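/- Let $\Sigma$ be an infinite set of labels with a total order and a least element; labels are atomic, and comparing two labels or producing the least label takes constant time. **Trees and queries.** A tree is a finite rooted unordered tree with nodes labelled in $\Sigma$. A Boolean twig query is a finite rooted unordered tree with nodes labelled in $\Sigma\cup\{\star\}$, each edge being a child edge or a descendant edge. The size of a tree or a query is its number of nodes. An embedding of a query $p$ in a tree or query $q$ is a map of nodes that sends the root to the root, child edges to child edges, the two ends of a descendant edge to a node and a proper descendant of it, and a node with a label $a\ne\star$ to a node labelled $a$. Write $q\preccurlyeq p$ if there is an embedding of $p$ in $q$, let $\mathcal L(q)$ be the set of trees $t$ with $t\preccurlyeq q$, write $q\subseteq p$ for $\mathcal L(q)\subseteq\mathcal L(p)$, and call $p$, $q$ equivalent if $\mathcal L(p)=\mathcal L(q)$. **Classes.** A path query is a query in which every node has at most one child. It is (Boolean) anchored if every $\star$-node incident to a descendant edge is the root or the leaf, and a $\star$-leaf is not the end of a child edge. A set of path queries is reduced if no two of its members are comparable under $\subseteq$. Let $\mathit{Paths}(q)$ be the family of the path queries on the paths from the root of $q$ to its leaves, one for each leaf. The query $q$ is path-subsumption-free, $q\in\mathit{PsfTwig}_0$,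 if all members of $\mathit{Paths}(q)$ are anchored and those of any two different leaves are incomparable under $\subseteq$. **Samples.** A sample is a finite nonempty set $S$ of trees; its size is the sum of the sizes of its trees. A query $q$ is consistent with $S$ if $S\subseteq\mathcal L(q)$. A minimal anchored path query for $S$ is an anchored path query $p$ consistent with $S$ such that no anchored path query $p'$ consistent with $S$ satisfies $\mathcal L(p')\subsetneq\mathcal L(p)$. **Fusions.** For a path query $p$ and a query $q$, a fusion of $p$ into $q$ is obtained by choosing a node $n$ of $p$ and an embedding $\lambda$ in $q$ of the part of $p$ from the root to $n$, and attaching the part of $p$ below $n$ to $q$ at $\lambda(n)$. The only fusion of $p$ into the empty query is $p$. To fuse a list of path queries with respect to $S$ is to start from the empty query and to fuse the members of the list one after the other, replacing the current query each time by some $\preccurlyeq$-minimal element of the set of those fusions that are consistent with $S$. **Theorem.** Boolean path-subsumption-free twig queries are learnable in polynomial time and data from positive examples. More precisely, there are a polynomial-time algorithm, the learner, and a polynomial $\mathit{poly}$ with the following properties. 1. (The learner.) On a sample $S$, the learner first infers in polynomial time a nonempty reduced set $P$ of minimal anchored path queries for $S$, and then fuses the members of $P$, in some order, with respect to $S$;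 the query so obtained is its answer. 2. (Soundness.) On every sample $S$, the learner returns a query in $\mathit{PsfTwig}_0$ consistent with $S$, or Null if there is no such query. 3. (Completeness.) For every $q\in\mathit{PsfTwig}_0$ there is a sample $\mathit{CS}_q\subseteq\mathcal L(q)$ of size at most $\mathit{poly}(|q|)$ such that for every sample $S$ with $\mathit{CS}_q\subseteq S\subseteq\mathcal L(q)$ (the first inclusion up to isomorphism of trees): - the learner returns on $S$ a query equivalent to $q$; - the set $P$ inferred by the learner consists of all the minimal anchored path queries for $S$, and equals $\mathit{Paths}(q)$; - in whatever order the members of $\mathit{Paths}(q)$ are fused with respect to $S$, at every step there is, up to isomorphism, exactly one $\preccurlyeq$-minimal element in the set of consistent fusions, and the result is isomorphic to $q$. Here the running time is that of while-programs over binary trees with leaves in $\Sigma\cup\{\mathrm{nil}\}$, where each basic operation (constants, projections, test for a label, comparison of two labels) costs the size of its argument and every other construct costs one step plus the costs of its parts, and a while-loop is also charged the size of its data when it stops. -/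

import Mathlib

/-! ## Trees and Boolean twig queries -/

/-- The two kinds of edges of a twig query: child edges and descendant edges. -/
inductive Edge : Type
  | child
  | desc

/-- A Boolean twig query over the labels `A`: the label of the root (`none` is the wildcard) and the
list of the subqueries below it, each with the kind of the edge that leads to it. Queries are
unordered: the order of the list carries no meaning, see `Twig.Iso`. -/
inductive Twig (A : Type*) : Type _
  | node (lab : Option A) (kids : List (Edge × Twig A)) : Twig A

namespace Twig

variable {A : Type*}

/-- The label of the root. -/
def rootLab : Twig A → Option A
  | node l _ => l

/-- The subqueries below the root, with the edges leading to them. -/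
def kids : Twig A → List (Edge × Twig A)
  | node _ ks => ks

mutual
/-- The size of a query is its number of nodes. -/
def size : Twig A → ℕ
  | node _ ks => 1 + sizeKids ks
/-- The total number of nodes of a list of subqueries. -/
def sizeKids : List (Edge × Twig A) → ℕ
  | [] => 0
  | (_, c) :: ks => size c + sizeKids ks
end

/-- The subquery at an address; the address of a node lists the positions of the children to descend
to, starting at the root. -/
def at? : Twig A → List ℕ → Option (Twig A)
  | q, [] => some q
  | node _ ks, i :: v =>
    match ks[i]? with
    | none => none
    | some k => at? k.2 v

/-- The nodes of a query, as the valid addresses. -/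
def Node (q : Twig A) : Type := {v : List ℕ // (q.at? v).isSome}

/-- The root node. -/
def root (q : Twig A) : q.Node := ⟨[], by cases q; rfl⟩

/-- The subquery rooted at a node. -/
def sub (q : Twig A) (v : q.Node) : Twig A := (q.at? v.1).get v.2

/-- The label of a node. -/
def lab (q : Twig A) (v : q.Node) : Option A := (q.sub v).rootLab

/-- There is an edge of kind `e` from the node `v` to the node `w`. -/
def HasEdge (q : Twig A) (e : Edge) (v w : q.Node) : Prop :=
  ∃ i c, w.1 = v.1 ++ [i] ∧ (q.sub v).kids[i]? = some (e, c)

/-- The node `w` is a proper descendant of the node `v`. -/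
def Below (q : Twig A) : q.Node → q.Node → Prop :=
  Relation.TransGen fun v w => ∃ e, q.HasEdge e v w

/-- A node without outgoing edges. -/
def IsLeaf (q : Twig A) (v : q.Node) : Prop := (q.sub v).kids = []

/-- The label `x` matches the label `y`. -/
def Matches (x y : Option A) : Prop := y ≠ none → x = y

/-- `f` is an embedding of the query `p` in the query `q`. -/
structure IsEmbedding (p q : Twig A) (f : p.Node → q.Node) : Prop where
  root : f p.root = q.root
  child : ∀ v w, p.HasEdge .child v w → q.HasEdge .child (f v) (f w)
  desc : ∀ v w, p.HasEdge .desc v w → q.Below (f v) (f w)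
  lab : ∀ v, Matches (q.lab (f v)) (p.lab v)

/-- `p` subsumes `q`, written `q ≼ p`: there is an embedding of `p` in `q`. -/
def Subsumed (q p : Twig A) : Prop := ∃ f : p.Node → q.Node, IsEmbedding p q f

/-- Isomorphism of queries as labelled graphs with two kinds of edges. -/
def Iso (p q : Twig A) : Prop :=
  ∃ f : p.Node ≃ q.Node, f p.root = q.root ∧ (∀ v, q.lab (f v) = p.lab v) ∧
    ∀ e v w, p.HasEdge e v w ↔ q.HasEdge e (f v) (f w)

/-- A tree is a query without wildcards and without descendant edges. For a tree `t`, the embeddings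
of a query `q` in `t` as a query are the embeddings of `q` in the tree `t`. -/
def IsTree (t : Twig A) : Prop :=
  (∀ v, t.lab v ≠ none) ∧ ∀ v w, ¬ t.HasEdge .desc v w

end Twig

/-- Trees with labels in `A`. -/
abbrev Tree₀ (A : Type*) : Type _ := {t : Twig A // t.IsTree}

infix:50 " ≼ " => Twig.Subsumed
infix:50 " ≅ₜ " => Twig.Iso

namespace Twig

variable {A : Type*}

/-- The language of a query: the trees in which it embeds. -/
def language (q : Twig A) : Set (Tree₀ A) := {t | t.1 ≼ q}

/-- Containment of queries. -/
def Contained (q p : Twig A) : Prop := q.language ⊆ p.language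

/-- Equivalence of queries. -/
def Equivalent (q p : Twig A) : Prop := q.Contained p ∧ p.Contained q

/-! ## Anchored path queries and path-subsumption-free twig queries -/

/-- A path query: every node has at most one child. -/
def IsPath (p : Twig A) : Prop := ∀ v, (p.sub v).kids.length ≤ 1

/-- A Boolean anchored path query: a path query in which a wildcard node that is incident to a
descendant edge is the root or the leaf, and a wildcard leaf is not entered by a child edge. -/
structure IsAnchoredPath (p : Twig A) : Prop where
  path : p.IsPath
  desc : ∀ v w, p.HasEdge .desc v w →
    (p.lab v = none → v = p.root ∨ p.IsLeaf v) ∧ (p.lab w = none → w = p.root ∨ p.IsLeaf w)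
  leaf : ∀ v w, p.HasEdge .child v w → p.IsLeaf w → p.lab w ≠ none

mutual
/-- The path queries from the root to the leaves, one for each leaf. -/
def paths : Twig A → List (Twig A)
  | node l [] => [node l []]
  | node l (k :: ks) => (pathsKids (k :: ks)).map fun k => node l [k]
/-- The paths of a list of subqueries, with the edges leading to them. -/
def pathsKids : List (Edge × Twig A) → List (Edge × Twig A)
  | [] => []
  | (e, c) :: ks => (paths c).map (fun p => (e, p)) ++ pathsKids ks
end

/-- A reduced family of path queries: no two of them are comparable under containment. -/
def Reduced (P : List (Twig A)) : Prop :=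
  P.Pairwise fun p p' => ¬ p.Contained p' ∧ ¬ p'.Contained p

/-- A path-subsumption-free Boolean twig query: the root-to-leaf path queries are anchored, and those
of different leaves are incomparable. -/
structure IsPsf (q : Twig A) : Prop where
  anchored : ∀ p ∈ q.paths, IsAnchoredPath p
  reduced : Reduced q.paths

/-! ## Fusions -/

/-- Attach the subqueries `new` at the node with the given address. -/
def attach : Twig A → List ℕ → List (Edge × Twig A) → Twig A
  | node l ks, [], new => node l (ks ++ new)
  | node l ks, i :: v, new => node l (ks.modify i fun k => (k.1, attach k.2 v new))

/-- The path query from the root to the node with the given address. -/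
def cut : Twig A → List ℕ → Twig A
  | node l _, [] => node l []
  | node l ks, i :: v =>
    match ks[i]? with
    | none => node l []
    | some k => node l [(k.1, cut k.2 v)]

/-- `q'` is a fusion of the path query `p` into the query `q`: for a node `n` of `p`, the upper part
`p₁` of the split of `p` at `n` embeds in `q` by some `f`, and `q'` arises from `q` by attaching the
lower part at the image of `n` (the label of `n` in the lower part is ignored). All the nodes of a
path query have addresses consisting of zeros, hence `n` has the same address in `p` and `p₁`. -/
def IsFusion (p q q' : Twig A) : Prop :=
  ∃ (n : p.Node) (f : (p.cut n.1).Node → q.Node) (n₁ : (p.cut n.1).Node),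
    n₁.1 = n.1 ∧ IsEmbedding (p.cut n.1) q f ∧ q' = q.attach (f n₁).1 (p.sub n).kids

/-- The fusions of `p` into `q`, where `none` is the phantom empty query. -/
def Fusions (p : Twig A) : Option (Twig A) → Set (Twig A)
  | none => {p}
  | some q => {q' | IsFusion p q q'}

end Twig

/-! ## Samples -/

/-- A sample: finitely many, and at least one, trees, listed in any order. -/
abbrev Sample (A : Type*) : Type _ := {S : List (Tree₀ A) // S ≠ []}

namespace Sample

variable {A : Type*}

/-- The size of a sample is the sum of the sizes of its trees. -/
def size (S : Sample A) : ℕ := (S.1.map fun t => t.1.size).sum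

/-- The sample `S` is consistent with the query `q`. -/
def Consistent (S : Sample A) (q : Twig A) : Prop := ∀ t ∈ S.1, t ∈ q.language

/-- The sample `S` extends the sample `C`: every tree of `C` is, up to isomorphism, in `S`. -/
def Extends (S C : Sample A) : Prop := ∀ t ∈ C.1, ∃ t' ∈ S.1, t.1 ≅ₜ t'.1

/-- `q` is a minimal query in the class `Q` consistent with `S` (minimal for containment). -/
def IsMinimalIn (S : Sample A) (Q : Set (Twig A)) (q : Twig A) : Prop :=
  q ∈ Q ∧ S.Consistent q ∧
    ¬ ∃ q' ∈ Q, q'.Contained q ∧ ¬ q'.Equivalent q ∧ S.Consistent q'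

/-- The fusions of `p` into `q` that are consistent with `S`. -/
def Candidates (S : Sample A) (p : Twig A) (q : Option (Twig A)) : Set (Twig A) :=
  {q' | q' ∈ Twig.Fusions p q ∧ S.Consistent q'}

/-- `q'` is a `≼`-minimal one among the fusions of `p` into `q` that are consistent with `S`. -/
def IsBestFusion (S : Sample A) (p : Twig A) (q : Option (Twig A)) (q' : Twig A) : Prop :=
  q' ∈ S.Candidates p q ∧ ∀ r ∈ S.Candidates p q, r ≼ q' → q' ≼ r

/-- The fusion loop: `S.FusionRun q P r` says that `r` can be reached from `q` by fusing into it the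
elements of `P` one after the other, each time choosing any `≼`-minimal consistent fusion. -/
inductive FusionRun (S : Sample A) : Option (Twig A) → List (Twig A) → Option (Twig A) → Prop
  | done (q : Option (Twig A)) : FusionRun S q [] q
  | step {q : Option (Twig A)} {p q' : Twig A} {P : List (Twig A)} {r : Option (Twig A)} :
      S.IsBestFusion p q q' → FusionRun S (some q') P r → FusionRun S q (p :: P) r

end Sample

/-! ## The machine model

Programs work on binary trees whose leaves are `nil` or labels. As labels are atomic data, programs
can compare two labels, and produce the least label, in one step. -/

/-- The data of programs. -/
inductive Data (A : Type*) : Type _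
  | nil : Data A
  | atom (a : A) : Data A
  | cons (x y : Data A) : Data A

namespace Data

variable {A : Type*}

/-- The number of constructors. -/
def size : Data A → ℕ
  | nil => 1
  | atom _ => 1
  | cons x y => 1 + size x + size y

/-- The truth value `true`; `nil` serves as `false`. -/
def yes : Data A := cons nil nil

/-- The encoding of lists. -/
def ofList : List (Data A) → Data A
  | [] => nil
  | x :: xs => cons x (ofList xs)

end Data

/-- The basic operations of programs. -/
inductive Op : Type
  | id
  | nil
  | least
  | fst
  | snd
  | isAtom
  | le

/-- The result of a basic operation. -/
def Op.apply {A : Type*} [LinearOrder A] [OrderBot A] : Op → Data A → Data A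
  | .id, x => x
  | .nil, _ => .nil
  | .least, _ => .atom ⊥
  | .fst, .cons x _ => x
  | .snd, .cons _ y => y
  | .isAtom, .atom _ => .yes
  | .le, .cons (.atom a) (.atom b) => if a ≤ b then .yes else .nil
  | _, _ => .nil

/-- Programs: while-programs with one variable. -/
inductive Prog : Type
  | op (o : Op) : Prog
  | pair (f g : Prog) : Prog
  | seq (f g : Prog) : Prog
  | ite (c f g : Prog) : Prog
  | while (c f : Prog) : Prog

/-- `f.Eval x y n` says that the program `f` halts on the input `x` with the output `y` after time
`n`. A basic operation takes as long as it takes to read its input; everything else takes one step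
plus the times of its parts (and, for a loop that stops, the time to read its data). In particular,
the size of the output is at most three times the time. -/
inductive Prog.Eval {A : Type*} [LinearOrder A] [OrderBot A] :
    Prog → Data A → Data A → ℕ → Prop
  | op (o : Op) (x : Data A) : Eval (.op o) x (o.apply x) x.size
  | pair {f g : Prog} {x y z : Data A} {m n : ℕ} :
      Eval f x y m → Eval g x z n → Eval (.pair f g) x (.cons y z) (m + n + 1)
  | seq {f g : Prog} {x y z : Data A} {m n : ℕ} :
      Eval f x y m → Eval g y z n → Eval (.seq f g) x z (m + n + 1)
  | ite_true {c f g : Prog} {x b y : Data A} {m n : ℕ} :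
      Eval c x b m → b ≠ .nil → Eval f x y n → Eval (.ite c f g) x y (m + n + 1)
  | ite_false {c f g : Prog} {x y : Data A} {m n : ℕ} :
      Eval c x .nil m → Eval g x y n → Eval (.ite c f g) x y (m + n + 1)
  | while_stop {c f : Prog} {x : Data A} {m : ℕ} :
      Eval c x .nil m → Eval (.while c f) x x (m + x.size + 1)
  | while_step {c f : Prog} {x b y z : Data A} {m n k : ℕ} :
      Eval c x b m → b ≠ .nil → Eval f x y n → Eval (.while c f) y z k →
      Eval (.while c f) x z (m + n + k + 1)

/-! ## Encodings -/

/-- The encoding of edges. -/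
def Edge.enc {A : Type*} : Edge → Data A
  | .child => .nil
  | .desc => .yes

/-- The encoding of node labels. -/
def encLab {A : Type*} : Option A → Data A
  | none => .nil
  | some a => .atom a

namespace Twig

variable {A : Type*}

mutual
/-- The encoding of queries, and in particular of trees. -/
def enc : Twig A → Data A
  | node l ks => .cons (encLab l) (encKids ks)
/-- The encoding of lists of subqueries. -/
def encKids : List (Edge × Twig A) → Data A
  | [] => .nil
  | (e, c) :: ks => .cons (.cons e.enc (enc c)) (encKids ks)
end

end Twig

/-- The encoding of the answers of a learner; `none` is the special value Null. -/
def encAnswer {A : Type*} : Option (Twig A) → Data A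
  | none => .nil
  | some q => q.enc

/-- The encoding of samples. -/
def Sample.enc {A : Type*} (S : Sample A) : Data A := Data.ofList (S.1.map fun t => t.1.enc)

/-! ## Learning -/

/-- The program `M` computes the function `g` on samples, with results encoded by `e`, in time at
most `T` of the size of the sample. -/
def ComputesInTime {A B : Type*} [LinearOrder A] [OrderBot A] (M : Prog) (T : Polynomial ℕ)
    (e : B → Data A) (g : Sample A → B) : Prop :=
  ∀ S : Sample A, ∃ n ≤ T.eval S.size, M.Eval S.enc (e (g S)) n

/-- Soundness: on every sample the learner returns a query of the class `Q` consistent with the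
sample, or Null if there is none. -/
def IsSound {A : Type*} (Q : Set (Twig A)) (learner : Sample A → Option (Twig A)) : Prop :=
  ∀ S : Sample A, (∀ q, learner S = some q → q ∈ Q ∧ S.Consistent q) ∧
    (learner S = none → ¬ ∃ q ∈ Q, S.Consistent q)

/-- `C` is a characteristic sample for `q`: it consists of examples of `q`, and on every sample that
extends `C` consistently with `q` the learner returns a query equivalent to `q`. -/
def IsCharacteristic {A : Type*} (learner : Sample A → Option (Twig A)) (q : Twig A)
    (C : Sample A) : Prop :=
  C.Consistent q ∧ ∀ S : Sample A, S.Extends C → S.Consistent q →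
    ∃ q', learner S = some q' ∧ q'.Equivalent q

/-- The class of path-subsumption-free Boolean twig queries. -/
def PsfTwig₀ (A : Type*) : Set (Twig A) := {q | q.IsPsf}

/-- The class of Boolean anchored path queries. -/
def AnchPath₀ (A : Type*) : Set (Twig A) := {p | p.IsAnchoredPath}

/-! ## Polynomial time computable functions -/

namespace Polynomial

-- Canonical trees. Fill the wildcards of `q` with a label `z` and replace its descendant edges by
-- chains of `k` nodes labelled `z`. Let an anchored query `p` without the label `z` and of depth at
-- most `k` embed in this tree. A node of `p` on a chain must be a wildcard. If a descendant edge
-- leads to it, it is a leaf and can slide down to the end of the chain. If a child edge leads to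
-- it, only child edges to further wildcards can follow until a label is met, and the chain is too
-- long for that. So `p` embeds in `q` (`Match.of_canon`). A second tree, with `k = 0` and another
-- label `z'`, enforces the conditions on the labels and the depth of `p` (`Match.of_canons`). It
-- follows that containment in an anchored query is the existence of an embedding (`contained_iff`),
-- and that the two trees form a sample of quadratic size such that every anchored query consistent
-- with it embeds in `q` (`Sample.characterizes`). The minimal anchored path queries are then
-- exactly the paths of `q` (`Characterizes.minPath_iff`).
--
-- Inference. Path queries are treated as words. Every proper anchored specialization of a path
-- query passes through an elementary one (`PE.eq_or_exists_spec`), hence a path query without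
-- consistent elementary specialization is minimal. Polynomially many elementary specializations can
-- fit a given tree, and a weight bounds the length of a chain of them, so greedy specialization
-- takes polynomial time (`greedy_spec`). To find all the minimal path queries and not only some,
-- the search is run once for each path of each tree, at first with this path added to the sample as
-- a tree. On the path of the canonical tree that belongs to a leaf of `q`, this yields the path
-- query of that leaf (`Sample.mem_infer_iff`).
--
-- Fusion. Minimality makes paths rigid. When a minimal path query is fused into a query whose paths
-- are all minimal, the upper part and its image have the same word, as otherwise a more specific
-- consistent path query would arise. The consistent fusions are therefore found among polynomially
-- many pairs of nodes (`Sample.mem_candidates`). Fusing at the root is always consistent, and the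
-- invariant `Good` is preserved. It implies soundness (`Good.isPsf`).
--
-- Uniqueness. An embedding between good queries sends each path to the path with the same word.
-- Good queries with the same words are thus ordered by which of their paths share which nodes, and
-- equal sharing means isomorphism (`Good.sharesLe`, `SharesLe.match`, `SharesLe.iso`). When the
-- sample contains the characteristic one, everything consistent embeds in `q`, so no fusion shares
-- more than `q`; some fusion shares exactly as much (`Good.exists_shares`). That one is least,
-- hence the only minimal one up to isomorphism (`Sample.Faithful.step`).
--
-- Running times. Programs are never written out for the learner: `PolyTime` is closed under
-- composition, pairing, case distinction and folds with bounded accumulators, and embeddings are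
-- tested by dynamic programming over pairs of subqueries (`emb_eq_true`).

theorem eval_le_eval_nat (P : Polynomial ℕ) {m n : ℕ} (h : m ≤ n) : P.eval m ≤ P.eval n := by
  rw [eval_eq_sum_range, eval_eq_sum_range]
  gcongr

end Polynomial

namespace Data

variable {A : Type*}

theorem one_le_size (x : Data A) : 1 ≤ x.size := by
  cases x <;> simp [size] <;> omega

end Data

/-- Encodings of the elements of a type as data. -/
class Code (A : Type*) (α : Type*) where
  /-- The encoding. -/
  code : α → Data A
  inj : Function.Injective code

open Code

section Instances

variable {A : Type*} {α β : Type*}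

instance : Code A (Data A) := ⟨id, Function.injective_id⟩

instance : Code A Bool :=
  ⟨fun b => if b then .yes else .nil, fun a b h => by cases a <;> cases b <;> simp_all [Data.yes]⟩

instance : Code A Edge :=
  ⟨Edge.enc, fun a b h => by cases a <;> cases b <;> simp_all [Data.yes, Edge.enc]⟩

instance : Code A (Option A) :=
  ⟨encLab, fun a b h => by cases a <;> cases b <;> simp_all [encLab]⟩

instance : Code A Unit := ⟨fun _ => .nil, fun _ _ _ => rfl⟩

instance [Code A α] [Code A β] : Code A (α × β) :=
  ⟨fun x => .cons (code x.1) (code x.2), fun x y h => by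
    simp only [Data.cons.injEq] at h
    exact Prod.ext (Code.inj h.1) (Code.inj h.2)⟩

theorem Data.ofList_injective : Function.Injective (Data.ofList (A := A)) := by
  intro x
  induction x with
  | nil => intro y; cases y <;> simp [Data.ofList]
  | cons a x ih => intro y; cases y with
    | nil => simp [Data.ofList]
    | cons b y =>
      simp only [Data.ofList, Data.cons.injEq, List.cons.injEq]
      exact fun h => ⟨h.1, ih h.2⟩

instance [Code A α] : Code A (List α) :=
  ⟨fun l => Data.ofList (l.map code), fun _ _ h =>
    (List.map_injective_iff.2 Code.inj) (Data.ofList_injective h)⟩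

namespace Twig

theorem encKids_eq (ks : List (Edge × Twig A)) :
    encKids ks = Data.ofList (ks.map fun k => .cons k.1.enc k.2.enc) := by
  induction ks with
  | nil => simp [encKids, Data.ofList]
  | cons k ks ih => obtain ⟨e, c⟩ := k; simp [encKids, Data.ofList, ih]

/-- Induction on queries. -/
@[elab_as_elim]
theorem ind {P : Twig A → Prop} (h : ∀ l ks, (∀ k ∈ ks, P k.2) → P (node l ks)) : ∀ q, P q := by
  intro q
  induction q using Twig.rec (motive_2 := fun ks => ∀ k ∈ ks, P k.2)
    (motive_3 := fun k => P k.2) with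
  | node l ks ih => exact h l ks ih
  | nil => rename_i h; cases h
  | cons k ks ih1 ih2 =>
    rename_i h
    rcases List.mem_cons.1 h with rfl | h
    exacts [ih1, ih2 _ h]
  | mk e c ih => exact ih

theorem enc_injective : Function.Injective (enc (A := A)) := by
  intro p
  induction p using ind with
  | h l ks ih =>
    rintro ⟨l', ks'⟩ h
    simp only [enc, Data.cons.injEq] at h
    have hl : l = l' := Code.inj (A := A) h.1
    have h2 := h.2
    rw [encKids_eq, encKids_eq] at h2
    have h3 := Data.ofList_injective h2
    clear h h2
    subst hl
    congr 1
    induction ks generalizing ks' with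
    | nil => cases ks' <;> simp_all
    | cons k ks ih2 => cases ks' with
      | nil => simp at h3
      | cons k' ks' =>
        simp only [List.map_cons, List.cons.injEq, Data.cons.injEq] at h3
        rw [ih2 (fun k hk => ih k (by simp [hk])) ks' h3.2]
        congr 1
        exact Prod.ext (Code.inj (A := A) h3.1.1) (ih k (by simp) h3.1.2)

end Twig

instance : Code A (Twig A) := ⟨Twig.enc, Twig.enc_injective⟩

instance : Code A (Option (Twig A)) :=
  ⟨encAnswer, fun a b h => by
    rcases a with _ | ⟨la, ka⟩ <;> rcases b with _ | ⟨lb, kb⟩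
    · rfl
    · simp [encAnswer, Twig.enc] at h
    · simp [encAnswer, Twig.enc] at h
    · exact congrArg some (Twig.enc_injective h)⟩

/-- The size of the code. -/
def csize (A : Type*) {α : Type*} [Code A α] (x : α) : ℕ := (code x : Data A).size

variable [Code A α] [Code A β]

theorem one_le_csize (x : α) : 1 ≤ csize A x := Data.one_le_size _

@[simp] theorem csize_prod (x : α × β) : csize A x = 1 + csize A x.1 + csize A x.2 := rfl

@[simp] theorem csize_nil : csize A ([] : List α) = 1 := rfl

@[simp] theorem csize_cons (a : α) (l : List α) :
    csize A (a :: l) = 1 + csize A a + csize A l := rfl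

theorem csize_bool_le (b : Bool) : csize A b ≤ 3 := by
  cases b <;> simp [csize, code, Data.yes, Data.size]

theorem csize_edge_le (e : Edge) : csize A e ≤ 3 := by
  cases e <;> simp [csize, code, Data.yes, Data.size, Edge.enc]

@[simp] theorem csize_lab (l : Option A) : csize A l = 1 := by
  cases l <;> rfl

@[simp] theorem csize_unit (l : Unit) : csize A l = 1 := rfl

theorem code_node (l : Option A) (ks : List (Edge × Twig A)) :
    (code (Twig.node l ks) : Data A) = .cons (code l) (code ks) := by
  simp only [code, Twig.enc, Twig.encKids_eq]

theorem csize_node (l : Option A) (ks : List (Edge × Twig A)) :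
    csize A (Twig.node l ks) = 2 + csize A ks := by
  rw [csize, code_node, Data.size]
  change 1 + csize A l + csize A ks = _
  simp

theorem csize_eq_sum (l : List α) : csize A l = 1 + (l.map fun a => 1 + csize A a).sum := by
  induction l with
  | nil => rfl
  | cons a l ih => simp [ih]; omega

theorem csize_append (l l' : List α) : csize A (l ++ l') + 1 = csize A l + csize A l' := by
  simp [csize_eq_sum]; omega

theorem csize_sublist {l l' : List α} (h : l.Sublist l') : csize A l ≤ csize A l' := by
  induction h with
  | slnil => rfl
  | cons a h ih => simp; omega
  | cons_cons a h ih => simp; omega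

theorem csize_reverse (l : List α) : csize A l.reverse = csize A l := by
  simp [csize_eq_sum, List.sum_reverse]

theorem length_lt_csize (l : List α) : l.length < csize A l := by
  induction l with
  | nil => simp
  | cons a l ih => simp; omega

theorem csize_le_of_mem {l : List α} {a : α} (h : a ∈ l) : csize A a ≤ csize A l := by
  induction l with
  | nil => simp at h
  | cons b l ih =>
    simp only [List.mem_cons] at h
    rcases h with rfl | h
    · simp; omega
    · have := ih h; simp; omega

theorem csize_le_of_forall {l : List α} {n : ℕ} (h : ∀ a ∈ l, csize A a ≤ n) :
    csize A l ≤ 1 + l.length * (1 + n) := by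
  induction l with
  | nil => simp
  | cons b l ih =>
    have h1 := ih fun a ha => h a (by simp [ha])
    have h2 := h b (by simp)
    simp [add_mul]; omega

end Instances

/-- This is what makes composition polynomial: a time bound also bounds the input of the next
program. The factor is 3 because a test can answer `Data.yes`, of size 3, to an argument of size 1.
-/
theorem Prog.Eval.size_le {A : Type*} [LinearOrder A] [OrderBot A] {f : Prog} {x y : Data A}
    {n : ℕ} (h : f.Eval x y n) : y.size ≤ 3 * n := by
  induction h with
  | op o x =>
    have := x.one_le_size
    unfold Op.apply
    split <;> (try split) <;> simp [Data.size, Data.yes] at * <;> omega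
  | pair => simp only [Data.size] at *; omega
  | _ => omega

/-- The function `f` is computable in polynomial time. -/
@[fun_prop]
def PolyTime (A : Type*) [LinearOrder A] [OrderBot A] {α β : Type*} [Code A α] [Code A β]
    (f : α → β) : Prop :=
  ∃ (M : Prog) (T : Polynomial ℕ), ∀ x, ∃ n ≤ T.eval (csize A x),
    M.Eval (code x : Data A) (code (f x)) n

-- Closure properties of polynomial time computability.

namespace PolyTime

variable {A : Type*} [LinearOrder A] [OrderBot A] {α β γ δ σ : Type*}
  [Code A α] [Code A β] [Code A γ] [Code A δ] [Code A σ]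

open Polynomial

theorem bound {f : α → β} (h : PolyTime A f) :
    ∃ B : Polynomial ℕ, ∀ x, csize A (f x) ≤ B.eval (csize A x) := by
  obtain ⟨M, T, h⟩ := h
  refine ⟨3 * T, fun x => ?_⟩
  obtain ⟨n, hn, he⟩ := h x
  have := he.size_le
  simp [csize] at *
  omega

theorem of_op (o : Op) {f : α → β} (h : ∀ x, (code (f x) : Data A) = o.apply (code x)) :
    PolyTime A f :=
  ⟨.op o, X, fun x => ⟨_, by simp [csize], h x ▸ Prog.Eval.op o _⟩⟩

/-- Change of the types along equal codes. -/
theorem of_code_eq {f : α → β} {g : γ → δ} (hf : PolyTime A f) (u : γ → α)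
    (hu : ∀ x, (code x : Data A) = code (u x)) (h : ∀ x, (code (g x) : Data A) = code (f (u x))) :
    PolyTime A g := by
  obtain ⟨M, T, hM⟩ := hf
  refine ⟨M, T, fun x => ?_⟩
  obtain ⟨n, hn, he⟩ := hM (u x)
  refine ⟨n, ?_, ?_⟩
  · simpa [csize, hu] using hn
  · rw [hu, h]; exact he

@[fun_prop]
theorem id : PolyTime A (fun x : α => x) := of_op .id fun _ => rfl

@[fun_prop]
theorem comp {f : β → γ} {g : α → β} (hf : PolyTime A f) (hg : PolyTime A g) :
    PolyTime A (fun x => f (g x)) := by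
  obtain ⟨M, T, hM⟩ := hf
  obtain ⟨M', T', hM'⟩ := hg
  refine ⟨.seq M' M, T' + T.comp (3 * T') + 1, fun x => ?_⟩
  obtain ⟨m, hm, em⟩ := hM' x
  obtain ⟨n, hn, en⟩ := hM (g x)
  refine ⟨_, ?_, em.seq en⟩
  have h1 : csize A (g x) ≤ 3 * T'.eval (csize A x) := em.size_le.trans (by omega)
  have h2 := T.eval_le_eval_nat h1
  simp [eval_comp]
  omega

@[fun_prop]
theorem pair {f : α → β} {g : α → γ} (hf : PolyTime A f) (hg : PolyTime A g) :
    PolyTime A (fun x => (f x, g x)) := by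
  obtain ⟨M, T, hM⟩ := hf
  obtain ⟨M', T', hM'⟩ := hg
  refine ⟨.pair M M', T + T' + 1, fun x => ?_⟩
  obtain ⟨m, hm, em⟩ := hM x
  obtain ⟨n, hn, en⟩ := hM' x
  exact ⟨_, by simp; omega, em.pair en⟩

@[fun_prop]
theorem fst {f : α → β × γ} (hf : PolyTime A f) : PolyTime A (fun x => (f x).1) :=
  comp (of_op .fst fun _ => rfl) hf

@[fun_prop]
theorem snd {f : α → β × γ} (hf : PolyTime A f) : PolyTime A (fun x => (f x).2) :=
  comp (of_op .snd fun _ => rfl) hf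

@[fun_prop]
theorem cond {c : α → Bool} {f g : α → β} (hc : PolyTime A c) (hf : PolyTime A f)
    (hg : PolyTime A g) : PolyTime A (fun x => bif c x then f x else g x) := by
  obtain ⟨C, U, hC⟩ := hc
  obtain ⟨M, T, hM⟩ := hf
  obtain ⟨M', T', hM'⟩ := hg
  refine ⟨.ite C M M', U + T + T' + 1, fun x => ?_⟩
  obtain ⟨k, hk, ek⟩ := hC x
  obtain ⟨m, hm, em⟩ := hM x
  obtain ⟨n, hn, en⟩ := hM' x
  cases h : c x
  · rw [h] at ek
    simp only [h, cond_false]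
    exact ⟨_, by simp; omega, .ite_false ek en⟩
  · rw [h] at ek
    simp only [h, cond_true]
    exact ⟨_, by simp; omega, .ite_true ek (by simp [code, Data.yes]) em⟩

@[fun_prop]
theorem ite {c : α → Prop} [DecidablePred c] {f g : α → β} (hc : PolyTime A fun x => decide (c x))
    (hf : PolyTime A f) (hg : PolyTime A g) : PolyTime A (fun x => if c x then f x else g x) := by
  convert cond hc hf hg using 2 with x
  by_cases h : c x <;> simp [h]

@[fun_prop]
theorem const_nil : PolyTime A (fun _ : α => (Data.nil : Data A)) := of_op .nil fun _ => rfl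

@[fun_prop]
theorem const_false : PolyTime A (fun _ : α => false) := of_op .nil fun _ => rfl

@[fun_prop]
theorem const_true : PolyTime A (fun _ : α => true) :=
  of_code_eq (pair const_nil const_nil) _root_.id (fun _ => rfl) (fun _ => rfl)

@[fun_prop]
theorem nil : PolyTime A (fun _ : α => ([] : List β)) := of_op .nil fun _ => rfl

@[fun_prop]
theorem cons {f : α → β} {g : α → List β} (hf : PolyTime A f) (hg : PolyTime A g) :
    PolyTime A (fun x => f x :: g x) :=
  of_code_eq (pair hf hg) _root_.id (fun _ => rfl) (fun _ => rfl)

@[fun_prop]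
theorem not {c : α → Bool} (hc : PolyTime A c) : PolyTime A (fun x => !c x) := by
  convert cond hc const_false const_true using 2 with x
  cases c x <;> rfl

@[fun_prop]
theorem and {c d : α → Bool} (hc : PolyTime A c) (hd : PolyTime A d) :
    PolyTime A (fun x => c x && d x) := by
  convert cond hc hd const_false using 2 with x
  cases c x <;> rfl

@[fun_prop]
theorem or {c d : α → Bool} (hc : PolyTime A c) (hd : PolyTime A d) :
    PolyTime A (fun x => c x || d x) := by
  convert cond hc const_true hd using 2 with x
  cases c x <;> rfl

/-- The test for the code `nil`. -/
theorem isNil {f : α → β} {c : α → Bool} (hf : PolyTime A f)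
    (h : ∀ x, (code (f x) : Data A) = .nil ↔ c x = false) : PolyTime A c := by
  obtain ⟨M, T, hM⟩ := hf
  obtain ⟨M', T', hM'⟩ := const_true (A := A) (α := α)
  refine ⟨.ite M M' (.op .nil), T + T' + X + 1, fun x => ?_⟩
  obtain ⟨m, hm, em⟩ := hM x
  obtain ⟨n, hn, en⟩ := hM' x
  cases hc : c x
  · rw [(h x).2 hc] at em
    exact ⟨_, by simp [csize] at *; omega, .ite_false em (.op .nil _)⟩
  · exact ⟨_, by simp; omega, .ite_true em (by simp [h, hc]) en⟩

@[fun_prop]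
theorem isDesc {f : α → Edge} (hf : PolyTime A f) :
    PolyTime A (fun x => match f x with | .child => false | .desc => true) :=
  isNil hf fun x => by cases f x <;> simp [code, Edge.enc, Data.yes]

@[fun_prop]
theorem isSome {f : α → Option A} (hf : PolyTime A f) : PolyTime A (fun x => (f x).isSome) :=
  isNil hf fun x => by cases f x <;> simp [code, encLab]

@[fun_prop]
theorem isEmpty {f : α → List β} (hf : PolyTime A f) : PolyTime A (fun x => (f x).isEmpty) := by
  have : PolyTime A (fun x => !(f x).isEmpty) :=
    isNil hf fun x => by cases f x <;> simp [code, Data.ofList]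
  simpa using this.not

/-- The program for `l` runs twice in the nonempty case: once as the test, and once paired with the
input to supply the argument of `g`. A list is encoded as `nil` exactly if it is empty, so its code
serves as the truth value. -/
theorem listCase {l : α → List β} {f : α → γ} {g : α → β → List β → γ} (hl : PolyTime A l)
    (hf : PolyTime A f) (hg : PolyTime A fun y : α × β × List β => g y.1 y.2.1 y.2.2) :
    PolyTime A (fun x => match l x with | [] => f x | b :: t => g x b t) := by
  obtain ⟨C, U, hC⟩ := hl
  obtain ⟨M, T, hM⟩ := hf
  obtain ⟨M', T', hM'⟩ := hg
  refine ⟨.ite C (.seq (.pair (.op .id) C) M') M,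
    U + T + U + X + T'.comp (1 + X + 3 * U) + 5, fun x => ?_⟩
  obtain ⟨k, hk, ek⟩ := hC x
  obtain ⟨m, hm, em⟩ := hM x
  cases h : l x with
  | nil =>
    rw [h] at ek
    simp only [h]
    exact ⟨_, by simp; omega, .ite_false ek em⟩
  | cons b t =>
    rw [h] at ek
    simp only [h]
    obtain ⟨n, hn, en⟩ := hM' (x, b, t)
    refine ⟨_, ?_, .ite_true ek (by simp [code, Data.ofList]) ((Prog.Eval.pair (.op .id _) ek).seq en)⟩
    have h1 : csize A (x, b, t) ≤ 1 + csize A x + 3 * U.eval (csize A x) := by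
      have h1 := ek.size_le
      simp only [csize_prod]
      have h2 : Data.size (code (b :: t) : Data A) = 1 + csize A b + csize A t := rfl
      omega
    have h2 := T'.eval_le_eval_nat h1
    have h3 : Data.size (code x) = csize A x := rfl
    simp [eval_comp] at *
    omega

/-- Loops with polynomially many iterations and polynomially bounded states. -/
theorem loop {i : α → σ} {c : σ → Bool} {f : σ → σ} {N : α → ℕ} (hi : PolyTime A i)
    (hc : PolyTime A c) (hf : PolyTime A f) (B : Polynomial ℕ)
    (hN : ∀ x, N x ≤ B.eval (csize A x))
    (hB : ∀ x, ∀ n ≤ N x, csize A (f^[n] (i x)) ≤ B.eval (csize A x))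
    (hgo : ∀ x, ∀ n < N x, c (f^[n] (i x)) = true) (h_end : ∀ x, c (f^[N x] (i x)) = false) :
    PolyTime A (fun x => f^[N x] (i x)) := by
  obtain ⟨I, R, hI⟩ := hi
  obtain ⟨C, U, hC⟩ := hc
  obtain ⟨M, T, hM⟩ := hf
  refine ⟨.seq I (.while C M), R + (B + 1) * (U.comp B + T.comp B + B + 1) + 1, fun x => ?_⟩
  obtain ⟨m, hm, em⟩ := hI x
  obtain ⟨b, hb⟩ : ∃ b, b = B.eval (csize A x) := ⟨_, rfl⟩
  have hN := hN x
  have hB := hB x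
  rw [← hb] at hN hB
  -- Induction on the number `k` of remaining iterations, because the rule for a loop step puts an
  -- iteration in front of a completed run.
  have key : ∀ k ≤ N x, ∃ n ≤ (k + 1) * (U.eval b + T.eval b + b + 1),
      (Prog.while C M).Eval (code (f^[N x - k] (i x)) : Data A) (code (f^[N x] (i x))) n := by
    intro k
    induction k with
    | zero =>
      intro _
      obtain ⟨k, hk, ek⟩ := hC (f^[N x] (i x))
      rw [h_end] at ek
      refine ⟨_, ?_, Prog.Eval.while_stop ek⟩
      have h1 := hB (N x) le_rfl
      have h2 := U.eval_le_eval_nat h1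
      simp only [csize, Nat.sub_zero] at h1 h2 hk ⊢
      omega
    | succ k ih =>
      intro hk'
      obtain ⟨n, hn, en⟩ := ih (by omega)
      have h0 : f^[N x - k] (i x) = f (f^[N x - (k + 1)] (i x)) := by
        rw [← Function.iterate_succ_apply' f]
        congr 2
        omega
      obtain ⟨j, hj, ej⟩ := hC (f^[N x - (k + 1)] (i x))
      obtain ⟨l, hl, el⟩ := hM (f^[N x - (k + 1)] (i x))
      rw [hgo x _ (by omega)] at ej
      rw [h0] at en
      refine ⟨_, ?_, .while_step ej (by simp [code, Data.yes]) el en⟩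
      have h1 := hB (N x - (k + 1)) (by omega)
      have h2 := U.eval_le_eval_nat h1
      have h3 := T.eval_le_eval_nat h1
      rw [add_mul (k + 1) 1, one_mul]
      omega
  obtain ⟨n, hn, en⟩ := key (N x) le_rfl
  rw [Nat.sub_self] at en
  refine ⟨_, ?_, em.seq en⟩
  have h1 : (N x + 1) * (U.eval b + T.eval b + b + 1) ≤ (b + 1) * (U.eval b + T.eval b + b + 1) :=
    Nat.mul_le_mul_right _ (by omega)
  simp [eval_comp, ← hb]
  omega

/-- Left folds with polynomially bounded accumulators. -/
theorem foldl {l : α → List β} {i : α → γ} {f : α → γ → β → γ} (hl : PolyTime A l)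
    (hi : PolyTime A i) (hf : PolyTime A fun y : α × γ × β => f y.1 y.2.1 y.2.2)
    (B : Polynomial ℕ) (hB : ∀ x l', l' <+: l x → csize A (l'.foldl (f x) (i x)) ≤ B.eval (csize A x)) :
    PolyTime A (fun x => (l x).foldl (f x) (i x)) := by
  obtain ⟨P, hP⟩ := hl.bound
  -- The state carries the input along with the accumulator and the rest of the list, as `f` may
  -- depend on the input. After `n` steps the accumulator is the fold over a prefix, which is why
  -- the bound is required for prefixes only.
  let step : α × γ × List β → α × γ × List β := fun s =>
    match s.2.2 with | [] => s | b :: t => (s.1, f s.1 s.2.1 b, t)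
  have hstep : PolyTime A step := by
    refine listCase (l := fun s : α × γ × List β => s.2.2) (f := fun s => s)
      (g := fun s b t => (s.1, f s.1 s.2.1 b, t)) id.snd.snd id ?_
    exact pair id.fst.fst (pair (hf.comp (pair id.fst.fst (pair id.fst.snd.fst id.snd.fst)))
      id.snd.snd)
  have hit : ∀ x n, step^[n] (x, i x, l x) =
      (x, ((l x).take n).foldl (f x) (i x), (l x).drop n) := by
    intro x n
    induction n with
    | zero => simp
    | succ n ih =>
      rw [Function.iterate_succ_apply', ih]
      simp only [step]
      cases h : (l x).drop n with
      | nil =>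
        have : (l x).length ≤ n := by simpa using h
        simp [List.take_of_length_le, this, Nat.le_succ_of_le this]
      | cons b t =>
        have hn : n < (l x).length := by
          by_contra hn
          simp [List.drop_of_length_le (not_lt.1 hn)] at h
        rw [List.drop_eq_getElem_cons hn, List.cons.injEq] at h
        rw [List.take_succ_eq_append_getElem hn, List.foldl_append, h.1, h.2]
        simp
  have := loop (i := fun x => (x, i x, l x)) (c := fun s : α × γ × List β => !s.2.2.isEmpty)
    (f := step) (N := fun x => (l x).length) (pair id (pair hi hl)) id.snd.snd.isEmpty.not hstep
    (X + B + P + 2) (fun x => ?_) (fun x n hn => ?_) (fun x n hn => ?_) (fun x => ?_)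
  · simpa [hit] using this.snd.fst
  · have h1 := hP x
    have h2 := length_lt_csize (A := A) (l x)
    simp
    omega
  · have h1 := hP x
    have h2 := hB x _ (List.take_prefix n (l x))
    have h3 := csize_sublist (A := A) (List.drop_sublist n (l x))
    simp [hit]
    omega
  · simpa [hit] using hn
  · simp [hit]

end PolyTime

open Code

-- List operations in polynomial time.

namespace PolyTime

variable {A : Type*} [LinearOrder A] [OrderBot A] {α β γ δ σ : Type*}
  [Code A α] [Code A β] [Code A γ] [Code A δ] [Code A σ]

open Polynomial

@[fun_prop]
theorem reverse {l : α → List β} (hl : PolyTime A l) : PolyTime A (fun x => (l x).reverse) := by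
  have h : PolyTime A fun x => (l x).foldl (fun acc b => b :: acc) [] := by
    obtain ⟨P, hP⟩ := hl.bound
    refine foldl hl nil (f := fun _ acc b => b :: acc) (by fun_prop) P fun x l' h => ?_
    rw [List.foldl_flip_cons_eq_append', List.append_nil, csize_reverse]
    exact (csize_sublist h.sublist).trans (hP x)
  simpa using h

theorem foldr {l : α → List β} {i : α → γ} {f : α → β → γ → γ} (hl : PolyTime A l)
    (hi : PolyTime A i) (hf : PolyTime A fun y : α × γ × β => f y.1 y.2.2 y.2.1)
    (B : Polynomial ℕ) (hB : ∀ x l', l' <:+ l x → csize A (l'.foldr (f x) (i x)) ≤ B.eval (csize A x)) :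
    PolyTime A (fun x => (l x).foldr (f x) (i x)) := by
  have := foldl hl.reverse hi (f := fun x c b => f x b c) hf B fun x l' h => by
    have := hB x l'.reverse (by simpa using h.reverse)
    simpa using this
  simpa using this

theorem map {l : α → List β} {f : α → β → γ} (hl : PolyTime A l)
    (hf : PolyTime A fun y : α × β => f y.1 y.2) : PolyTime A (fun x => (l x).map (f x)) := by
  obtain ⟨P, hP⟩ := hl.bound
  obtain ⟨Q, hQ⟩ := hf.bound
  have := foldr hl nil (f := fun x b acc => f x b :: acc)
    (cons (hf.comp (by fun_prop : PolyTime A fun y : α × List γ × β => (y.1, y.2.2))) (by fun_prop))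
    (1 + P * (1 + Q.comp (1 + X + P))) fun x l' h => ?_
  · convert this using 2 with x
    induction l x <;> simp_all
  · have h1 : l'.foldr (fun b acc => f x b :: acc) [] = l'.map (f x) := by
      clear h
      induction l' <;> simp_all
    rw [h1]
    refine (csize_le_of_forall (n := Q.eval (1 + csize A x + P.eval (csize A x))) ?_).trans ?_
    · intro c hc
      obtain ⟨b, hb, rfl⟩ := List.mem_map.1 hc
      refine (hQ (x, b)).trans (Q.eval_le_eval_nat ?_)
      have h2 : csize A b ≤ csize A (l x) := csize_le_of_mem (h.subset hb)
      have := hP x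
      simp; omega
    · have h3 := length_lt_csize (A := A) (l x)
      have h4 := hP x
      have h5 := h.length_le
      simp [eval_comp]
      omega

@[fun_prop]
theorem append {l l' : α → List β} (hl : PolyTime A l) (hl' : PolyTime A l') :
    PolyTime A (fun x => l x ++ l' x) := by
  obtain ⟨P, hP⟩ := hl.bound
  obtain ⟨Q, hQ⟩ := hl'.bound
  have := foldr hl hl' (f := fun _ b acc => b :: acc) (by fun_prop) (P + Q) fun x m h => ?_
  · simpa using this
  · have h1 := csize_append (A := A) m (l' x)
    have h2 := csize_sublist (A := A) h.sublist
    have h3 := hP x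
    have h4 := hQ x
    simp
    omega

@[fun_prop]
theorem flatten {l : α → List (List β)} (hl : PolyTime A l) :
    PolyTime A (fun x => (l x).flatten) := by
  obtain ⟨P, hP⟩ := hl.bound
  have := foldr hl nil (f := fun _ b acc => b ++ acc) (by fun_prop) P fun x m h => ?_
  · convert this using 2 with x
    induction l x <;> simp_all
  · refine le_trans ?_ ((csize_sublist h.sublist).trans (hP x))
    clear h
    induction m with
    | nil => simp
    | cons b m ih =>
      have := csize_append (A := A) b (m.foldr (fun b acc => b ++ acc) [])
      simp
      omega

theorem flatMap {l : α → List β} {f : α → β → List γ} (hl : PolyTime A l)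
    (hf : PolyTime A fun y : α × β => f y.1 y.2) : PolyTime A (fun x => (l x).flatMap (f x)) := by
  simpa [List.flatMap] using (map hl hf).flatten

theorem filter {l : α → List β} {p : α → β → Bool} (hl : PolyTime A l)
    (hp : PolyTime A fun y : α × β => p y.1 y.2) : PolyTime A (fun x => (l x).filter (p x)) := by
  have := flatMap hl (f := fun x b => bif p x b then [b] else [])
    (cond hp (by fun_prop) (by fun_prop))
  convert this using 2 with x
  induction l x with
  | nil => rfl
  | cons b t ih => cases h : p x b <;> simp [h, ih, List.flatMap_cons]

theorem any {l : α → List β} {p : α → β → Bool} (hl : PolyTime A l)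
    (hp : PolyTime A fun y : α × β => p y.1 y.2) : PolyTime A (fun x => (l x).any (p x)) := by
  convert (filter hl hp).isEmpty.not using 2 with x
  induction l x with
  | nil => rfl
  | cons b t ih => cases h : p x b <;> simp_all

theorem all {l : α → List β} {p : α → β → Bool} (hl : PolyTime A l)
    (hp : PolyTime A fun y : α × β => p y.1 y.2) : PolyTime A (fun x => (l x).all (p x)) := by
  convert (any (p := fun x b => !p x b) hl hp.not).not using 2 with x
  induction l x with
  | nil => rfl
  | cons b t ih => cases h : p x b <;> simp_all

theorem flatMap_map {l : α → List β} {m : α → β → List γ} {f : α → β → γ → δ} (hl : PolyTime A l)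
    (hm : PolyTime A fun y : α × β => m y.1 y.2)
    (hf : PolyTime A fun y : (α × β) × γ => f y.1.1 y.1.2 y.2) :
    PolyTime A (fun x => (l x).flatMap fun b => (m x b).map (f x b)) :=
  flatMap hl (map hm hf)

/-- Iteration with polynomially bounded states. -/
theorem iterate {l : α → List Unit} {i : α → γ} {f : α → γ → γ} (hl : PolyTime A l)
    (hi : PolyTime A i) (hf : PolyTime A fun y : α × γ => f y.1 y.2) (B : Polynomial ℕ)
    (hB : ∀ x, ∀ n ≤ (l x).length, csize A ((f x)^[n] (i x)) ≤ B.eval (csize A x)) :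
    PolyTime A (fun x => (f x)^[(l x).length] (i x)) := by
  have h : ∀ x l', List.foldl (fun c (_ : Unit) => f x c) (i x) l' = (f x)^[l'.length] (i x) := by
    intro x l'
    generalize i x = c
    induction l' generalizing c <;> simp_all
  have := foldl hl hi (f := fun x c _ => f x c)
    (hf.comp (by fun_prop : PolyTime A fun y : α × γ × Unit => (y.1, y.2.1))) B
    fun x l' h' => by rw [h]; exact hB x _ h'.length_le
  simpa [h] using this

end PolyTime

/-! ### The size of a code, and equality -/

namespace Data

variable {A : Type*} [LinearOrder A] [OrderBot A]

/-- One step of the traversal of a stack of data. -/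
def popStep : List (Data A) → List (Data A)
  | [] => []
  | .cons x y :: s => x :: y :: s
  | _ :: s => s

open Classical in
/-- One step of the comparison of the two components of the pairs in a stack. -/
noncomputable def eqStep : Bool × List (Data A × Data A) → Bool × List (Data A × Data A)
  | (ok, []) => (ok, [])
  | (ok, (.cons x y, .cons x' y') :: s) => (ok, (x, x') :: (y, y') :: s)
  | (ok, (x, x') :: s) => (ok && decide (x = x'), s)

/-- The test for pairs. -/
def isCons : Data A → Bool
  | .cons _ _ => true
  | _ => false

end Data

namespace PolyTime

variable {A : Type*} [LinearOrder A] [OrderBot A] {α β γ δ σ : Type*}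
  [Code A α] [Code A β] [Code A γ] [Code A δ] [Code A σ]

open Polynomial Data

@[fun_prop]
theorem isAtom {f : α → Data A} (hf : PolyTime A f) :
    PolyTime A (fun x => match f x with | .atom _ => true | _ => false) :=
  comp (of_op .isAtom (f := fun x : Data A => match x with | .atom _ => true | _ => false)
    fun x => by cases x <;> rfl) hf

@[fun_prop]
theorem isCons {f : α → Data A} (hf : PolyTime A f) : PolyTime A (fun x => (f x).isCons) := by
  have h : PolyTime A (fun x => match f x with | .nil => false | _ => true) :=
    isNil hf fun x => by cases f x <;> simp [code]
  convert h.and hf.isAtom.not using 2 with x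
  cases f x <;> rfl

theorem left {f : α → Data A} (hf : PolyTime A f) : PolyTime A (fun x => Op.fst.apply (f x)) :=
  comp (of_op .fst (f := fun x : Data A => Op.fst.apply x) fun _ => rfl) hf

theorem right {f : α → Data A} (hf : PolyTime A f) : PolyTime A (fun x => Op.snd.apply (f x)) :=
  comp (of_op .snd (f := fun x : Data A => Op.snd.apply x) fun _ => rfl) hf

theorem popStep : PolyTime A (popStep (A := A)) := by
  have := listCase (l := fun s : List (Data A) => s) (f := fun _ => [])
    (g := fun _ x s => bif x.isCons then Op.fst.apply x :: Op.snd.apply x :: s else s)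
    id nil (cond (by fun_prop) (cons (left (by fun_prop)) (cons (right (by fun_prop)) (by fun_prop)))
      (by fun_prop))
  convert this using 2 with s
  rcases s with _ | ⟨_ | _ | _, s⟩ <;> rfl

/-- The size of the code in unary. -/
theorem fuel {f : α → β} (hf : PolyTime A f) :
    PolyTime A (fun x => List.replicate (csize A (f x)) ()) := by
  suffices h : PolyTime A (fun x : Data A => List.replicate x.size ()) from
    (of_code_eq h (fun x => code x) (fun _ => rfl) (fun _ => rfl)).comp hf
  -- Each step removes exactly one constructor from the stack, so the number of steps until the
  -- stack is empty is the size of the datum.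
  have h1 : ∀ (x : Data A) n, n ≤ x.size →
      (((Data.popStep (A := A))^[n] [x]).map Data.size).sum + n = x.size := by
    intro x n
    induction n with
    | zero => simp
    | succ n ih =>
      intro hn
      have := ih (by omega)
      rw [Function.iterate_succ_apply']
      rcases h : (Data.popStep (A := A))^[n] [x] with _ | ⟨_ | _ | _, s⟩ <;>
        simp [h, Data.popStep, Data.size] at this ⊢ <;> omega
  have h2 : ∀ (x : Data A) n, (fun s : List (Data A) × List Unit =>
      (Data.popStep s.1, () :: s.2))^[n] ([x], []) =
      ((Data.popStep (A := A))^[n] [x], List.replicate n ()) := by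
    intro x n
    induction n with
    | zero => rfl
    | succ n ih => rw [Function.iterate_succ_apply', ih, Function.iterate_succ_apply']; rfl
  have h3 : ∀ s : List (Data A), csize A s ≤ 1 + 2 * (s.map Data.size).sum := by
    intro s
    induction s with
    | nil => simp
    | cons x s ih =>
      have := x.one_le_size
      have h : csize A x = x.size := rfl
      simp
      omega
  have := loop (i := fun x : Data A => ([x], ([] : List Unit))) (c := fun s => !s.1.isEmpty)
    (f := fun s => (Data.popStep s.1, () :: s.2)) (N := Data.size) (by fun_prop) (by fun_prop)
    (pair (popStep.comp (by fun_prop)) (by fun_prop)) (4 * X + 3) (fun x => ?_) (fun x n hn => ?_)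
    (fun x n hn => ?_) (fun x => ?_)
  · simpa [h2] using this.snd
  · have h : csize A x = x.size := rfl
    simp
    omega
  · have h4 := h1 x n hn
    have h5 := h3 ((Data.popStep (A := A))^[n] [x])
    have h : csize A x = x.size := rfl
    have h6 : csize A (List.replicate n ()) = 1 + 2 * n := by
      rw [csize_eq_sum]; simp; omega
    simp [h2, h6]
    omega
  · have h4 := h1 x n hn.le
    rw [h2]
    cases h : (Data.popStep (A := A))^[n] [x] with
    | nil => simp [h] at h4; omega
    | cons => rfl
  · have h4 := h1 x x.size le_rfl
    rw [h2]
    cases h : (Data.popStep (A := A))^[x.size] [x] with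
    | nil => rfl
    | cons y s => have := y.one_le_size; simp [h] at h4; omega

/-- Comparison of labels. -/
theorem le {f g : α → Data A} (hf : PolyTime A f) (hg : PolyTime A g) :
    PolyTime A (fun x => (Op.le.apply (.cons (f x) (g x))).isCons) :=
  isCons ((of_op .le (f := fun x : Data A × Data A => Op.le.apply (.cons x.1 x.2))
    fun _ => rfl : PolyTime A _).comp (pair hf hg))

theorem eqStep : PolyTime A (eqStep (A := A)) := by
  -- The only comparison of labels available is `≤`; equality of two atoms is tested by comparing
  -- them in both directions.
  have := listCase (A := A) (l := fun s : Bool × List (Data A × Data A) => s.2) (f := fun s => (s.1, []))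
    (g := fun s x t => bif x.1.isCons && x.2.isCons then
      (s.1, (Op.fst.apply x.1, Op.fst.apply x.2) :: (Op.snd.apply x.1, Op.snd.apply x.2) :: t)
      else (s.1 && bif (match x.1 with | .atom _ => true | _ => false) then
        ((Op.le.apply (.cons x.1 x.2)).isCons && (Op.le.apply (.cons x.2 x.1)).isCons) else
        !x.1.isCons && !x.2.isCons && !(match x.2 with | .atom _ => true | _ => false), t))
    (by fun_prop) (by fun_prop) ?_
  · convert this using 2 with s
    rcases s with ⟨ok, _ | ⟨⟨_ | a | _, _ | b | _⟩, s⟩⟩ <;>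
      simp [Data.eqStep, Data.isCons, Op.apply]
    split_ifs with h1 h2 h2 <;>
      simp [Data.yes, h1, h2, le_antisymm_iff (α := A)]
  · refine cond (by fun_prop) (pair (by fun_prop) (cons (pair (left ?_) (left ?_))
      (cons (pair (right ?_) (right ?_)) ?_))) (pair (and (by fun_prop) (cond (by fun_prop)
      (and (le ?_ ?_) (le ?_ ?_)) ?_)) ?_) <;> fun_prop

@[fun_prop]
theorem eq [DecidableEq β] {f g : α → β} (hf : PolyTime A f) (hg : PolyTime A g) :
    PolyTime A (fun x => decide (f x = g x)) := by
  classical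
  suffices h : PolyTime A (fun x : Data A × Data A => decide (x.1 = x.2)) from
    (of_code_eq h (fun x : β × β => (code x.1, code x.2)) (fun _ => rfl)
      (fun x => by simp [Code.inj.eq_iff]) : PolyTime A
        (fun x : β × β => decide (x.1 = x.2))).comp (pair hf hg)
  have h1 : ∀ s : Bool × List (Data A × Data A),
      ((Data.eqStep s).1 = true ∧ ∀ p ∈ (Data.eqStep s).2, p.1 = p.2) ↔
      (s.1 = true ∧ ∀ p ∈ s.2, p.1 = p.2) := by
    rintro ⟨ok, _ | ⟨⟨_ | a | _, _ | b | _⟩, s⟩⟩ <;> simp [Data.eqStep] <;> tauto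
  -- The left components lose at least one constructor per step as long as the stack is nonempty.
  -- The size of the left datum is therefore enough fuel to empty the stack, and then the flag alone
  -- holds the verdict by `h1`.
  have h2 : ∀ s : Bool × List (Data A × Data A),
      ((Data.eqStep s).2.map fun p => p.1.size).sum ≤ (s.2.map fun p => p.1.size).sum - 1 := by
    rintro ⟨ok, _ | ⟨⟨_ | a | _, _ | b | _⟩, s⟩⟩ <;> simp [Data.eqStep, Data.size] <;> omega
  have h3 : ∀ s : Bool × List (Data A × Data A),
      ((Data.eqStep s).2.map fun p => p.1.size + p.2.size).sum ≤
        (s.2.map fun p => p.1.size + p.2.size).sum := by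
    rintro ⟨ok, _ | ⟨⟨_ | a | _, _ | b | _⟩, s⟩⟩ <;> simp [Data.eqStep, Data.size] <;> omega
  have h4 : ∀ s : Bool × List (Data A × Data A),
      csize A s ≤ 5 + 2 * (s.2.map fun p => p.1.size + p.2.size).sum := by
    rintro ⟨ok, s⟩
    have := csize_bool_le (A := A) ok
    suffices h : csize A s ≤ 1 + 2 * (s.map fun p => p.1.size + p.2.size).sum by
      simp only [csize_prod]
      omega
    induction s with
    | nil => simp
    | cons p s ih =>
      have h1 := p.1.one_le_size
      have h2 := p.2.one_le_size
      have h3 : csize A p = 1 + p.1.size + p.2.size := rfl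
      simp only [csize_cons, List.map_cons, List.sum_cons]
      omega
  have := iterate (l := fun x : Data A × Data A => List.replicate (csize A x.1) ())
    (i := fun x => (true, [x])) (f := fun _ => Data.eqStep) (fuel (by fun_prop)) (by fun_prop)
    (eqStep.comp (by fun_prop)) (2 * X + 5) fun x n _ => ?_
  · convert this.fst using 2 with x
    have h5 : ∀ n, ((Data.eqStep^[n] (true, [x])).2.map fun p => p.1.size).sum ≤ x.1.size - n := by
      intro n
      induction n with
      | zero => simp
      | succ n ih =>
        rw [Function.iterate_succ_apply']
        have := h2 (Data.eqStep^[n] (true, [x]))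
        omega
    have h6 : ∀ n, ((Data.eqStep^[n] (true, [x])).1 = true ∧
        ∀ p ∈ (Data.eqStep^[n] (true, [x])).2, p.1 = p.2) ↔ x.1 = x.2 := by
      intro n
      induction n with
      | zero => simp
      | succ n ih => rw [Function.iterate_succ_apply', h1, ih]
    rw [Bool.eq_iff_iff, decide_eq_true_iff, ← h6 (csize A x.1), List.length_replicate]
    have h7 := h5 (csize A x.1)
    have h8 : csize A x.1 = x.1.size := rfl
    cases h : (Data.eqStep^[csize A x.1] (true, [x])).2 with
    | nil => simp
    | cons p s =>
      have := p.1.one_le_size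
      simp [h] at h7
      omega
  · refine (h4 _).trans ?_
    have h5 : ((Data.eqStep^[n] (true, [x])).2.map fun p => p.1.size + p.2.size).sum ≤
        x.1.size + x.2.size := by
      clear * - h3
      induction n with
      | zero => simp
      | succ n ih => rw [Function.iterate_succ_apply']; exact (h3 _).trans ih
    have h6 : csize A x = 1 + x.1.size + x.2.size := rfl
    simp only [Polynomial.eval_add, Polynomial.eval_mul, Polynomial.eval_X, Polynomial.eval_ofNat]
    omega

@[fun_prop]
theorem mem [DecidableEq β] {f : α → β} {l : α → List β} (hf : PolyTime A f) (hl : PolyTime A l) :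
    PolyTime A (fun x => decide (f x ∈ l x)) := by
  have := any (p := fun x b => decide (f x = b)) hl (by fun_prop)
  convert this using 2 with x
  rw [Bool.eq_iff_iff]
  simp

end PolyTime

/-! ## Walks and structural embeddings -/

namespace Twig

variable {A : Type*}

/-- An edge together with the label of its lower end. -/
abbrev Step (A : Type*) : Type _ := Edge × Option A

/-- `Walk q v w c`: the address `v` leads from the root of `q` to the subquery `c`, along the edges
and labels `w`. -/
inductive Walk : Twig A → List ℕ → List (Step A) → Twig A → Prop
  | nil (q : Twig A) : Walk q [] [] q
  | cons {q c c' : Twig A} {i : ℕ} {v : List ℕ} {w : List (Step A)} {e : Edge} :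
      q.kids[i]? = some (e, c) → Walk c v w c' → Walk q (i :: v) ((e, c.rootLab) :: w) c'

theorem walk_nil {q c : Twig A} {w : List (Step A)} : Walk q [] w c ↔ w = [] ∧ c = q := by
  constructor
  · rintro ⟨⟩; exact ⟨rfl, rfl⟩
  · rintro ⟨rfl, rfl⟩; exact .nil _

theorem walk_cons {q c : Twig A} {i : ℕ} {v : List ℕ} {w : List (Step A)} :
    Walk q (i :: v) w c ↔
      ∃ e k w', q.kids[i]? = some (e, k) ∧ Walk k v w' c ∧ w = (e, k.rootLab) :: w' := by
  constructor
  · rintro (_ | ⟨h1, h2⟩); exact ⟨_, _, _, h1, h2, rfl⟩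
  · rintro ⟨e, k, w', h1, h2, rfl⟩; exact .cons h1 h2

theorem at?_eq_some {q c : Twig A} {v : List ℕ} : q.at? v = some c ↔ ∃ w, Walk q v w c := by
  induction v generalizing q with
  | nil => cases q; simp [at?, walk_nil, eq_comm]
  | cons i v ih =>
    obtain ⟨l, ks⟩ := q
    simp only [at?, walk_cons, kids]
    cases h : ks[i]? with
    | none => simp
    | some k => obtain ⟨e, k⟩ := k; simp [ih]

namespace Walk

variable {q c c' : Twig A} {v v' : List ℕ} {w w' : List (Step A)}

theorem length_eq (h : Walk q v w c) : v.length = w.length := by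
  induction h with
  | nil => rfl
  | cons _ _ ih => simp [ih]

theorem unique (h : Walk q v w c) (h' : Walk q v w' c') : w = w' ∧ c = c' := by
  induction h generalizing w' with
  | nil => cases h'; exact ⟨rfl, rfl⟩
  | cons h1 _ ih =>
    obtain ⟨e, k, w1, h2, h3, rfl⟩ := walk_cons.1 h'
    rw [h1, Option.some.injEq, Prod.mk.injEq] at h2
    obtain ⟨rfl, rfl⟩ := h2
    obtain ⟨rfl, rfl⟩ := ih h3
    exact ⟨rfl, rfl⟩

theorem append (h : Walk q v w c) (h' : Walk c v' w' c') : Walk q (v ++ v') (w ++ w') c' := by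
  induction h with
  | nil => exact h'
  | cons h1 _ ih => exact .cons h1 (ih h')

theorem split (h : Walk q (v ++ v') w c) :
    ∃ w₁ w₂ m, w = w₁ ++ w₂ ∧ Walk q v w₁ m ∧ Walk m v' w₂ c := by
  induction v generalizing q w with
  | nil => exact ⟨[], w, q, rfl, .nil _, h⟩
  | cons i v ih =>
    obtain ⟨e, k, w1, h1, h2, rfl⟩ := walk_cons.1 h
    obtain ⟨w₁, w₂, m, rfl, h3, h4⟩ := ih h2
    exact ⟨_, w₂, m, rfl, .cons h1 h3, h4⟩

theorem single {e : Edge} {k : Twig A} {i : ℕ} (h : q.kids[i]? = some (e, k)) :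
    Walk q [i] [(e, k.rootLab)] k := .cons h (.nil _)

theorem snoc {e : Edge} {k : Twig A} {i : ℕ} (h : Walk q v w c) (h' : c.kids[i]? = some (e, k)) :
    Walk q (v ++ [i]) (w ++ [(e, k.rootLab)]) k := h.append (single h')

theorem take (h : Walk q v w c) (d : ℕ) : ∃ m, Walk q (v.take d) (w.take d) m ∧
    Walk m (v.drop d) (w.drop d) c := by
  have h1 := h
  rw [← List.take_append_drop d v] at h1
  obtain ⟨w₁, w₂, m, rfl, h2, h3⟩ := h1.split
  have h4 := h2.length_eq
  have h5 := h.length_eq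
  have h8 := h3.length_eq
  have h6 : (w₁ ++ w₂).take d = w₁ := by
    simp only [List.length_take, List.length_drop] at h4 h8
    rw [List.take_append, List.take_of_length_le (by omega)]
    rcases le_total d v.length with h | h
    · rw [(by omega : d - w₁.length = 0), List.take_zero, List.append_nil]
    · rw [List.eq_nil_of_length_eq_zero (by omega : w₂.length = 0), List.take_nil, List.append_nil]
  have h7 : (w₁ ++ w₂).drop d = w₂ := by
    have := List.take_append_drop d (w₁ ++ w₂)
    rw [h6] at this
    exact List.append_cancel_left this
  rw [h6, h7]
  exact ⟨m, h2, h3⟩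

/-- The node that a walk leads to. -/
def toNode (h : Walk q v w c) : q.Node := ⟨v, by rw [at?_eq_some.2 ⟨w, h⟩]; rfl⟩

@[simp] theorem toNode_val (h : Walk q v w c) : h.toNode.1 = v := rfl

theorem sub_eq {n : q.Node} (h : Walk q n.1 w c) : q.sub n = c := by
  have := at?_eq_some.2 ⟨w, h⟩
  simp [sub, this]

end Walk

theorem walk_snoc {q c : Twig A} {i : ℕ} {v : List ℕ} {w : List (Step A)} :
    Walk q (v ++ [i]) w c ↔ ∃ e m w', m.kids[i]? = some (e, c) ∧ Walk q v w' m ∧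
      w = w' ++ [(e, c.rootLab)] := by
  constructor
  · intro h
    obtain ⟨w₁, w₂, m, rfl, h1, h2⟩ := h.split
    obtain ⟨e, k, w3, h3, h4, rfl⟩ := walk_cons.1 h2
    obtain ⟨rfl, rfl⟩ := walk_nil.1 h4
    exact ⟨e, m, w₁, h3, h1, rfl⟩
  · rintro ⟨e, m, w', h1, h2, rfl⟩
    exact h2.snoc h1

theorem walk_sub {q : Twig A} (v : q.Node) : ∃ w, Walk q v.1 w (q.sub v) :=
  at?_eq_some.1 (by simp [sub])

theorem below_iff {q : Twig A} {v w : q.Node} : q.Below v w ↔ ∃ x ≠ [], w.1 = v.1 ++ x := by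
  constructor
  · intro h
    induction h with
    | single h =>
      obtain ⟨e, i, c, h, -⟩ := h
      exact ⟨[i], by simp, h⟩
    | tail _ h ih =>
      obtain ⟨e, i, c, h, -⟩ := h
      obtain ⟨x, hx, h'⟩ := ih
      exact ⟨x ++ [i], by simp, by rw [h, h', List.append_assoc]⟩
  · rintro ⟨x, hx, h⟩
    induction x using List.reverseRecOn generalizing w with
    | nil => exact absurd rfl hx
    | append_singleton x i ih =>
      obtain ⟨w1, h1⟩ := walk_sub w
      rw [h, ← List.append_assoc] at h1
      obtain ⟨e, m, w', h2, h3, -⟩ := walk_snoc.1 h1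
      have h4 : ∃ e, q.HasEdge e h3.toNode w :=
        ⟨e, i, q.sub w, by simp [h], by rw [Walk.sub_eq (n := h3.toNode) h3]; exact h2⟩
      by_cases hx : x = []
      · subst hx
        have : h3.toNode = v := Subtype.ext (by simp)
        rw [this] at h4
        exact .single h4
      · exact (ih (w := h3.toNode) hx rfl).tail h4

/-- An embedding of `p` in `q` on the level of addresses. -/
structure RawEmb (p q : Twig A) (F : List ℕ → List ℕ) : Prop where
  root : F [] = []
  walk : ∀ {v w c}, Walk p v w c → ∃ w' c', Walk q (F v) w' c' ∧ Matches c'.rootLab c.rootLab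
  child : ∀ {v w c i k}, Walk p v w c → c.kids[i]? = some (.child, k) →
    ∃ j w' c' k', Walk q (F v) w' c' ∧ c'.kids[j]? = some (.child, k') ∧ F (v ++ [i]) = F v ++ [j]
  below : ∀ {v w c i e k}, Walk p v w c → c.kids[i]? = some (e, k) →
    ∃ x ≠ [], F (v ++ [i]) = F v ++ x

theorem IsEmbedding.exists_rawEmb {p q : Twig A} {f : p.Node → q.Node} (hf : IsEmbedding p q f) :
    ∃ F, RawEmb p q F ∧ ∀ v : p.Node, F v.1 = (f v).1 := by
  classical
  -- Outside the nodes of `p` the value is `[]`; this is harmless, since `RawEmb` speaks only of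
  -- addresses reached by walks.
  have hF : ∀ v : p.Node, (fun v => if h : (p.at? v).isSome then (f ⟨v, h⟩).1 else []) v.1 =
      (f v).1 := fun v => dif_pos v.2
  refine ⟨fun v => if h : (p.at? v).isSome then (f ⟨v, h⟩).1 else [], ?_, hF⟩
  generalize (fun v => if h : (p.at? v).isSome then (f ⟨v, h⟩).1 else []) = F at hF
  have hF' : ∀ {v w c} (h : Walk p v w c), F v = (f h.toNode).1 := fun h => hF h.toNode
  have edge : ∀ {v w c i e k} (h : Walk p v w c) (h' : c.kids[i]? = some (e, k)),
      p.HasEdge e h.toNode (h.snoc h').toNode := fun {v w c i e k} h h' =>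
    ⟨i, k, rfl, by rw [Walk.sub_eq (n := h.toNode) h]; exact h'⟩
  have child : ∀ {v w c i k}, Walk p v w c → c.kids[i]? = some (.child, k) →
    ∃ j w' c' k', Walk q (F v) w' c' ∧ c'.kids[j]? = some (.child, k') ∧
      F (v ++ [i]) = F v ++ [j] := by
    intro v w c i k h h'
    obtain ⟨j, k', h1, h2⟩ := hf.child _ _ (edge h h')
    rw [hF' h, hF' (h.snoc h')]
    obtain ⟨w', h3⟩ := walk_sub (f h.toNode)
    exact ⟨j, w', _, k', h3, h2, h1⟩
  refine ⟨?_, ?_, child, ?_⟩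
  · have := hF p.root
    rw [hf.root] at this
    exact this
  · intro v w c h
    rw [hF' h]
    obtain ⟨w', h3⟩ := walk_sub (f h.toNode)
    refine ⟨w', _, h3, ?_⟩
    have := hf.lab h.toNode
    rw [Twig.lab, Twig.lab, Walk.sub_eq (n := h.toNode) h] at this
    exact this
  · intro v w c i e k h h'
    cases e with
    | child =>
      obtain ⟨j, -, -, -, -, -, h⟩ := child h h'
      exact ⟨[j], by simp, h⟩
    | desc =>
      rw [hF' h, hF' (h.snoc h')]
      exact below_iff.1 (hf.desc _ _ (edge h h'))

theorem RawEmb.exists_isEmbedding {p q : Twig A} {F : List ℕ → List ℕ} (hF : RawEmb p q F) :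
    ∃ f, IsEmbedding p q f ∧ ∀ v : p.Node, (f v).1 = F v.1 := by
  have h1 : ∀ v : p.Node, (q.at? (F v.1)).isSome := fun v => by
    obtain ⟨w, h⟩ := walk_sub v
    obtain ⟨w', c', h', -⟩ := hF.walk h
    rw [at?_eq_some.2 ⟨_, h'⟩]; rfl
  refine ⟨fun v => ⟨F v.1, h1 v⟩, ⟨Subtype.ext hF.root, ?_, ?_, ?_⟩, fun v => rfl⟩
  · rintro v w ⟨i, k, h2, h3⟩
    obtain ⟨u, h⟩ := walk_sub v
    obtain ⟨j, w', c', k', h4, h5, h6⟩ := hF.child h h3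
    exact ⟨j, k', by simp [h2, h6], by rw [Walk.sub_eq (n := ⟨F v.1, h1 v⟩) h4]; exact h5⟩
  · rintro v w ⟨i, k, h2, h3⟩
    obtain ⟨u, h⟩ := walk_sub v
    obtain ⟨x, hx, h4⟩ := hF.below h h3
    exact below_iff.2 ⟨x, hx, by rw [← h4, ← h2]⟩
  · intro v
    obtain ⟨w, h⟩ := walk_sub v
    obtain ⟨w', c', h', h2⟩ := hF.walk h
    change Matches (q.sub ⟨F v.1, h1 v⟩).rootLab _
    rw [Walk.sub_eq (n := ⟨F v.1, h1 v⟩) h']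
    exact h2

/-- The subqueries at the end of the child edges below the root, resp. the proper subqueries. -/
def Reach (e : Edge) (q c : Twig A) : Prop :=
  match e with
  | .child => (.child, c) ∈ q.kids
  | .desc => ∃ v w, v ≠ [] ∧ Walk q v w c

theorem reach_iff {e : Edge} {q c : Twig A} : Reach e q c ↔ ∃ v w, v ≠ [] ∧ Walk q v w c ∧
    (e = .child → ∃ j, v = [j] ∧ q.kids[j]? = some (.child, c)) := by
  cases e with
  | child =>
    simp only [Reach, List.mem_iff_getElem?, forall_const]
    constructor
    · rintro ⟨j, h⟩
      exact ⟨[j], _, by simp, .single h, j, rfl, h⟩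
    · rintro ⟨-, -, -, -, j, rfl, h⟩
      exact ⟨j, h⟩
  | desc => simp [Reach]

mutual
/-- The query `p` embeds in the query `q`, by recursion on `p`. -/
def Match : Twig A → Twig A → Prop
  | node l ks, q => Matches q.rootLab l ∧ MatchKids ks q
/-- The subqueries in a list embed below the root of `q`. -/
def MatchKids : List (Edge × Twig A) → Twig A → Prop
  | [], _ => True
  | (e, c) :: ks, q => (∃ c', Reach e q c' ∧ Match c c') ∧ MatchKids ks q
end

theorem matchKids_iff {ks : List (Edge × Twig A)} {q : Twig A} :
    MatchKids ks q ↔ ∀ e c, (e, c) ∈ ks → ∃ c', Reach e q c' ∧ Match c c' := by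
  induction ks with
  | nil => simp [MatchKids]
  | cons k ks ih =>
    obtain ⟨e, c⟩ := k
    rw [MatchKids, ih]
    constructor
    · rintro ⟨h1, h2⟩ e' c' h
      rcases List.mem_cons.1 h with h | h
      · cases h; exact h1
      · exact h2 _ _ h
    · exact fun h => ⟨h _ _ (by simp), fun e' c' h' => h _ _ (by simp [h'])⟩

theorem match_iff {p q : Twig A} : Match p q ↔ Matches q.rootLab p.rootLab ∧
    ∀ e c, (e, c) ∈ p.kids → ∃ c', Reach e q c' ∧ Match c c' := by
  cases p
  rw [Match, matchKids_iff]
  rfl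

/-- The address map restricts to an embedding of the subquery at each node, so induction on that
subquery yields the recursive relation. -/
theorem RawEmb.match {p q : Twig A} {F : List ℕ → List ℕ} (hF : RawEmb p q F) {c : Twig A} :
    ∀ {v w w' c'}, Walk p v w c → Walk q (F v) w' c' → Match c c' := by
  induction c using ind with
  | h l ks ih =>
    intro v w w' c' h h'
    rw [match_iff]
    constructor
    · obtain ⟨w1, c1, h1, h2⟩ := hF.walk h
      obtain ⟨rfl, rfl⟩ := h'.unique h1
      exact h2
    · intro e k hk
      obtain ⟨i, hi⟩ := List.mem_iff_getElem?.1 hk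
      obtain ⟨w1, k', h1, h2⟩ := hF.walk (h.snoc hi)
      refine ⟨k', ?_, ih _ hk (h.snoc hi) h1⟩
      cases e with
      | child =>
        obtain ⟨j, w2, c2, k2, h3, h4, h5⟩ := hF.child h hi
        obtain ⟨rfl, rfl⟩ := h'.unique h3
        rw [h5] at h1
        obtain ⟨-, rfl⟩ := (h3.snoc h4).unique h1
        exact List.mem_iff_getElem?.2 ⟨j, h4⟩
      | desc =>
        obtain ⟨x, hx, h5⟩ := hF.below h hi
        rw [h5] at h1
        obtain ⟨w₁, w₂, m, -, h3, h4⟩ := h1.split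
        obtain ⟨rfl, rfl⟩ := h'.unique h3
        exact ⟨x, w₂, hx, h4⟩

/-- Embeddings need not be injective and siblings do not constrain each other, so embeddings of the
subqueries chosen independently can be glued: `X i` is the image of the `i`-th child and `G i` the
embedding below it. -/
theorem Match.exists_rawEmb {p : Twig A} : ∀ {q : Twig A}, Match p q → ∃ F, RawEmb p q F := by
  induction p using ind with
  | h l ks ih =>
    intro q h
    rw [match_iff] at h
    obtain ⟨h0, h⟩ := h
    have h1 : ∀ i : ℕ, ∃ (x : List ℕ) (G : List ℕ → List ℕ), ∀ e k, ks[i]? = some (e, k) →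
        ∃ w k', x ≠ [] ∧ Walk q x w k' ∧
          (e = Edge.child → ∃ j : ℕ, x = [j] ∧ q.kids[j]? = some (.child, k')) ∧ RawEmb k k' G := by
      intro i
      cases hi : ks[i]? with
      | none => exact ⟨[], fun x => x, fun e k h => by simp at h⟩
      | some k =>
        obtain ⟨e, k⟩ := k
        have hk : (e, k) ∈ ks := List.mem_iff_getElem?.2 ⟨i, hi⟩
        obtain ⟨k', h2, h3⟩ := h e k hk
        obtain ⟨G, hG⟩ := ih _ hk h3
        obtain ⟨x, w, hx, hw, h4⟩ := reach_iff.1 h2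
        refine ⟨x, G, fun e' k1 h5 => ?_⟩
        cases h5
        exact ⟨w, k', hx, hw, h4, hG⟩
    choose X G hXG using h1
    let F : List ℕ → List ℕ := fun v => match v with
      | [] => []
      | i :: v => X i ++ G i v
    have hF : ∀ i v, F (i :: v) = X i ++ G i v := fun _ _ => rfl
    refine ⟨F, rfl, ?_, ?_, ?_⟩
    · intro v w c hw
      cases hw with
      | nil => exact ⟨[], q, .nil _, h0⟩
      | cons h1 h2 =>
        obtain ⟨w1, k', hx, hw, h4, hG⟩ := hXG _ _ _ h1
        obtain ⟨w2, c2, h5, h6⟩ := hG.walk h2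
        exact ⟨_, c2, hw.append h5, h6⟩
    · intro v w c i k hw hi
      cases hw with
      | nil =>
        obtain ⟨w1, k', hx, hw, h4, hG⟩ := hXG _ _ _ hi
        obtain ⟨j, h5, h6⟩ := h4 rfl
        exact ⟨j, [], q, k', .nil _, h6, by simp [F, h5, hG.root]⟩
      | cons h1 h2 =>
        obtain ⟨w1, k', hx, hw, h4, hG⟩ := hXG _ _ _ h1
        obtain ⟨j, w2, c2, k2, h5, h6, h7⟩ := hG.child h2 hi
        exact ⟨j, _, c2, k2, hw.append h5, h6, by simp [F, h7]⟩
    · intro v w c i e k hw hi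
      cases hw with
      | nil =>
        obtain ⟨w1, k', hx, hw, h4, hG⟩ := hXG _ _ _ hi
        exact ⟨_, hx, by simp [F, hG.root]⟩
      | cons h1 h2 =>
        obtain ⟨w1, k', hx, hw, h4, hG⟩ := hXG _ _ _ h1
        obtain ⟨x, hx, h5⟩ := hG.below h2 hi
        exact ⟨x, hx, by simp [F, h5]⟩

/-- Replaces maps between sets of nodes by a relation defined by recursion, on which both the
inductions and the algorithm work. -/
theorem subsumed_iff {p q : Twig A} : q ≼ p ↔ Match p q := by
  constructor
  · rintro ⟨f, hf⟩
    obtain ⟨F, hF, -⟩ := hf.exists_rawEmb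
    exact hF.match (.nil _) (by rw [hF.root]; exact .nil _)
  · intro h
    obtain ⟨F, hF⟩ := h.exists_rawEmb
    obtain ⟨f, hf, -⟩ := hF.exists_isEmbedding
    exact ⟨f, hf⟩

theorem Matches.trans {x y z : Option A} (h : Matches x y) (h' : Matches y z) : Matches x z := by
  intro hz
  have := h' hz
  subst this
  exact h hz

theorem Subsumed.refl (q : Twig A) : q ≼ q :=
  ⟨fun v => v, rfl, fun _ _ h => h, fun _ _ h => .single ⟨_, h⟩, fun _ _ => rfl⟩

theorem IsEmbedding.below {p q : Twig A} {f : p.Node → q.Node} (hf : IsEmbedding p q f)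
    {v w : p.Node} (h : p.Below v w) : q.Below (f v) (f w) := by
  have edge : ∀ v w, (∃ e, p.HasEdge e v w) → q.Below (f v) (f w) := by
    rintro v w ⟨e | _, h⟩
    · exact .single ⟨_, hf.child _ _ h⟩
    · exact hf.desc _ _ h
  induction h with
  | single h => exact edge _ _ h
  | tail _ h ih => exact Relation.TransGen.trans ih (edge _ _ h)

theorem Subsumed.trans {p q r : Twig A} (h : p ≼ q) (h' : q ≼ r) : p ≼ r := by
  obtain ⟨f, hf⟩ := h
  obtain ⟨g, hg⟩ := h'
  refine ⟨fun v => f (g v), by rw [hg.root, hf.root], fun v w h => hf.child _ _ (hg.child _ _ h),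
    fun v w h => hf.below (hg.desc _ _ h), fun v => (hf.lab _).trans (hg.lab v)⟩

theorem Iso.symm {p q : Twig A} (h : p ≅ₜ q) : q ≅ₜ p := by
  obtain ⟨f, h1, h2, h3⟩ := h
  exact ⟨f.symm, by rw [← h1, f.symm_apply_apply], fun v => by rw [← h2, f.apply_symm_apply],
    fun e v w => by rw [h3, f.apply_symm_apply, f.apply_symm_apply]⟩

theorem Iso.subsumed {p q : Twig A} (h : p ≅ₜ q) : q ≼ p := by
  obtain ⟨f, h1, h2, h3⟩ := h
  exact ⟨f, h1, fun v w => (h3 _ v w).1, fun v w h => .single ⟨_, (h3 _ v w).1 h⟩,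
    fun v _ => h2 v⟩

end Twig

/-! ## Path queries as words -/

namespace Twig

variable {A : Type*}

/-- The subqueries below the root of a path query. -/
def tail : List (Step A) → List (Edge × Twig A)
  | [] => []
  | (e, l) :: w => [(e, node l (tail w))]

/-- The path query with a given root label, and given edges and labels below the root. -/
def ofWord (l : Option A) (w : List (Step A)) : Twig A := node l (tail w)

@[simp] theorem rootLab_ofWord (l : Option A) (w : List (Step A)) : (ofWord l w).rootLab = l := rfl

@[simp] theorem kids_ofWord_eq_nil {l : Option A} {w : List (Step A)} :
    (ofWord l w).kids = [] ↔ w = [] := by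
  rcases w with _ | ⟨⟨e, l'⟩, w⟩ <;> simp [ofWord, kids, tail]

theorem kids_ofWord_cons (l : Option A) (e : Edge) (l' : Option A) (w : List (Step A)) :
    (ofWord l ((e, l') :: w)).kids = [(e, ofWord l' w)] := rfl

/-- The address `v` leads to a leaf of `q`, along the edges and labels `w`. -/
def LeafW (q : Twig A) (v : List ℕ) (w : List (Step A)) : Prop := ∃ c, Walk q v w c ∧ c.kids = []

theorem exists_leafW (q : Twig A) : ∃ v w, LeafW q v w := by
  induction q using ind with
  | h l ks ih =>
    cases ks with
    | nil => exact ⟨[], [], _, .nil _, rfl⟩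
    | cons k ks =>
      obtain ⟨v, w, c, h1, h2⟩ := ih k (by simp)
      exact ⟨0 :: v, _, c, .cons (q := node l (k :: ks)) (by simp [kids]; rfl) h1, h2⟩

theorem Walk.leafW {q c : Twig A} {v v' : List ℕ} {w w' : List (Step A)} (h : Walk q v w c)
    (h' : LeafW c v' w') : LeafW q (v ++ v') (w ++ w') := by
  obtain ⟨c', h1, h2⟩ := h'
  exact ⟨c', h.append h1, h2⟩

theorem leafW_cons {q : Twig A} {i : ℕ} {v : List ℕ} {w : List (Step A)} :
    LeafW q (i :: v) w ↔ ∃ e k w', q.kids[i]? = some (e, k) ∧ LeafW k v w' ∧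
      w = (e, k.rootLab) :: w' := by
  simp only [LeafW, walk_cons]
  constructor
  · rintro ⟨c, ⟨e, k, w', h1, h2, h3⟩, h4⟩
    exact ⟨e, k, w', h1, ⟨c, h2, h4⟩, h3⟩
  · rintro ⟨e, k, w', h1, ⟨c, h2, h4⟩, h3⟩
    exact ⟨c, ⟨e, k, w', h1, h2, h3⟩, h4⟩

theorem leafW_nil {q : Twig A} {w : List (Step A)} : LeafW q [] w ↔ w = [] ∧ q.kids = [] := by
  simp only [LeafW, walk_nil]
  constructor
  · rintro ⟨c, ⟨h1, rfl⟩, h2⟩; exact ⟨h1, h2⟩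
  · rintro ⟨h1, h2⟩; exact ⟨q, ⟨h1, rfl⟩, h2⟩

theorem LeafW.unique {q : Twig A} {v : List ℕ} {w w' : List (Step A)} (h : LeafW q v w)
    (h' : LeafW q v w') : w = w' := by
  obtain ⟨c, h, -⟩ := h
  obtain ⟨c', h', -⟩ := h'
  exact (h.unique h').1

theorem LeafW.length_eq {q : Twig A} {v : List ℕ} {w : List (Step A)} (h : LeafW q v w) :
    v.length = w.length := by
  obtain ⟨c, h, -⟩ := h
  exact h.length_eq

theorem leafW_ofWord {l : Option A} {w w' : List (Step A)} {v : List ℕ} :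
    LeafW (ofWord l w) v w' ↔ w' = w ∧ v = List.replicate w.length 0 := by
  induction w generalizing l v w' with
  | nil =>
    cases v with
    | nil => simp [leafW_nil, ofWord, tail, kids]
    | cons i v => simp [leafW_cons, ofWord, tail, kids]
  | cons x w ih =>
    obtain ⟨e, l'⟩ := x
    cases v with
    | nil => simp [leafW_nil, List.replicate_succ]
    | cons i v =>
      rw [leafW_cons, kids_ofWord_cons, List.length_cons, List.replicate_succ, List.cons.injEq]
      constructor
      · rintro ⟨e', k, w1, h1, h2, rfl⟩
        cases i with
        | zero =>
          simp only [List.getElem?_cons_zero, Option.some.injEq, Prod.mk.injEq] at h1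
          obtain ⟨rfl, rfl⟩ := h1
          obtain ⟨rfl, rfl⟩ := ih.1 h2
          exact ⟨rfl, rfl, rfl⟩
        | succ i => simp at h1
      · rintro ⟨rfl, rfl, rfl⟩
        exact ⟨e, ofWord l' w, w, by simp, ih.2 ⟨rfl, rfl⟩, rfl⟩

/-- The part of a path query below the root embeds in that of another one. -/
inductive PE : List (Step A) → List (Step A) → Prop
  | nil (w' : List (Step A)) : PE [] w'
  | child {l l' : Option A} {w w' : List (Step A)} :
      Matches l' l → PE w w' → PE ((.child, l) :: w) ((.child, l') :: w')
  | desc {l l' : Option A} {w w' : List (Step A)} (e : Edge) :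
      Matches l' l → PE w w' → PE ((.desc, l) :: w) ((e, l') :: w')
  | skip {l : Option A} {w w' : List (Step A)} (x : Step A) :
      PE ((.desc, l) :: w) w' → PE ((.desc, l) :: w) (x :: w')

theorem PE.refl (w : List (Step A)) : PE w w := by
  induction w with
  | nil => exact .nil _
  | cons x w ih =>
    obtain ⟨e | _, l⟩ := x
    · exact .child (fun _ => rfl) ih
    · exact .desc _ (fun _ => rfl) ih

theorem PE.length_le {w w' : List (Step A)} (h : PE w w') : w.length ≤ w'.length := by
  induction h <;> simp at * <;> omega

theorem Matches.antisymm {x y : Option A} (h : Matches x y) (h' : Matches y x) : x = y := by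
  by_cases hx : x = none
  · by_cases hy : y = none
    · rw [hx, hy]
    · exact h hy
  · exact (h' hx).symm

/-- Embeddings do not shorten words. A skip would make the second word strictly longer than the
first, which the converse embedding forbids, so the two words are compared position by position. -/
theorem PE.antisymm {w w' : List (Step A)} (h : PE w w') (h' : PE w' w) : w = w' := by
  induction h with
  | nil w' => exact (List.eq_nil_of_length_eq_zero (by simpa using h'.length_le)).symm
  | child h1 h2 ih =>
    cases h' with
    | child h3 h4 => rw [h1.antisymm h3, ih h4]
  | desc e h1 h2 ih =>
    cases h' with
    | desc _ h3 h4 => rw [h1.antisymm h3, ih h4]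
    | skip _ h3 =>
      have h4 := h2.length_le
      have h5 := h3.length_le
      simp at h5
      omega
  | skip x h1 ih =>
    have h4 := h1.length_le
    have h5 := h'.length_le
    simp at h4 h5
    omega

theorem PE.skips {l : Option A} {w w' : List (Step A)} (h : PE ((.desc, l) :: w) w')
    (x : List (Step A)) : PE ((.desc, l) :: w) (x ++ w') := by
  induction x with
  | nil => exact h
  | cons y x ih => exact .skip y ih

/-- Embeddings of path queries in arbitrary queries. -/
theorem match_ofWord {l : Option A} {w : List (Step A)} {q : Twig A} :
    Match (ofWord l w) q ↔ Matches q.rootLab l ∧ ∃ v w', LeafW q v w' ∧ PE w w' := by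
  constructor
  · intro h
    induction w generalizing l q with
    | nil =>
      obtain ⟨v, w', h1⟩ := exists_leafW q
      exact ⟨(match_iff.1 h).1, v, w', h1, .nil _⟩
    | cons x w ih =>
      obtain ⟨e, l'⟩ := x
      obtain ⟨h1, h2⟩ := match_iff.1 h
      obtain ⟨c', h3, h4⟩ := h2 e (ofWord l' w) (by simp [kids_ofWord_cons])
      obtain ⟨h5, v, w', h6, h7⟩ := ih h4
      refine ⟨h1, ?_⟩
      obtain ⟨x, u, hx, h8, h9⟩ := reach_iff.1 h3
      refine ⟨_, _, h8.leafW h6, ?_⟩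
      cases e with
      | child =>
        obtain ⟨j, rfl, h10⟩ := h9 rfl
        obtain ⟨e, k, u', h11, h12, rfl⟩ := walk_cons.1 h8
        obtain ⟨rfl, rfl⟩ := walk_nil.1 h12
        rw [h10] at h11
        cases h11
        exact .child h5 h7
      | desc =>
        -- The image of the end of a descendant edge is entered by some last edge `e`; the steps
        -- before it are the skipped ones.
        obtain ⟨i, x, rfl⟩ : ∃ y i, x = y ++ [i] := ⟨_, _, (List.dropLast_append_getLast hx).symm⟩
        obtain ⟨e, m, u', h10, h11, rfl⟩ := walk_snoc.1 h8
        rw [List.append_assoc]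
        exact (PE.desc e h5 h7).skips _
  · rintro ⟨h1, v, w', h2, h3⟩
    induction h3 generalizing l q v with
    | nil w' => exact match_iff.2 ⟨h1, by simp [ofWord, tail, kids]⟩
    | @child l1 l1' w w' h3 h4 ih =>
      cases v with
      | nil => simp [leafW_nil] at h2
      | cons i v =>
        obtain ⟨e, k, w1, h5, h6, h7⟩ := leafW_cons.1 h2
        cases h7
        refine match_iff.2 ⟨h1, fun e c hc => ?_⟩
        obtain ⟨rfl, rfl⟩ : e = .child ∧ c = ofWord l1 w := by
          simpa [kids_ofWord_cons] using hc
        exact ⟨k, List.mem_iff_getElem?.2 ⟨i, h5⟩, ih h3 _ h6⟩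
    | @desc l1 l1' w w' e h3 h4 ih =>
      cases v with
      | nil => simp [leafW_nil] at h2
      | cons i v =>
        obtain ⟨e, k, w1, h5, h6, h7⟩ := leafW_cons.1 h2
        cases h7
        refine match_iff.2 ⟨h1, fun e c hc => ?_⟩
        obtain ⟨rfl, rfl⟩ : e = .desc ∧ c = ofWord l1 w := by
          simpa [kids_ofWord_cons] using hc
        exact ⟨k, ⟨[i], _, by simp, .single h5⟩, ih h3 _ h6⟩
    | @skip l1 w w' x h3 ih =>
      cases v with
      | nil => simp [leafW_nil] at h2
      | cons i v =>
        obtain ⟨e, k, w1, h5, h6, h7⟩ := leafW_cons.1 h2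
        cases h7
        -- The skipped node need not match the root label `l`. A wildcard root makes the induction
        -- hypothesis available there.
        have h8 := ih (l := none) (fun h => absurd rfl h) _ h6
        refine match_iff.2 ⟨h1, fun e c hc => ?_⟩
        obtain ⟨rfl, rfl⟩ : e = .desc ∧ c = ofWord l1 w := by
          simpa [kids_ofWord_cons] using hc
        obtain ⟨c', ⟨x, u, hx, h9⟩, h10⟩ := (match_iff.1 h8).2 _ _ hc
        exact ⟨c', ⟨i :: x, _, by simp, .cons h5 h9⟩, h10⟩

theorem match_ofWord_ofWord {l l' : Option A} {w w' : List (Step A)} :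
    Match (ofWord l w) (ofWord l' w') ↔ Matches l' l ∧ PE w w' := by
  rw [match_ofWord]
  simp [leafW_ofWord]

theorem LeafW.match {q : Twig A} {v : List ℕ} {w : List (Step A)} (h : LeafW q v w) :
    Match (ofWord q.rootLab w) q :=
  match_ofWord.2 ⟨fun _ => rfl, v, w, h, .refl _⟩

/-! ### Anchored path queries -/

/-- The word `w` is the part of an anchored path query below some node; `b` says whether this node
is the root or has a label. -/
def Anch : Bool → List (Step A) → Prop
  | _, [] => True
  | b, (e, l) :: w => (e = .desc → b = true ∧ (l = none → w = [])) ∧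
      (e = .child → l = none → w ≠ []) ∧ Anch l.isSome w

theorem Anch.mono {b b' : Bool} {w : List (Step A)} (h : Anch b w) (hb : b = true → b' = true) :
    Anch b' w := by
  cases w with
  | nil => trivial
  | cons x w => exact ⟨fun h1 => ⟨hb (h.1 h1).1, (h.1 h1).2⟩, h.2⟩

theorem isPath_iff {p : Twig A} : p.IsPath ↔ ∀ v w c, Walk p v w c → c.kids.length ≤ 1 := by
  constructor
  · intro h v w c hw
    have := h hw.toNode
    rwa [Walk.sub_eq (n := hw.toNode) hw] at this
  · intro h v
    obtain ⟨w, hw⟩ := walk_sub v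
    exact h _ _ _ hw

theorem isPath_iff_exists {p : Twig A} : p.IsPath ↔ ∃ w, p = ofWord p.rootLab w := by
  rw [isPath_iff]
  constructor
  · induction p using ind with
    | h l ks ih =>
      intro h
      have h1 := h _ _ _ (.nil _)
      rcases ks with _ | ⟨⟨e, k⟩, _ | _⟩
      · exact ⟨[], rfl⟩
      · obtain ⟨w, hw⟩ := ih (e, k) (by simp) fun v w c hw => h _ _ _ (.cons (i := 0) rfl hw)
        refine ⟨(e, k.rootLab) :: w, ?_⟩
        conv_lhs => rw [show k = ofWord k.rootLab w from hw]
        rfl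
      · simp [kids] at h1
  · rintro ⟨w, hw⟩
    rw [hw]
    generalize p.rootLab = l
    clear hw
    intro v u c h
    induction w generalizing l v u with
    | nil =>
      cases h with
      | nil => simp [ofWord, kids, tail]
      | cons h1 => simp [ofWord, kids, tail] at h1
    | cons x w ih =>
      obtain ⟨e, l'⟩ := x
      cases h with
      | nil => simp [kids_ofWord_cons]
      | @cons _ _ _ i _ _ _ h1 h2 =>
        rw [kids_ofWord_cons] at h1
        cases i with
        | zero =>
          simp only [List.getElem?_cons_zero, Option.some.injEq, Prod.mk.injEq] at h1
          obtain ⟨rfl, rfl⟩ := h1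
          exact ih _ _ _ h2
        | succ i => simp at h1

/-- The recursion `Anch` remembers of the upper end of an edge only whether it is labelled, while
the definition of anchored path queries looks at both ends of an edge in place. At the root, `b`
stands for the condition on the upper end. -/
theorem anch_iff {l : Option A} {b : Bool} {w : List (Step A)} : Anch b w ↔
    ∀ v u c (i : ℕ) (e : Edge) (k : Twig A), Walk (ofWord l w) v u c → c.kids[i]? = some (e, k) →
      (e = .desc → (v = [] → b = true) ∧ (v ≠ [] → c.rootLab ≠ none) ∧
        (k.rootLab = none → k.kids = [])) ∧ (e = .child → k.kids = [] → k.rootLab ≠ none) := by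
  induction w generalizing l b with
  | nil =>
    simp only [Anch, true_iff]
    intro v u c i e k h h'
    cases h with
    | nil => simp [ofWord, kids, tail] at h'
    | cons h1 => simp [ofWord, kids, tail] at h1
  | cons x w ih =>
    obtain ⟨e, l'⟩ := x
    rw [Anch, ih (l := l')]
    have h0 : ∀ {i : ℕ} {e' : Edge} {k : Twig A}, (ofWord l ((e, l') :: w)).kids[i]? = some (e', k) ↔
        i = 0 ∧ e' = e ∧ k = ofWord l' w := by
      intro i e' k
      rw [kids_ofWord_cons]
      cases i <;> simp [eq_comm]
    constructor
    · rintro ⟨h1, h2, h3⟩ v u c i e' k h h'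
      cases h with
      | nil =>
        obtain ⟨-, rfl, rfl⟩ := h0.1 h'
        simp only [kids_ofWord_eq_nil, rootLab_ofWord]
        exact ⟨fun h => ⟨fun _ => (h1 h).1, fun h => absurd rfl h, (h1 h).2⟩,
          fun h h4 h5 => h2 h h5 h4⟩
      | cons h4 h5 =>
        obtain ⟨-, rfl, rfl⟩ := h0.1 h4
        obtain ⟨h6, h7⟩ := h3 _ _ _ _ _ _ h5 h'
        refine ⟨fun h => ⟨by simp, fun _ => ?_, (h6 h).2.2⟩, h7⟩
        by_cases hv : ∃ v', v' = ([] : List ℕ) ∧ Walk (ofWord l' w) v' [] c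
        · obtain ⟨v', rfl, hv⟩ := hv
          obtain ⟨-, rfl⟩ := walk_nil.1 hv
          cases h5 with
          | nil =>
            have := (h6 h).1 rfl
            intro h8
            simp at h8
            simp [h8] at this
          | cons h9 h10 =>
            exact (h6 h).2.1 (by simp)
        · refine (h6 h).2.1 ?_
          rintro rfl
          obtain ⟨rfl, rfl⟩ := walk_nil.1 h5
          exact hv ⟨_, rfl, .nil _⟩
    · intro h
      have h1 := h [] [] _ 0 e _ (.nil _) (h0.2 ⟨rfl, rfl, rfl⟩)
      simp only [kids_ofWord_eq_nil, rootLab_ofWord] at h1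
      refine ⟨fun h2 => ⟨(h1.1 h2).1 trivial, (h1.1 h2).2.2⟩, fun h2 h3 h4 => h1.2 h2 h4 h3,
        fun v u c i e' k h2 h3 => ?_⟩
      obtain ⟨h4, h5⟩ := h _ _ _ _ _ _ (.cons (h0.2 ⟨rfl, rfl, rfl⟩) h2) h3
      refine ⟨fun h6 => ⟨?_, fun _ => (h4 h6).2.1 (by simp), (h4 h6).2.2⟩, h5⟩
      rintro rfl
      obtain ⟨rfl, rfl⟩ := walk_nil.1 h2
      have := (h4 h6).2.1 (by simp)
      simpa [Option.isSome_iff_ne_none] using this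

theorem isAnchoredPath_iff {p : Twig A} :
    p.IsAnchoredPath ↔ ∃ l w, p = ofWord l w ∧ Anch true w := by
  have key : ∀ l (w : List (Step A)), (ofWord l w).IsAnchoredPath ↔ Anch true w := by
    intro l w
    rw [anch_iff (l := l)]
    constructor
    · rintro ⟨h1, h2, h3⟩ v u c i e k h h'
      have he : (ofWord l w).HasEdge e h.toNode (h.snoc h').toNode :=
        ⟨i, k, rfl, by rw [Walk.sub_eq (n := h.toNode) h]; exact h'⟩
      have e1 : (ofWord l w).lab h.toNode = c.rootLab := by
        rw [lab, Walk.sub_eq (n := h.toNode) h]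
      have e2 : (ofWord l w).lab (h.snoc h').toNode = k.rootLab := by
        rw [lab, Walk.sub_eq (n := (h.snoc h').toNode) (h.snoc h')]
      have e3 : (ofWord l w).IsLeaf (h.snoc h').toNode ↔ k.kids = [] := by
        rw [IsLeaf, Walk.sub_eq (n := (h.snoc h').toNode) (h.snoc h')]
      refine ⟨fun h4 => ⟨fun _ => rfl, fun h5 h6 => ?_, fun h5 => ?_⟩, fun h4 h5 => ?_⟩
      · subst h4
        rcases (h2 _ _ he).1 (e1.trans h6) with h7 | h7
        · exact h5 (congrArg Subtype.val h7)
        · rw [IsLeaf, Walk.sub_eq (n := h.toNode) h] at h7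
          rw [h7] at h'
          simp at h'
      · subst h4
        rcases (h2 _ _ he).2 (e2.trans h5) with h7 | h7
        · have := congrArg Subtype.val h7
          simp [root] at this
        · exact e3.1 h7
      · subst h4
        rw [← e2]
        exact h3 _ _ he (e3.2 h5)
    · intro h
      refine ⟨isPath_iff_exists.2 ⟨w, rfl⟩, ?_, ?_⟩
      · rintro v v' ⟨i, k, h1, h2⟩
        obtain ⟨u, h3⟩ := walk_sub v
        obtain ⟨h4, -⟩ := h _ _ _ _ _ _ h3 h2
        obtain ⟨-, h5, h6⟩ := h4 rfl
        have h7 : (ofWord l w).sub v' = k := Walk.sub_eq (h1 ▸ h3.snoc h2)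
        refine ⟨fun h8 => ?_, fun h8 => .inr ?_⟩
        · by_cases h9 : v.1 = []
          · exact .inl (Subtype.ext h9)
          · exact absurd h8 (h5 h9)
        · rw [IsLeaf, h7]
          exact h6 (by rw [← h7]; exact h8)
      · rintro v v' ⟨i, k, h1, h2⟩ h8
        obtain ⟨u, h3⟩ := walk_sub v
        obtain ⟨-, h4⟩ := h _ _ _ _ _ _ h3 h2
        have h7 : (ofWord l w).sub v' = k := Walk.sub_eq (h1 ▸ h3.snoc h2)
        rw [lab, h7]
        exact h4 rfl (by rw [← h7]; exact h8)
  constructor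
  · intro h
    obtain ⟨w, hw⟩ := isPath_iff_exists.1 h.path
    exact ⟨_, w, hw, (key _ _).1 (hw ▸ h)⟩
  · rintro ⟨l, w, rfl, h⟩
    exact (key _ _).2 h

theorem isAnchoredPath_ofWord {l : Option A} {w : List (Step A)} :
    (ofWord l w).IsAnchoredPath ↔ Anch true w := by
  rw [isAnchoredPath_iff]
  constructor
  · rintro ⟨l', w', h, h'⟩
    have h1 : LeafW (ofWord l' w') _ w' := leafW_ofWord.2 ⟨rfl, rfl⟩
    rw [← h] at h1
    rwa [← (leafW_ofWord.1 h1).1]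
  · exact fun h => ⟨l, w, rfl, h⟩

/-! ### The paths of a query -/

mutual
/-- The addresses of the leaves, with the edges and labels leading to them. -/
def leaves : Twig A → List (List ℕ × List (Step A))
  | node _ [] => [([], [])]
  | node _ (k :: ks) => leavesKids 0 (k :: ks)
/-- The leaves of a list of subqueries, whose positions are counted from `i`. -/
def leavesKids (i : ℕ) : List (Edge × Twig A) → List (List ℕ × List (Step A))
  | [] => []
  | (e, c) :: ks =>
    (leaves c).map (fun x => (i :: x.1, (e, c.rootLab) :: x.2)) ++ leavesKids (i + 1) ks
end

theorem mem_leavesKids {ks : List (Edge × Twig A)}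
    (h : ∀ k ∈ ks, ∀ v w, (v, w) ∈ k.2.leaves ↔ LeafW k.2 v w) (i : ℕ) (v : List ℕ)
    (w : List (Step A)) : (v, w) ∈ leavesKids i ks ↔ ∃ j e c v' w', ks[j]? = some (e, c) ∧
        LeafW c v' w' ∧ v = (i + j) :: v' ∧ w = (e, c.rootLab) :: w' := by
  induction ks generalizing i v w with
  | nil => simp [leavesKids]
  | cons k ks ih2 =>
    obtain ⟨e, c⟩ := k
    simp only [leavesKids, List.mem_append, List.mem_map, Prod.exists, Prod.mk.injEq,
      ih2 (fun k hk => h k (by simp [hk])), h (e, c) (by simp)]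
    constructor
    · rintro (⟨v', w', h, rfl, rfl⟩ | ⟨j, e', c', v', w', h1, h2, rfl, rfl⟩)
      · exact ⟨0, e, c, v', w', rfl, h, rfl, rfl⟩
      · exact ⟨j + 1, e', c', v', w', h1, h2, by rw [add_assoc, add_comm 1], rfl⟩
    · rintro ⟨_ | j, e', c', v', w', h1, h2, rfl, rfl⟩
      · simp only [List.getElem?_cons_zero, Option.some.injEq, Prod.mk.injEq] at h1
        obtain ⟨rfl, rfl⟩ := h1
        exact .inl ⟨v', w', h2, rfl, rfl⟩
      · exact .inr ⟨j, e', c', v', w', h1, h2, by rw [add_assoc, add_comm 1], rfl⟩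

/-- The list `paths` forgets at which leaf a path ends. Listing addresses along with words makes it
possible to express that two paths belong to different leaves, even if their words agree. -/
theorem leaves_spec (q : Twig A) : (q.paths = q.leaves.map fun x => ofWord q.rootLab x.2) ∧
    (∀ v w, (v, w) ∈ q.leaves ↔ LeafW q v w) ∧ q.leaves.Nodup := by
  induction q using ind with
  | h l ks ih =>
    have h1 : ∀ i, (pathsKids ks).map (fun k => node l [k]) =
        (leavesKids i ks).map fun x => ofWord l x.2 := by
      induction ks with
      | nil => intro i; simp [pathsKids, leavesKids]
      | cons k ks ih2 =>
        intro i
        obtain ⟨e, c⟩ := k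
        simp only [pathsKids, leavesKids, List.map_append, List.map_map,
          ih2 (fun k hk => ih k (by simp [hk])) (i + 1), (ih (e, c) (by simp)).1]
        rfl
    have h2 := mem_leavesKids (ks := ks) fun k hk => (ih k hk).2.1
    have h3 : ∀ i, (leavesKids i ks).Nodup := by
      clear h1
      induction ks with
      | nil => simp [leavesKids]
      | cons k ks ih2 =>
        intro i
        obtain ⟨e, c⟩ := k
        rw [leavesKids, List.nodup_append]
        refine ⟨(ih (e, c) (by simp)).2.2.map ?_, ?_, ?_⟩
        · rintro ⟨a, b⟩ ⟨a', b'⟩ h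
          simpa using h
        · exact ih2 (fun k hk => ih k (by simp [hk])) (mem_leavesKids fun k hk =>
            (ih k (by simp [hk])).2.1) _
        · rintro a ha ⟨v, w⟩ hb rfl
          obtain ⟨x, -, hx⟩ := List.mem_map.1 ha
          obtain ⟨j, -, -, v', -, -, -, h, -⟩ := (mem_leavesKids (fun k hk =>
            (ih k (by simp [hk])).2.1) _ _ _).1 hb
          rw [Prod.mk.injEq, h, List.cons.injEq] at hx
          omega
    cases ks with
    | nil =>
      refine ⟨by simp [paths, leaves, ofWord, tail, rootLab], fun v w => ?_, by simp [leaves]⟩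
      cases v with
      | nil => simp [leaves, leafW_nil, kids]
      | cons i v => simp [leaves, leafW_cons, kids]
    | cons k ks =>
      refine ⟨?_, fun v w => ?_, ?_⟩
      · rw [paths, leaves]; exact h1 0
      · rw [leaves, h2]
        cases v with
        | nil => simp [leafW_nil, kids]
        | cons i v =>
          rw [leafW_cons]
          constructor
          · rintro ⟨j, e, c, v', w', h4, h5, h6, rfl⟩
            simp only [zero_add, List.cons.injEq] at h6
            obtain ⟨rfl, rfl⟩ := h6
            exact ⟨e, c, w', h4, h5, rfl⟩
          · rintro ⟨e, c, w', h4, h5, rfl⟩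
            exact ⟨i, e, c, v, w', h4, h5, by simp, rfl⟩
      · rw [leaves]; exact h3 0

theorem mem_paths {p q : Twig A} :
    p ∈ q.paths ↔ ∃ v w, LeafW q v w ∧ p = ofWord q.rootLab w := by
  obtain ⟨h1, h2, -⟩ := leaves_spec q
  simp only [h1, List.mem_map, Prod.exists, h2, eq_comm]

theorem reduced_paths_iff {q : Twig A} : Reduced q.paths ↔ ∀ v w v' w', LeafW q v w →
    LeafW q v' w' → v ≠ v' → ¬ (ofWord q.rootLab w).Contained (ofWord q.rootLab w') := by
  obtain ⟨h1, h2, h3⟩ := leaves_spec q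
  rw [Reduced, h1, List.pairwise_map]
  constructor
  · intro h v w v' w' h4 h5 h6
    have hs : Std.Symm fun (a b : List ℕ × List (Step A)) =>
      ¬ (ofWord q.rootLab a.2).Contained (ofWord q.rootLab b.2) ∧
      ¬ (ofWord q.rootLab b.2).Contained (ofWord q.rootLab a.2) := ⟨fun _ _ h => h.symm⟩
    exact (h.forall ((h2 _ _).2 h4) ((h2 _ _).2 h5) (by simp [h6])).1
  · rintro h
    refine h3.pairwise_of_forall_ne ?_
    rintro ⟨v, w⟩ h4 ⟨v', w'⟩ h5 h6
    have h7 : v ≠ v' := by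
      rintro rfl
      exact h6 (by rw [((h2 _ _).1 h4).unique ((h2 _ _).1 h5)])
    exact ⟨h _ _ _ _ ((h2 _ _).1 h4) ((h2 _ _).1 h5) h7,
      h _ _ _ _ ((h2 _ _).1 h5) ((h2 _ _).1 h4) h7.symm⟩

theorem Reduced.nodup {P : List (Twig A)} (h : Reduced P) : P.Nodup :=
  h.imp fun h => by rintro rfl; exact h.1 (Set.Subset.refl _)

end Twig

/-! ## Canonical trees -/

namespace Twig

variable {A : Type*}

/-- All root-to-leaf paths of `q` are anchored; `b` says whether the root counts as labelled. -/
def Anchored (b : Bool) (q : Twig A) : Prop := ∀ v w, LeafW q v w → Anch b w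

theorem Anchored.kid {b : Bool} {q c : Twig A} {e : Edge} (h : Anchored b q)
    (hc : (e, c) ∈ q.kids) : Anchored c.rootLab.isSome c ∧
      (e = .desc → b = true ∧ (c.rootLab = none → c.kids = [])) ∧
      (e = .child → c.rootLab = none → c.kids ≠ []) := by
  obtain ⟨i, hi⟩ := List.mem_iff_getElem?.1 hc
  have h1 : ∀ v w, LeafW c v w → Anch b ((e, c.rootLab) :: w) := fun v w hw =>
    h (i :: v) _ (leafW_cons.2 ⟨e, c, w, hi, hw, rfl⟩)
  obtain ⟨v, w, hw⟩ := exists_leafW c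
  have h2 : w = [] ↔ c.kids = [] := by
    cases v with
    | nil => obtain ⟨rfl, h⟩ := leafW_nil.1 hw; simp [h]
    | cons i v =>
      obtain ⟨e, k, w', h3, -, rfl⟩ := leafW_cons.1 hw
      have : c.kids ≠ [] := by rintro h4; simp [h4] at h3
      simp [this]
  have h3 := h1 v w hw
  exact ⟨fun v w hw => (h1 v w hw).2.2, fun he => ⟨(h3.1 he).1, fun hl => h2.1 ((h3.1 he).2 hl)⟩,
    fun he hl hk => h3.2.1 he hl (h2.2 hk)⟩

theorem isTree_iff_walk {t : Twig A} : t.IsTree ↔ ∀ v w c, Walk t v w c →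
    c.rootLab ≠ none ∧ ∀ e k, (e, k) ∈ c.kids → e = .child := by
  constructor
  · rintro ⟨h1, h2⟩ v w c h
    constructor
    · have := h1 h.toNode
      rwa [lab, Walk.sub_eq (n := h.toNode) h] at this
    · rintro (_ | _) k hk
      · rfl
      · obtain ⟨i, hi⟩ := List.mem_iff_getElem?.1 hk
        exact absurd ⟨i, k, rfl, by rw [Walk.sub_eq (n := h.toNode) h]; exact hi⟩
          (h2 h.toNode (h.snoc hi).toNode)
  · intro h
    constructor
    · intro v
      obtain ⟨w, hw⟩ := walk_sub v
      exact (h _ _ _ hw).1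
    · rintro v v' ⟨i, k, h1, h2⟩
      obtain ⟨w, hw⟩ := walk_sub v
      exact absurd ((h _ _ _ hw).2 _ k (List.mem_iff_getElem?.2 ⟨i, h2⟩)) (by simp)

theorem isTree_iff {t : Twig A} : t.IsTree ↔
    t.rootLab ≠ none ∧ ∀ e c, (e, c) ∈ t.kids → e = .child ∧ c.IsTree := by
  simp only [isTree_iff_walk]
  constructor
  · intro h
    obtain ⟨h1, h2⟩ := h _ _ _ (.nil _)
    refine ⟨h1, fun e c hc => ⟨h2 _ _ hc, fun v w c' h' => ?_⟩⟩
    obtain ⟨i, hi⟩ := List.mem_iff_getElem?.1 hc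
    exact h _ _ _ (.cons hi h')
  · rintro ⟨h1, h2⟩ v w c (_ | ⟨h3, h4⟩)
    · exact ⟨h1, fun e k hk => (h2 e k hk).1⟩
    · exact (h2 _ _ (List.mem_iff_getElem?.2 ⟨_, h3⟩)).2 _ _ _ h4

theorem size_eq (l : Option A) (ks : List (Edge × Twig A)) :
    (node l ks).size = 1 + (ks.map fun k => k.2.size).sum := by
  rw [size]
  congr 1
  induction ks with
  | nil => rfl
  | cons k ks ih => obtain ⟨e, c⟩ := k; simp [sizeKids, ih]

theorem one_le_size (q : Twig A) : 1 ≤ q.size := by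
  obtain ⟨l, ks⟩ := q
  rw [size_eq]
  omega

theorem Walk.length_add_size_le {q c : Twig A} {v : List ℕ} {w : List (Step A)}
    (h : Walk q v w c) : v.length + c.size ≤ q.size := by
  induction h with
  | nil => simp
  | @cons q c c' i v w e h1 h2 ih =>
    obtain ⟨l, ks⟩ := q
    have h3 : (e, c) ∈ ks := List.mem_iff_getElem?.2 ⟨_, h1⟩
    have := List.single_le_sum (l := ks.map fun k => k.2.size) (by simp) c.size
      (List.mem_map.2 ⟨_, h3, rfl⟩)
    rw [size_eq, List.length_cons]
    omega

/-- A chain of `n` nodes labelled `z` above `t`. -/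
def chain (z : A) (t : Twig A) : ℕ → Twig A
  | 0 => t
  | n + 1 => node (some z) [(.child, chain z t n)]

/-- The end of the edge that replaces an edge of kind `e` to `t`. -/
def stretch (k : ℕ) (z : A) : Edge → Twig A → Twig A
  | .child, t => t
  | .desc, t => chain z t k

mutual
/-- The canonical tree of a query: wildcards become `z`, and descendant edges become chains with
`k` inner nodes labelled `z`. -/
def canon (k : ℕ) (z : A) : Twig A → Twig A
  | node l ks => node (some (l.getD z)) (canonKids k z ks)
/-- The canonical trees of a list of subqueries. -/
def canonKids (k : ℕ) (z : A) : List (Edge × Twig A) → List (Edge × Twig A)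
  | [] => []
  | (e, c) :: ks => (.child, stretch k z e (canon k z c)) :: canonKids k z ks
end

variable {k : ℕ} {z : A}

theorem canonKids_eq (ks : List (Edge × Twig A)) : canonKids k z ks =
    ks.map fun x => (.child, stretch k z x.1 (canon k z x.2)) := by
  induction ks with
  | nil => rfl
  | cons x ks ih => obtain ⟨e, c⟩ := x; simp [canonKids, ih]

theorem canon_node (l : Option A) (ks : List (Edge × Twig A)) : canon k z (node l ks) =
    node (some (l.getD z)) (ks.map fun x => (.child, stretch k z x.1 (canon k z x.2))) := by
  rw [canon, canonKids_eq]

theorem rootLab_canon (q : Twig A) : (canon k z q).rootLab = some (q.rootLab.getD z) := by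
  cases q; rfl

theorem kids_canon (q : Twig A) : (canon k z q).kids =
    q.kids.map fun x => (.child, stretch k z x.1 (canon k z x.2)) := by
  cases q; rw [canon_node]; rfl

theorem isTree_chain {t : Twig A} (h : t.IsTree) (n : ℕ) : (chain z t n).IsTree := by
  induction n with
  | zero => exact h
  | succ n ih =>
    rw [isTree_iff]
    refine ⟨by simp [chain, rootLab], fun e c hc => ?_⟩
    simp only [chain, kids, List.mem_singleton, Prod.mk.injEq] at hc
    obtain ⟨rfl, rfl⟩ := hc
    exact ⟨rfl, ih⟩

theorem isTree_canon (q : Twig A) : (canon k z q).IsTree := by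
  induction q using ind with
  | h l ks ih =>
    rw [isTree_iff, rootLab_canon, kids_canon]
    refine ⟨by simp, fun e c hc => ?_⟩
    obtain ⟨x, hx, h⟩ := List.mem_map.1 hc
    cases h
    refine ⟨rfl, ?_⟩
    cases x.1
    · exact ih x hx
    · exact isTree_chain (ih x hx) _

theorem walk_chain (t : Twig A) (n : ℕ) : ∃ v w, v.length = n ∧ Walk (chain z t n) v w t := by
  induction n with
  | zero => exact ⟨[], [], rfl, .nil _⟩
  | succ n ih =>
    obtain ⟨v, w, h, h'⟩ := ih
    exact ⟨0 :: v, _, by simp [h], .cons (q := chain z t (n + 1)) (e := .child)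
      (by simp [chain, kids]) h'⟩

theorem match_canon (q : Twig A) : Match q (canon k z q) := by
  induction q using ind with
  | h l ks ih =>
    rw [match_iff, rootLab_canon]
    refine ⟨fun h => ?_, fun e c hc => ⟨canon k z c, ?_, ih _ hc⟩⟩
    · obtain ⟨a, ha⟩ := Option.ne_none_iff_exists'.1 h
      simp [rootLab] at ha ⊢
      simp [ha]
    · have h1 : (Edge.child, stretch k z e (canon k z c)) ∈ (canon k z (node l ks)).kids := by
        rw [kids_canon]
        exact List.mem_map.2 ⟨_, hc, rfl⟩
      cases e with
      | child => exact h1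
      | desc =>
        obtain ⟨i, hi⟩ := List.mem_iff_getElem?.1 h1
        obtain ⟨v, w, -, h⟩ := walk_chain (z := z) (canon k z c) k
        exact ⟨i :: v, _, by simp, .cons hi h⟩

theorem size_chain (t : Twig A) (n : ℕ) : (chain z t n).size = n + t.size := by
  induction n with
  | zero => simp [chain]
  | succ n ih => rw [chain, size_eq]; simp [ih]; omega

/-- Each node costs itself and at most `k` chain nodes on the edge above it. The root has no such
edge; the summand `k` records this saving and pays for the edge above it in the induction. -/
theorem size_canon_add_le (q : Twig A) : (canon k z q).size + k ≤ (k + 1) * q.size := by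
  induction q using ind with
  | h l ks ih =>
    rw [canon_node, size_eq, size_eq, List.map_map]
    have h : (ks.map ((fun x : Edge × Twig A => x.2.size) ∘
        fun x => (Edge.child, stretch k z x.1 (canon k z x.2)))).sum ≤
        (k + 1) * (ks.map fun x => x.2.size).sum := by
      induction ks with
      | nil => simp
      | cons x ks ih2 =>
        have h1 := ih2 fun k hk => ih k (by simp [hk])
        have h2 := ih x (by simp)
        have h3 : (stretch k z x.1 (canon k z x.2)).size ≤ k + (canon k z x.2).size := by
          cases x.1 <;> simp [stretch, size_chain]
        simp only [List.map_cons, List.sum_cons, mul_add, Function.comp] at h1 ⊢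
        omega
    rw [mul_add]
    omega

theorem size_canon_le (q : Twig A) : (canon k z q).size ≤ (k + 1) * q.size := by
  have := size_canon_add_le (k := k) (z := z) q
  omega

/-- The number `j` counts the steps from the node down its chain to the canonical tree of the
subquery `c'`. That the root has `j = 0` keeps nodes below the root on proper subqueries `c'`, as is
needed for images of descendant edges. -/
theorem walk_canon {q x : Twig A} {v : List ℕ} {w : List (Step A)}
    (h : Walk (canon k z q) v w x) : ∃ v' w' c' j, Walk q v' w' c' ∧ (v ≠ [] → v' ≠ []) ∧ (v = [] → j = 0) ∧
      x = chain z (canon k z c') j := by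
  induction v using List.reverseRecOn generalizing w x with
  | nil =>
    obtain ⟨-, rfl⟩ := walk_nil.1 h
    exact ⟨[], [], q, 0, .nil _, fun h => h, fun _ => rfl, rfl⟩
  | append_singleton v i ih =>
    obtain ⟨e, m, w', h1, h2, rfl⟩ := walk_snoc.1 h
    obtain ⟨v', w', c', j, h3, h4, h7, rfl⟩ := ih h2
    cases j with
    | zero =>
      rw [chain, kids_canon, List.getElem?_map, Option.map_eq_some_iff] at h1
      obtain ⟨⟨e', c⟩, h5, h6⟩ := h1
      cases h6
      refine ⟨_, _, c, match e' with | .child => 0 | .desc => k, h3.snoc h5, by simp,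
        by simp, ?_⟩
      cases e' <;> rfl
    | succ j =>
      cases i with
      | zero =>
        simp only [chain, kids, List.getElem?_cons_zero, Option.some.injEq, Prod.mk.injEq] at h1
        obtain ⟨rfl, rfl⟩ := h1
        refine ⟨v', w', c', j, h3, fun _ => h4 ?_, by simp, rfl⟩
        rintro rfl
        simp at h7
      | succ i => simp [chain, kids] at h1

/-- A root counted as unlabelled has only child edges below it, so its children land on the next
chain node. They cannot be labelled, as `z` is excluded, and a wildcard entered by a child edge is
not a leaf. This repeats until `c` has used up its depth, before the chain ends. -/
theorem not_match_chain {c t : Twig A} {n : ℕ} (hz : ∀ v w c', Walk c v w c' → c'.rootLab ≠ some z)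
    (hl : ∀ v w c', Walk c v w c' → v.length < n) (ha : Anchored false c) (hk : c.kids ≠ []) :
    ¬ Match c (chain z t n) := by
  induction n generalizing c with
  | zero => simpa using hl _ _ _ (.nil _)
  | succ n ih =>
    intro h
    obtain ⟨⟨e, c'⟩, hc'⟩ := List.exists_mem_of_ne_nil _ hk
    obtain ⟨h1, h2, h3⟩ := ha.kid hc'
    obtain ⟨i, hi⟩ := List.mem_iff_getElem?.1 hc'
    cases e with
    | desc => simpa using (h2 rfl).1
    | child =>
      obtain ⟨x, h4, h5⟩ := (match_iff.1 h).2 _ _ hc'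
      simp only [Reach, chain, kids, List.mem_singleton, Prod.mk.injEq, true_and] at h4
      subst h4
      have hl' : ∀ v w c1, Walk c' v w c1 → v.length < n := fun v w c1 hw => by
        simpa using hl _ _ _ (.cons hi hw)
      have hz' : ∀ v w c1, Walk c' v w c1 → c1.rootLab ≠ some z := fun v w c1 hw =>
        hz _ _ _ (.cons hi hw)
      have hn : c'.rootLab = none := by
        cases n with
        | zero => simpa using hl' _ _ _ (.nil _)
        | succ n =>
          by_contra h6
          exact hz' _ _ _ (.nil _) ((match_iff.1 h5).1 h6).symm
      rw [hn] at h1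
      exact ih hz' hl' h1 (h3 rfl hn) h5

/-- Only images on the chains have to be repaired. The end of a descendant edge on a chain is a
wildcard, hence a leaf, and can be moved to the lower end of the chain. The end of a child edge
cannot lie on a chain, by `not_match_chain`. -/
theorem Match.of_canon {p q : Twig A} {b : Bool} (h : Match p (canon k z q)) (ha : Anchored b p)
    (hz : ∀ v w c, Walk p v w c → c.rootLab ≠ some z)
    (hl : ∀ v w c, Walk p v w c → v.length ≤ k) : Match p q := by
  induction p using ind generalizing b q with
  | h l ks ih =>
    obtain ⟨h1, h2⟩ := match_iff.1 h
    rw [match_iff]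
    constructor
    · intro h3
      have h4 := h1 h3
      have h5 := hz _ _ _ (.nil _)
      rw [rootLab_canon] at h4
      cases h6 : q.rootLab with
      | none => simp [h6] at h4; exact absurd h4.symm h5
      | some a => simpa [h6] using h4
    · intro e c hc
      obtain ⟨i, hi⟩ := List.mem_iff_getElem?.1 hc
      obtain ⟨ha1, ha2, ha3⟩ := ha.kid hc
      have hz' : ∀ v w c1, Walk c v w c1 → c1.rootLab ≠ some z := fun v w c1 hw =>
        hz _ _ _ (.cons hi hw)
      have hl' : ∀ v w c1, Walk c v w c1 → v.length < k := fun v w c1 hw => by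
        simpa using hl _ _ _ (.cons hi hw)
      obtain ⟨x, h3, h4⟩ := h2 e c hc
      cases e with
      | child =>
        rw [Reach, kids_canon] at h3
        obtain ⟨⟨e', c'⟩, h5, h6⟩ := List.mem_map.1 h3
        cases h6
        cases e' with
        | child => exact ⟨c', h5, ih _ hc h4 ha1 hz' fun v w c1 hw => (hl' v w c1 hw).le⟩
        | desc =>
          have hn : c.rootLab = none := by
            by_contra h6
            have h7 := (match_iff.1 h4).1 h6
            have hk := hl' _ _ _ (.nil _)
            obtain ⟨k, rfl⟩ : ∃ n, k = n + 1 := ⟨k - 1, by simp at hk; omega⟩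
            exact hz' _ _ _ (.nil _) h7.symm
          rw [hn] at ha1
          exact absurd h4 (not_match_chain hz' hl' ha1 (ha3 rfl hn))
      | desc =>
        obtain ⟨v, w, hv, h5⟩ := h3
        obtain ⟨v', w', c', j, h6, h7, -, rfl⟩ := walk_canon h5
        refine ⟨c', ⟨v', w', h7 hv, h6⟩, ?_⟩
        cases j with
        | zero => exact ih _ hc h4 ha1 hz' fun v w c1 hw => (hl' v w c1 hw).le
        | succ j =>
          have hn : c.rootLab = none := by
            by_contra h6
            exact hz' _ _ _ (.nil _) ((match_iff.1 h4).1 h6).symm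
          rw [match_iff, hn, (ha2 rfl).2 hn]
          exact ⟨fun h => absurd rfl h, by simp⟩

theorem RawEmb.length_le {p q c : Twig A} {F : List ℕ → List ℕ} (hF : RawEmb p q F)
    {v v' : List ℕ} {w w' : List (Step A)} (h : Walk p v w c) {c' : Twig A} (h' : Walk c v' w' c') :
    ∃ x, F (v ++ v') = F v ++ x ∧ v'.length ≤ x.length := by
  induction v' using List.reverseRecOn generalizing w' c' with
  | nil => exact ⟨[], by simp⟩
  | append_singleton v' i ih =>
    obtain ⟨e, m, w1, h1, h2, -⟩ := walk_snoc.1 h'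
    obtain ⟨x, h3, h4⟩ := ih h2
    obtain ⟨y, hy, h5⟩ := hF.below (h.append h2) h1
    refine ⟨x ++ y, by rw [← List.append_assoc, h5, h3, List.append_assoc], ?_⟩
    have := List.length_pos_iff.2 hy
    simp
    omega

/-- An anchored query that embeds in two suitable canonical trees, of `q` and of `q'`, embeds in
`q'`. -/
theorem Match.of_canons {p q q' : Twig A} {z' : A} (ha : Anchored true p)
    (h0 : Match p (canon 0 z' q)) (h1 : Match p (canon q.size z q')) (hzz : z ≠ z')
    (hz : ∀ v w c, Walk q v w c → c.rootLab ≠ some z) : Match p q' := by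
  obtain ⟨F, hF⟩ := h0.exists_rawEmb
  -- The tree with the short edges contains only labels of `q` and `z'`, so `z` does not occur in
  -- `p`; its size is at most that of `q`, which bounds the depth of `p` by the length of the chains
  -- in the other tree.
  refine h1.of_canon ha (fun v w c hw h => ?_) fun v w c hw => ?_
  · obtain ⟨w', c', h2, h3⟩ := hF.walk hw
    rw [h] at h3
    have h4 := h3 (by simp)
    obtain ⟨v', w', c1, j, h5, -, -, rfl⟩ := walk_canon h2
    cases j with
    | zero =>
      rw [chain, rootLab_canon] at h4
      cases h6 : c1.rootLab with
      | none => simp [h6] at h4; exact hzz h4.symm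
      | some a => exact hz _ _ _ h5 (by simpa [h6] using h4)
    | succ j =>
      simp [chain, rootLab] at h4
      exact hzz h4.symm
  · obtain ⟨x, h2, h3⟩ := hF.length_le (.nil _) hw
    obtain ⟨w', c', h4, -⟩ := hF.walk hw
    have h5 := h4.length_add_size_le
    have h6 := size_canon_le (k := 0) (z := z') q
    rw [hF.root] at h2
    simp only [List.nil_append] at h2
    rw [h2] at h5
    omega

theorem finite_labels (q : Twig A) : {a | ∃ v w c, Walk q v w c ∧ c.rootLab = some a}.Finite := by
  induction q using ind with
  | h l ks ih =>
    have h1 : {a | l = some a}.Finite := by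
      cases l with
      | none => simp
      | some a => simp [eq_comm]
    have h2 : (⋃ k ∈ {k | k ∈ ks}, {a | ∃ v w c, Walk k.2 v w c ∧ c.rootLab = some a}).Finite :=
      Set.Finite.biUnion (List.finite_toSet ks) fun k hk => ih k hk
    refine (h1.union h2).subset ?_
    rintro a ⟨v, w, c, h, ha⟩
    cases h with
    | nil => exact .inl ha
    | cons h3 h4 =>
      refine .inr (Set.mem_biUnion (List.mem_iff_getElem?.2 ⟨_, h3⟩) ⟨_, _, _, h4, ha⟩)

theorem exists_fresh [Infinite A] (q : Twig A) : ∃ z z' : A, z ≠ z' ∧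
    ∀ v w c, Walk q v w c → c.rootLab ≠ some z := by
  obtain ⟨z, hz⟩ := (finite_labels q).exists_notMem
  obtain ⟨z', hz'⟩ := exists_ne z
  exact ⟨z, z', hz'.symm, fun v w c h h' => hz ⟨v, w, c, h, h'⟩⟩

end Twig

/-! ## Specializations of anchored path queries -/

namespace Twig

variable {A : Type*}

/-- The elementary specializations of the part of an anchored path query below the root: to give a
label to a wildcard, to append a wildcard leaf, to insert a label into a descendant edge, and to
replace a descendant edge by a chain of child edges. -/
inductive Spec : List (Step A) → List (Step A) → Prop
  | lab (e : Edge) (a : A) (w : List (Step A)) : Spec ((e, none) :: w) ((e, some a) :: w)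
  | ext (e : Edge) (a : A) : Spec [(e, some a)] [(e, some a), (.desc, none)]
  | ins (l : Option A) (a : A) (w : List (Step A)) :
      Spec ((.desc, l) :: w) ((.desc, some a) :: (.desc, l) :: w)
  | run (m : ℕ) (b : A) (w : List (Step A)) : Spec ((.desc, some b) :: w)
      (List.replicate m (.child, none) ++ (.child, some b) :: w)
  | cons (x : Step A) {w w' : List (Step A)} : Spec w w' → Spec (x :: w) (x :: w')

theorem anch_cons_some {b : Bool} {e : Edge} {a : A} {w : List (Step A)} :
    Anch b ((e, some a) :: w) ↔ (e = .desc → b = true) ∧ Anch true w := by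
  simp [Anch]

theorem anch_child_none {b : Bool} {w : List (Step A)} :
    Anch b ((.child, none) :: w) ↔ w ≠ [] ∧ Anch false w := by
  simp [Anch]

theorem anch_desc_none {b : Bool} {w : List (Step A)} :
    Anch b ((.desc, none) :: w) ↔ b = true ∧ w = [] := by
  cases w <;> simp [Anch]

theorem Spec.ne_nil {w w' : List (Step A)} (h : Spec w w') : w ≠ [] ∧ w' ≠ [] := by
  cases h <;> simp

theorem Spec.anch {w w' : List (Step A)} (h : Spec w w') {b : Bool} (ha : Anch b w) :
    Anch b w' := by
  induction h generalizing b with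
  | lab e a w =>
    rw [anch_cons_some]
    cases e with
    | child => exact ⟨by simp, (anch_child_none.1 ha).2.mono (by simp)⟩
    | desc => obtain ⟨h, rfl⟩ := anch_desc_none.1 ha; exact ⟨fun _ => h, trivial⟩
  | ext e a => exact anch_cons_some.2 ⟨(anch_cons_some.1 ha).1, anch_desc_none.2 ⟨rfl, rfl⟩⟩
  | ins l a w => exact anch_cons_some.2 ⟨fun _ => (ha.1 rfl).1, ha.mono (by simp)⟩
  | run m b' w =>
    have h1 := (anch_cons_some.1 ha).2
    clear ha
    induction m generalizing b with
    | zero => exact anch_cons_some.2 ⟨by simp, h1⟩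
    | succ m ih => exact anch_child_none.2 ⟨by simp, ih⟩
  | cons x h ih =>
    exact ⟨fun h1 => ⟨(ha.1 h1).1, fun h2 => absurd ((ha.1 h1).2 h2) h.ne_nil.1⟩,
      fun _ _ => h.ne_nil.2, ih ha.2.2⟩

/-- The weight of a path query, which grows with each elementary specialization. -/
def weight (w : List (Step A)) : ℕ :=
  (w.map fun x => (match x.1 with | .child => 2 | .desc => 1) + x.2.toList.length).sum

/-- Together with `Spec.weight_lt` this bounds the number of successive specializations that still
embed in a given tree. -/
theorem weight_le (w : List (Step A)) : weight w ≤ 3 * w.length := by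
  induction w with
  | nil => simp [weight]
  | cons x w ih => rcases x with ⟨_ | _, _ | _⟩ <;> simp [weight] at * <;> omega

theorem Spec.weight_lt {w w' : List (Step A)} (h : Spec w w') : weight w < weight w' := by
  induction h with
  | lab e a w => simp [weight]
  | ext e a => simp [weight]
  | ins l a w => simp [weight]
  | run m b w => simp [weight]; omega
  | cons x h ih => simp [weight] at *; omega

/-- After a wildcard come only child edges as long as no label is met, and a wildcard entered by a
child edge is not a leaf. So a label must follow. -/
theorem PE.exists_label {w : List (Step A)} (ha : Anch false w) (hw : w ≠ []) :
    ∃ a, PE [(.desc, some a)] w := by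
  induction w with
  | nil => exact absurd rfl hw
  | cons x w ih =>
    obtain ⟨e, _ | a⟩ := x
    · cases e with
      | child =>
        obtain ⟨h1, h2⟩ := anch_child_none.1 ha
        obtain ⟨a, h⟩ := ih h2 h1
        exact ⟨a, .skip _ h⟩
      | desc => simp [anch_desc_none] at ha
    · exact ⟨a, .desc _ (fun _ => rfl) (.nil _)⟩

/-- `w'` follows a skipped wildcard, hence runs through child edges and wildcards to a first label.
If the end of the descendant edge is mapped below this label, the label can be inserted. If a
labelled end is mapped to it, the edge can become a run of child edges. An unlabelled end is a leaf,
and can be labelled with a label at or below its image. -/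
theorem PE.exists_of_skip {l : Option A} {w w' : List (Step A)} (h : PE ((.desc, l) :: w) w')
    (ha : Anch true ((.desc, l) :: w)) (ha' : Anch false w') :
    (∃ a, PE ((.desc, some a) :: (.desc, l) :: w) w') ∨
    (∃ b m, l = some b ∧ PE (List.replicate m (.child, none) ++ (.child, some b) :: w) w') ∨
    ∃ a, l = none ∧ PE ((.desc, some a) :: w) w' := by
  induction w' with
  | nil => cases h
  | cons x w' ih =>
    obtain ⟨e', l'⟩ := x
    cases e' with
    | desc => simpa using (ha'.1 rfl).1
    | child =>
      cases h with
      | desc _ h1 h2 =>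
        cases l with
        | some b => exact .inr (.inl ⟨b, 0, rfl, .child h1 h2⟩)
        | none =>
          obtain ⟨-, rfl⟩ := anch_desc_none.1 ha
          cases l' with
          | some a => exact .inr (.inr ⟨a, rfl, .desc _ (fun _ => rfl) (.nil _)⟩)
          | none =>
            obtain ⟨h3, h4⟩ := anch_child_none.1 ha'
            obtain ⟨a, h⟩ := exists_label h4 h3
            exact .inr (.inr ⟨a, rfl, .skip _ h⟩)
      | skip _ h1 =>
        cases l' with
        | some a => exact .inl ⟨a, .desc _ (fun _ => rfl) h1⟩
        | none =>
          obtain ⟨h3, h4⟩ := anch_child_none.1 ha'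
          rcases ih h1 h4 with ⟨a, h⟩ | ⟨b, m, rfl, h⟩ | ⟨a, rfl, h⟩
          · exact .inl ⟨a, .skip _ h⟩
          · exact .inr (.inl ⟨b, m + 1, rfl, .child (fun h => absurd rfl h) h⟩)
          · exact .inr (.inr ⟨a, rfl, .skip _ h⟩)

/-- A proper specialization passes through an elementary one. -/
theorem PE.eq_or_exists_spec {w w' : List (Step A)} (h : PE w w') {b : Bool} (ha : Anch b w)
    (ha' : Anch b w') (hw : w = [] → w' = []) : w = w' ∨ ∃ w'', Spec w w'' ∧ PE w'' w' := by
  -- The case of equal first steps, where the specialization happens further below. If `w` ends here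
  -- and `w'` does not, a wildcard leaf is appended; this needs a label at the present end. The
  -- hypothesis `hw` leaves an extension at the root to `RootSpec.ext`.
  have step : ∀ {e : Edge} {l : Option A} {w w' : List (Step A)} {b : Bool},
      (∀ {b}, Anch b w → Anch b w' → (w = [] → w' = []) → w = w' ∨ ∃ w'', Spec w w'' ∧ PE w'' w') →
      PE w w' → Anch b ((e, l) :: w) → Anch b ((e, l) :: w') →
      (e, l) :: w = (e, l) :: w' ∨ ∃ w'', Spec ((e, l) :: w) w'' ∧ PE w'' ((e, l) :: w') := by
    intro e l w w' b ih h ha ha'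
    have lift : ∀ {u : List (Step A)}, PE u w' → PE ((e, l) :: u) ((e, l) :: w') := by
      intro u hu
      cases e with
      | child => exact .child (fun _ => rfl) hu
      | desc => exact .desc _ (fun _ => rfl) hu
    by_cases hw : w = [] ∧ w' ≠ []
    · obtain ⟨rfl, hw'⟩ := hw
      cases l with
      | some a =>
        refine .inr ⟨_, .ext e a, lift ?_⟩
        obtain ⟨x, w', rfl⟩ := List.exists_cons_of_ne_nil hw'
        exact .desc _ (fun h => absurd rfl h) (.nil _)
      | none =>
        cases e with
        | child => exact absurd rfl (anch_child_none.1 ha).1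
        | desc => exact absurd (anch_desc_none.1 ha').2 hw'
    · rcases ih ha.2.2 ha'.2.2 (by tauto) with rfl | ⟨w'', h1, h2⟩
      · exact .inl rfl
      · exact .inr ⟨_, .cons _ h1, lift h2⟩
  induction h generalizing b with
  | nil w' => exact .inl (hw rfl).symm
  | @child l l' w w' h1 h2 ih =>
    cases l with
    | none =>
      cases l' with
      | none => exact step ih h2 ha ha'
      | some a => exact .inr ⟨_, .lab _ a _, .child (fun _ => rfl) h2⟩
    | some a =>
      obtain rfl : l' = some a := h1 (by simp)
      exact step ih h2 ha ha'
  | @desc l l' w w' e h1 h2 ih =>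
    cases e with
    | desc =>
      cases l with
      | none =>
        cases l' with
        | none => exact step ih h2 ha ha'
        | some a => exact .inr ⟨_, .lab _ a _, .desc _ (fun _ => rfl) h2⟩
      | some a =>
        obtain rfl : l' = some a := h1 (by simp)
        exact step ih h2 ha ha'
    | child =>
      cases l with
      | some b => exact .inr ⟨_, .run 0 b w, .child h1 h2⟩
      | none =>
        obtain ⟨-, rfl⟩ := anch_desc_none.1 ha
        cases l' with
        | some a => exact .inr ⟨_, .lab _ a _, .desc _ (fun _ => rfl) h2⟩
        | none =>
          obtain ⟨h3, h4⟩ := anch_child_none.1 ha'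
          obtain ⟨a, h⟩ := exists_label h4 h3
          exact .inr ⟨_, .lab _ a _, .skip _ h⟩
  | @skip l w w' x h1 ih =>
    obtain ⟨e, _ | a⟩ := x
    · cases e with
      | desc => obtain ⟨-, rfl⟩ := anch_desc_none.1 ha'; cases h1
      | child =>
        obtain ⟨h3, h4⟩ := anch_child_none.1 ha'
        rcases h1.exists_of_skip (ha.mono (by simp)) h4 with ⟨a, h⟩ | ⟨b, m, rfl, h⟩ | ⟨a, rfl, h⟩
        · exact .inr ⟨_, .ins _ a _, .skip _ h⟩
        · exact .inr ⟨_, .run (m + 1) b w, .child (fun h => absurd rfl h) h⟩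
        · exact .inr ⟨_, .lab _ a _, .skip _ h⟩
    · exact .inr ⟨_, .ins _ a _, .desc _ (fun _ => rfl) h1⟩

/-- The elementary specializations of an anchored path query, given by the root label and the part
below the root. -/
inductive RootSpec : Option A × List (Step A) → Option A × List (Step A) → Prop
  | lab (a : A) (w : List (Step A)) : RootSpec (none, w) (some a, w)
  | ext (l : Option A) : RootSpec (l, []) (l, [(.desc, none)])
  | spec (l : Option A) {w w' : List (Step A)} : Spec w w' → RootSpec (l, w) (l, w')

theorem RootSpec.anch {x y : Option A × List (Step A)} (h : RootSpec x y) (ha : Anch true x.2) :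
    Anch true y.2 := by
  cases h with
  | lab => exact ha
  | ext => exact anch_desc_none.2 ⟨rfl, rfl⟩
  | spec l h => exact h.anch ha

theorem RootSpec.weight_lt {x y : Option A × List (Step A)} (h : RootSpec x y) :
    x.1.toList.length + weight x.2 < y.1.toList.length + weight y.2 := by
  cases h with
  | lab => simp
  | ext => simp [weight]
  | spec l h => simpa using h.weight_lt

/-- The path query `x`, given by its root label and the part below the root, is a most specific one
among the anchored path queries that embed in the trees in `S`. -/
structure MinPath (S : List (Twig A)) (x : Option A × List (Step A)) : Prop where
  anch : Anch true x.2
  consistent : ∀ t ∈ S, Match (ofWord x.1 x.2) t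
  minimal : ∀ l w, Anch true w → (∀ t ∈ S, Match (ofWord l w) t) → Matches l x.1 → PE x.2 w →
    l = x.1 ∧ w = x.2

theorem Match.trans {p q r : Twig A} (h : Match p q) (h' : Match q r) : Match p r := by
  rw [← subsumed_iff] at *
  exact h'.trans h

/-- Local minimality is global: a strictly more specific consistent path query would lie beyond some
elementary specialization, which would then be consistent as well. -/
theorem minPath_of_forall_rootSpec {S : List (Twig A)} {x : Option A × List (Step A)}
    (ha : Anch true x.2) (hc : ∀ t ∈ S, Match (ofWord x.1 x.2) t)
    (h : ∀ y, RootSpec x y → ¬ ∀ t ∈ S, Match (ofWord y.1 y.2) t) : MinPath S x := by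
  refine ⟨ha, hc, fun l w hw hS hl hx => ?_⟩
  by_contra hne
  suffices ∃ y, RootSpec x y ∧ Match (ofWord y.1 y.2) (ofWord l w) by
    obtain ⟨y, h1, h2⟩ := this
    exact h y h1 fun t ht => h2.trans (hS t ht)
  obtain ⟨l', w'⟩ := x
  simp only [match_ofWord_ofWord] at *
  by_cases h1 : l = l'
  · subst h1
    by_cases h2 : w' = [] ∧ w ≠ []
    · obtain ⟨rfl, h2⟩ := h2
      refine ⟨_, .ext l, fun _ => rfl, ?_⟩
      obtain ⟨y, w, rfl⟩ := List.exists_cons_of_ne_nil h2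
      exact .desc _ (fun h => absurd rfl h) (.nil _)
    · rcases hx.eq_or_exists_spec ha hw (by tauto) with rfl | ⟨w'', h3, h4⟩
      · exact absurd ⟨rfl, rfl⟩ hne
      · exact ⟨_, .spec l h3, fun _ => rfl, h4⟩
  · have h2 : l' = none := by
      by_contra h3
      exact h1 (hl h3)
    subst h2
    obtain ⟨a, rfl⟩ := Option.ne_none_iff_exists'.1 h1
    exact ⟨_, .lab a w', fun _ => rfl, hx⟩

end Twig

/-! ## Zippers, and the embedding test -/

open Code Twig

/-- The splits of a list into two parts. -/
def splits {α : Type*} : List α → List (List α × List α)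
  | [] => [([], [])]
  | a :: l => ([], a :: l) :: (splits l).map fun s => (a :: s.1, s.2)

theorem mem_splits {α : Type*} {l u v : List α} : (u, v) ∈ splits l ↔ u ++ v = l := by
  induction l generalizing u with
  | nil => simp [splits]
  | cons a l ih =>
    cases u with
    | nil => simp [splits, eq_comm]
    | cons b u => simp [splits, ih, eq_comm, and_comm]

theorem length_splits {α : Type*} (l : List α) : (splits l).length = l.length + 1 := by
  induction l with
  | nil => rfl
  | cons a l ih => simp [splits, ih]

open Polynomial in
@[fun_prop]
theorem PolyTime.splits {A : Type*} [LinearOrder A] [OrderBot A] {α β : Type*} [Code A α] [Code A β]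
    {l : α → List β} (hl : PolyTime A l) :
    PolyTime A (fun x => splits (l x)) := by
  obtain ⟨P, hP⟩ := hl.bound
  -- A right fold does not see the rest of the list. It is recovered from the head of the
  -- accumulator, the split whose first part is empty.
  have h : ∀ l : List β, _root_.splits l = l.foldr (fun a acc =>
      (match acc with | [] => [] | s :: _ => [([], a :: s.2)]) ++
        acc.map fun s => (a :: s.1, s.2)) [([], [])] := by
    intro l
    induction l with
    | nil => rfl
    | cons a l ih =>
      rw [List.foldr_cons, ← ih]
      cases l <;> simp [_root_.splits]
  simp only [h]
  have h1 : PolyTime A fun y : α × List (List β × List β) × β =>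
      (match y.2.1 with | [] => [] | s :: _ => [(([] : List β), y.2.2 :: s.2)]) := by
    convert PolyTime.listCase (A := A) (l := fun y : α × List (List β × List β) × β => y.2.1)
      (f := fun _ => []) (g := fun y s _ => [(([] : List β), y.2.2 :: s.2)])
      (by fun_prop) (by fun_prop) (by fun_prop) using 2 with y
    cases y.2.1 <;> rfl
  have h2 : PolyTime A fun y : α × List (List β × List β) × β =>
      y.2.1.map fun s => (y.2.2 :: s.1, s.2) := map (by fun_prop) (by fun_prop)
  refine foldr hl (cons (pair nil nil) nil) (h1.append h2) (1 + (P + 1) * (2 + 2 * P))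
    fun x l' hl' => ?_
  rw [← h]
  have h1 := csize_sublist (A := A) hl'.sublist
  have h2 := hP x
  refine (csize_le_of_forall (n := 1 + 2 * P.eval (csize A x)) ?_).trans ?_
  · rintro ⟨u, v⟩ hs
    rw [mem_splits] at hs
    have h3 := csize_sublist (A := A) (hs ▸ List.sublist_append_left u v)
    have h4 := csize_sublist (A := A) (hs ▸ List.sublist_append_right u v)
    simp only [csize_prod]
    omega
  · rw [length_splits]
    have h3 := length_lt_csize (A := A) l'
    simp only [eval_add, eval_mul, eval_one, eval_ofNat]
    exact Nat.add_le_add_left (Nat.mul_le_mul (by omega) (by omega)) 1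

namespace Twig

variable {A : Type*}

/-- A frame describes the surroundings of a node: the label of its parent, and the siblings. -/
abbrev Frame (A : Type*) : Type _ := Option A × List (Edge × Twig A) × Edge × List (Edge × Twig A)

/-- A node of a query, given by the frames along the way from the node to the root, the edges and
labels along the way from the root, and the subquery at the node. -/
abbrev Zip (A : Type*) : Type _ := List (Frame A) × List (Step A) × Twig A

/-- The query with given frames around a given subquery. -/
def rebuild (ctx : List (Frame A)) (c : Twig A) : Twig A :=
  ctx.foldl (fun c f => node f.1 (f.2.1 ++ (f.2.2.1, c) :: f.2.2.2)) c

/-- The children of a node. -/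
def zipKids (z : Zip A) : List (Zip A) :=
  (splits z.2.2.kids).flatMap fun s =>
    match s.2 with
    | [] => []
    | k :: r =>
      [((z.2.2.rootLab, s.1, k.1, r) :: z.1, z.2.1 ++ [(k.1, k.2.rootLab)], k.2)]

/-- One step of a breadth first search. -/
def zipStep (s : List (Zip A) × List (Zip A)) : List (Zip A) × List (Zip A) :=
  (s.1 ++ s.2, s.2.flatMap zipKids)

/-- All nodes of a query. -/
def zippers (q : Twig A) : List (Zip A) := (zipStep^[csize A q] ([], [([], [], q)])).1

/-- The subquery at an address replaced by another query. -/
def replaceAt : Twig A → List ℕ → Twig A → Twig A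
  | _, [], c => c
  | node l ks, i :: v, c => node l (ks.modify i fun k => (k.1, replaceAt k.2 v c))

theorem Walk.attach_eq {q c : Twig A} {v : List ℕ} {w : List (Step A)} (h : Walk q v w c)
    (new : List (Edge × Twig A)) : q.attach v new = q.replaceAt v (node c.rootLab (c.kids ++ new)) := by
  induction h with
  | nil q => cases q; rfl
  | @cons q c c' i v w e h1 _ ih =>
    obtain ⟨l, ks⟩ := q
    rw [attach, replaceAt]
    congr 1
    refine List.ext_getElem? fun j => ?_
    rw [List.getElem?_modify, List.getElem?_modify]
    by_cases hij : i = j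
    · subst hij
      have h1 : ks[i]? = some (e, c) := h1
      simp [h1, ih]
    · simp [hij]

theorem Walk.replaceAt_snoc {q m : Twig A} {v : List ℕ} {w : List (Step A)} (h : Walk q v w m)
    {i : ℕ} {L R : List (Edge × Twig A)} {e : Edge} {k : Twig A} (hm : m.kids = L ++ (e, k) :: R)
    (hi : L.length = i) (c : Twig A) :
    q.replaceAt (v ++ [i]) c = q.replaceAt v (node m.rootLab (L ++ (e, c) :: R)) := by
  induction h with
  | nil q =>
    obtain ⟨l, ks⟩ := q
    change ks = _ at hm
    subst hm hi
    rw [List.nil_append, replaceAt, replaceAt, rootLab]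
    congr 1
    refine List.ext_getElem? fun j => ?_
    rw [List.getElem?_modify]
    rcases lt_trichotomy j L.length with hj | rfl | hj
    · simp [List.getElem?_append_left hj, hj.ne']
    · simp [replaceAt]
    · obtain ⟨d, rfl⟩ := Nat.exists_eq_add_of_lt hj
      simp [List.getElem?_append_right, add_assoc]
  | @cons q c c' i v w e h1 _ ih =>
    obtain ⟨l, ks⟩ := q
    rw [List.cons_append, replaceAt, replaceAt]
    congr 1
    refine List.ext_getElem? fun j => ?_
    rw [List.getElem?_modify, List.getElem?_modify]
    by_cases hij : i = j
    · subst hij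
      have h1 : ks[i]? = some (e, c) := h1
      simp [h1, ih hm]
    · simp [hij]

/-- The list element `z` represents the node of `q` with address `v`. -/
def IsZip (q : Twig A) (v : List ℕ) (z : Zip A) : Prop :=
  Walk q v z.2.1 z.2.2 ∧ ∀ c, rebuild z.1 c = q.replaceAt v c

theorem IsZip.attach_eq {q : Twig A} {v : List ℕ} {z : Zip A} (h : IsZip q v z)
    (new : List (Edge × Twig A)) :
    rebuild z.1 (node z.2.2.rootLab (z.2.2.kids ++ new)) = q.attach v new := by
  rw [h.1.attach_eq, h.2]

theorem mem_zipKids {z z' : Zip A} : z' ∈ zipKids z ↔ ∃ L e k R, z.2.2.kids = L ++ (e, k) :: R ∧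
    z' = ((z.2.2.rootLab, L, e, R) :: z.1, z.2.1 ++ [(e, k.rootLab)], k) := by
  rw [zipKids, List.mem_flatMap]
  constructor
  · rintro ⟨⟨L, _ | ⟨⟨e, k⟩, R⟩⟩, h1, h2⟩
    · simp at h2
    · exact ⟨L, e, k, R, (mem_splits.1 h1).symm, by simpa using h2⟩
  · rintro ⟨L, e, k, R, h, rfl⟩
    exact ⟨(L, (e, k) :: R), mem_splits.2 h.symm, by simp⟩

theorem IsZip.kid {q : Twig A} {v : List ℕ} {z z' : Zip A} (h : IsZip q v z)
    (h' : z' ∈ zipKids z) : ∃ i, IsZip q (v ++ [i]) z' := by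
  obtain ⟨L, e, k, R, h1, rfl⟩ := mem_zipKids.1 h'
  refine ⟨L.length, h.1.snoc (by simp [h1]), fun c => ?_⟩
  rw [h.1.replaceAt_snoc h1 rfl, ← h.2]
  rfl

theorem IsZip.exists_kid {q : Twig A} {v : List ℕ} {z : Zip A} (h : IsZip q v z) {i : ℕ} {e : Edge}
    {k : Twig A} (hi : z.2.2.kids[i]? = some (e, k)) : ∃ z' ∈ zipKids z, IsZip q (v ++ [i]) z' := by
  obtain ⟨h1, h2⟩ := List.getElem?_eq_some_iff.1 hi
  have h3 : z.2.2.kids = z.2.2.kids.take i ++ (e, k) :: z.2.2.kids.drop (i + 1) := by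
    rw [← h2, List.getElem_cons_drop, List.take_append_drop]
  refine ⟨_, mem_zipKids.2 ⟨_, e, k, _, h3, rfl⟩, h.1.snoc hi, fun c => ?_⟩
  rw [h.1.replaceAt_snoc h3 (by simp; omega), ← h.2]
  rfl

theorem zipStep_sound {q : Twig A} {n : ℕ} {z : Zip A}
    (h : z ∈ (zipStep^[n] ([], [([], [], q)])).2) : ∃ v, v.length = n ∧ IsZip q v z := by
  induction n generalizing z with
  | zero =>
    simp only [Function.iterate_zero, id, List.mem_singleton] at h
    subst h
    exact ⟨[], rfl, .nil q, fun c => by cases q; rfl⟩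
  | succ n ih =>
    rw [Function.iterate_succ_apply', zipStep, List.mem_flatMap] at h
    obtain ⟨z', h1, h2⟩ := h
    obtain ⟨v, rfl, h3⟩ := ih h1
    obtain ⟨i, h4⟩ := h3.kid h2
    exact ⟨_, by simp, h4⟩

theorem zipStep_complete {q c : Twig A} {v : List ℕ} {w : List (Step A)} (h : Walk q v w c) :
    ∃ z ∈ (zipStep^[v.length] ([], [([], [], q)])).2, IsZip q v z := by
  induction v using List.reverseRecOn generalizing w c with
  | nil => exact ⟨([], [], q), by simp, .nil q, fun c => by cases q; rfl⟩
  | append_singleton v i ih =>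
    obtain ⟨e, m, w', h1, h2, rfl⟩ := walk_snoc.1 h
    obtain ⟨z, h3, h4⟩ := ih h2
    obtain ⟨-, rfl⟩ := h4.1.unique h2
    obtain ⟨z', h5, h6⟩ := h4.exists_kid h1
    refine ⟨z', ?_, h6⟩
    rw [List.length_append, List.length_singleton, Function.iterate_succ_apply', zipStep,
      List.mem_flatMap]
    exact ⟨z, h3, h5⟩

theorem mem_zipStep_fst {q : Twig A} {n : ℕ} {z : Zip A} :
    z ∈ (zipStep^[n] ([], [([], [], q)])).1 ↔ ∃ m < n, z ∈ (zipStep^[m] ([], [([], [], q)])).2 := by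
  induction n with
  | zero => simp
  | succ n ih =>
    rw [Function.iterate_succ_apply', zipStep, List.mem_append, ih]
    simp only [Nat.lt_succ_iff_lt_or_eq]
    constructor
    · rintro (⟨m, h1, h2⟩ | h)
      · exact ⟨m, .inl h1, h2⟩
      · exact ⟨n, .inr rfl, h⟩
    · rintro ⟨m, h1 | rfl, h2⟩
      · exact .inl ⟨m, h1, h2⟩
      · exact .inr h2

theorem three_mul_size_le (q : Twig A) : 3 * q.size ≤ csize A q := by
  induction q using ind with
  | h l ks ih =>
    rw [csize_node, size_eq, csize_eq_sum, mul_add]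
    suffices h : 3 * (ks.map fun k => k.2.size).sum ≤ (ks.map fun k => 1 + csize A k).sum by omega
    induction ks with
    | nil => simp
    | cons k ks ih2 =>
      have h1 := ih2 fun k hk => ih k (by simp [hk])
      have h2 := ih k (by simp)
      have h3 := csize_prod (A := A) k
      have h4 := one_le_csize (A := A) k.1
      simp only [List.map_cons, List.sum_cons]
      omega

theorem mem_zippers {q : Twig A} {z : Zip A} (h : z ∈ zippers q) : ∃ v, IsZip q v z := by
  obtain ⟨m, -, h⟩ := mem_zipStep_fst.1 h
  obtain ⟨v, -, h⟩ := zipStep_sound h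
  exact ⟨v, h⟩

theorem Walk.exists_zippers {q c : Twig A} {v : List ℕ} {w : List (Step A)} (h : Walk q v w c) :
    ∃ z ∈ zippers q, IsZip q v z ∧ z.2 = (w, c) := by
  obtain ⟨z, h1, h2⟩ := zipStep_complete h
  have h3 := h.length_add_size_le
  have h4 := three_mul_size_le q
  have h5 := c.one_le_size
  refine ⟨z, mem_zipStep_fst.2 ⟨_, by omega, h1⟩, h2, ?_⟩
  obtain ⟨rfl, rfl⟩ := h2.1.unique h
  rfl

/-! ### The complexity of the search -/

theorem csize_kids (q : Twig A) : csize A q = 2 + csize A q.kids := by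
  cases q; exact csize_node _ _

theorem csize_zipKids {z z' : Zip A} (h : z' ∈ zipKids z) : csize A z' ≤ csize A z + 20 := by
  obtain ⟨L, e, k, R, h0, rfl⟩ := mem_zipKids.1 h
  have h1 := csize_append (A := A) L ((e, k) :: R)
  have h2 := csize_append (A := A) z.2.1 [(e, k.rootLab)]
  have h3 := csize_kids z.2.2
  have h4 := csize_edge_le (A := A) e
  rw [h0] at h3
  simp only [csize_prod, csize_cons, csize_lab, csize_nil] at h1 h2 ⊢
  omega

theorem csize_zipStep {q : Twig A} {n : ℕ} {z : Zip A}
    (h : z ∈ (zipStep^[n] ([], [([], [], q)])).2) : csize A z ≤ csize A q + 20 * n + 4 := by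
  induction n generalizing z with
  | zero =>
    simp only [Function.iterate_zero, id, List.mem_singleton] at h
    subst h
    simp
    omega
  | succ n ih =>
    rw [Function.iterate_succ_apply', zipStep, List.mem_flatMap] at h
    obtain ⟨z', h1, h2⟩ := h
    have := ih h1
    have := csize_zipKids h2
    omega

/-- The total size of the subqueries does not grow from one level of the search to the next, and so
no level has more nodes than the query. -/
theorem sum_size_zipKids (z : Zip A) :
    ((zipKids z).map fun z => z.2.2.size).sum + 1 ≤ z.2.2.size := by
  obtain ⟨ctx, w, ⟨l, ks⟩⟩ := z
  rw [size_eq]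
  have h : ∀ (L : List (Edge × Twig A)) (u : List (Edge × Twig A)),
      (((splits u).flatMap fun s => (match s.2 with
        | [] => []
        | k :: r => [((l, L ++ s.1, k.1, r) :: ctx, w ++ [(k.1, k.2.rootLab)], k.2)] :
          List (Zip A))).map fun z => z.2.2.size).sum = (u.map fun k => k.2.size).sum := by
    intro L u
    induction u generalizing L with
    | nil => simp [splits]
    | cons k u ih =>
      have := ih (L ++ [k])
      simp only [List.append_assoc, List.singleton_append] at this
      simp [splits, List.flatMap_map, ← this]
  have := h [] ks
  simp only [List.nil_append] at this
  change (((splits ks).flatMap _).map _).sum + 1 ≤ _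
  simp only [rootLab] at this ⊢
  rw [← this]
  omega

theorem length_zipStep (q : Twig A) (n : ℕ) :
    (zipStep^[n] ([], [([], [], q)])).2.length ≤ q.size ∧
      (zipStep^[n] ([], [([], [], q)])).1.length ≤ n * q.size := by
  have h : ∀ n, ((zipStep^[n] ([], [([], [], q)])).2.map fun z => z.2.2.size).sum ≤ q.size := by
    intro n
    induction n with
    | zero => simp
    | succ n ih =>
      rw [Function.iterate_succ_apply', zipStep]
      refine le_trans ?_ ih
      generalize (zipStep^[n] ([], [([], [], q)])).2 = l
      induction l with
      | nil => simp
      | cons z l ih =>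
        have := sum_size_zipKids z
        simp only [List.flatMap_cons, List.map_append, List.sum_append, List.map_cons,
          List.sum_cons] at ih ⊢
        omega
  have h' : ∀ n, (zipStep^[n] ([], [([], [], q)])).2.length ≤ q.size := by
    intro n
    refine le_trans ?_ (h n)
    generalize (zipStep^[n] ([], [([], [], q)])).2 = l
    induction l with
    | nil => simp
    | cons z l ih =>
      have := z.2.2.one_le_size
      simp only [List.length_cons, List.map_cons, List.sum_cons]
      omega
  refine ⟨h' n, ?_⟩
  induction n with
  | zero => simp
  | succ n ih =>
    rw [Function.iterate_succ_apply', zipStep, List.length_append, add_mul]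
    have := h' n
    omega

end Twig

-- The node search in polynomial time.

namespace PolyTime

variable {A : Type*} [LinearOrder A] [OrderBot A] {α β γ δ σ : Type*}
  [Code A α] [Code A β] [Code A γ] [Code A δ] [Code A σ]

open Polynomial

@[fun_prop]
theorem rootLab {q : α → Twig A} (hq : PolyTime A q) : PolyTime A fun x => (q x).rootLab :=
  (of_op .fst (f := fun q : Twig A => q.rootLab) fun q => by cases q; rw [code_node]; rfl).comp hq

@[fun_prop]
theorem kids {q : α → Twig A} (hq : PolyTime A q) : PolyTime A fun x => (q x).kids :=
  (of_op .snd (f := fun q : Twig A => q.kids) fun q => by cases q; rw [code_node]; rfl).comp hq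

@[fun_prop]
theorem node {l : α → Option A} {k : α → List (Edge × Twig A)} (hl : PolyTime A l)
    (hk : PolyTime A k) : PolyTime A fun x => Twig.node (l x) (k x) :=
  of_code_eq (pair hl hk) _root_.id (fun _ => rfl) fun _ => code_node _ _

theorem zipKids : PolyTime A (zipKids (A := A)) := by
  refine flatMap (by fun_prop) ?_
  convert listCase (A := A) (l := fun y : Zip A × List (Edge × Twig A) × List (Edge × Twig A) => y.2.2)
    (f := fun _ => []) (g := fun y k r => [((y.1.2.2.rootLab, y.2.1, k.1, r) :: y.1.1,
      y.1.2.1 ++ [(k.1, k.2.rootLab)], k.2)]) (by fun_prop) (by fun_prop) (by fun_prop) using 2 with y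
  cases y.2.2 <;> rfl

@[fun_prop]
theorem zippers {q : α → Twig A} (hq : PolyTime A q) : PolyTime A fun x => zippers (q x) := by
  suffices h : PolyTime A (Twig.zippers (A := A)) from h.comp hq
  have := iterate (l := fun q : Twig A => List.replicate (csize A q) ()) (f := fun _ => zipStep)
    (i := fun q => ([], [([], [], q)])) (fuel id) (by fun_prop)
    (pair (by fun_prop) (flatMap (f := fun _ => Twig.zipKids) (by fun_prop) (zipKids.comp (by fun_prop))))
    -- After `n ≤ X` steps an entry has size at most `X + 20 * n + 4`, hence at most `21 * X + 4`.
    -- The current level has at most `X` entries, and the levels already visited have at most `X *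
    -- X` altogether.
    (3 + (X + X * X) * (1 + (21 * X + 4))) fun q n hn => ?_
  · convert this.fst using 2 with q
    simp [Twig.zippers]
  · rw [List.length_replicate] at hn
    obtain ⟨h1, h2⟩ := length_zipStep q n
    have h3 := three_mul_size_le q
    have h4 : csize A (zipStep^[n] ([], [([], [], q)])).2 ≤ 1 + csize A q * (1 + (21 * csize A q + 4)) := by
      refine (csize_le_of_forall (n := 21 * csize A q + 4) fun z hz => ?_).trans ?_
      · have := csize_zipStep hz
        omega
      · gcongr
        omega
    have h5 : csize A (zipStep^[n] ([], [([], [], q)])).1 ≤ 1 + csize A q * csize A q * (1 + (21 * csize A q + 4)) := by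
      refine (csize_le_of_forall (n := 21 * csize A q + 4) fun z hz => ?_).trans ?_
      · obtain ⟨m, hm, hz⟩ := mem_zipStep_fst.1 hz
        have := csize_zipStep hz
        omega
      · gcongr
        refine h2.trans (Nat.mul_le_mul hn (by omega))
    simp only [csize_prod, eval_add, eval_mul, eval_ofNat, eval_X, eval_one, add_mul _ (csize A q * csize A q)]
    omega

end PolyTime

/-! ## Embedding tests -/

open Code Twig

/-- The test for descendant edges. -/
def Edge.isDesc : Edge → Bool
  | .child => false
  | .desc => true

namespace Twig

variable {A : Type*}

/-- The subqueries of a query. -/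
def subs (q : Twig A) : List (Twig A) := (zippers q).map fun z => z.2.2

theorem mem_subs {q c : Twig A} : c ∈ subs q ↔ ∃ v w, Walk q v w c := by
  simp only [subs, List.mem_map]
  constructor
  · rintro ⟨z, hz, rfl⟩
    obtain ⟨v, hv⟩ := mem_zippers hz
    exact ⟨v, _, hv.1⟩
  · rintro ⟨v, w, h⟩
    obtain ⟨z, hz, -, h2⟩ := h.exists_zippers
    exact ⟨z, hz, by rw [h2]⟩

/-- The subqueries which can be the image of the end of an edge whose start is mapped to the root. -/
def reaches (e : Edge) (q : Twig A) : List (Twig A) :=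
  bif e.isDesc then ((zippers q).filter fun z => !z.2.1.isEmpty).map fun z => z.2.2
  else (q.kids.filter fun k => !k.1.isDesc).map fun k => k.2

theorem mem_reaches {e : Edge} {q c : Twig A} : c ∈ reaches e q ↔ Reach e q c := by
  cases e with
  | child =>
    simp only [reaches, Reach, Edge.isDesc, cond_false, List.mem_map, List.mem_filter]
    constructor
    · rintro ⟨⟨e, k⟩, ⟨h1, h2⟩, rfl⟩
      cases e
      · exact h1
      · simp at h2
    · exact fun h => ⟨_, ⟨h, rfl⟩, rfl⟩
  | desc =>
    simp only [reaches, Reach, Edge.isDesc, cond_true, List.mem_map, List.mem_filter]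
    constructor
    · rintro ⟨z, ⟨hz, h2⟩, rfl⟩
      obtain ⟨v, hv⟩ := mem_zippers hz
      refine ⟨v, _, ?_, hv.1⟩
      rintro rfl
      simp [(walk_nil.1 hv.1).1] at h2
    · rintro ⟨v, w, hv, h⟩
      obtain ⟨z, hz, -, h2⟩ := h.exists_zippers
      refine ⟨z, ⟨hz, ?_⟩, by rw [h2]⟩
      have h3 := h.length_eq
      rw [h2]
      cases w
      · simp [hv] at h3
      · rfl

/-- The words of the root-to-leaf paths. -/
def pathWords (q : Twig A) : List (List (Step A)) :=
  ((zippers q).filter fun z => z.2.2.kids.isEmpty).map fun z => z.2.1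

theorem mem_pathWords {q : Twig A} {w : List (Step A)} : w ∈ pathWords q ↔ ∃ v, LeafW q v w := by
  simp only [pathWords, List.mem_map, List.mem_filter, List.isEmpty_iff]
  constructor
  · rintro ⟨z, ⟨hz, h⟩, rfl⟩
    obtain ⟨v, hv⟩ := mem_zippers hz
    exact ⟨v, _, hv.1, h⟩
  · rintro ⟨v, c, h, hc⟩
    obtain ⟨z, hz, -, h2⟩ := h.exists_zippers
    exact ⟨z, ⟨hz, by rw [h2]; exact hc⟩, by rw [h2]⟩

open Classical in
/-- The local condition for an embedding, given the known embeddings of subqueries. -/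
noncomputable def embCond (R : List (Twig A × Twig A)) (x : Twig A × Twig A) : Bool :=
  (!x.1.rootLab.isSome || decide (x.2.rootLab = x.1.rootLab)) &&
    x.1.kids.all fun k => (reaches k.1 x.2).any fun c => decide ((k.2, c) ∈ R)

theorem embCond_eq_true {R : List (Twig A × Twig A)} {x : Twig A × Twig A} :
    embCond R x = true ↔ Matches x.2.rootLab x.1.rootLab ∧
      ∀ e c, (e, c) ∈ x.1.kids → ∃ c', Reach e x.2 c' ∧ (c, c') ∈ R := by
  rw [embCond, Bool.and_eq_true]
  refine and_congr ?_ ?_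
  · cases h : x.1.rootLab <;> simp [Matches]
  · simp [mem_reaches]

/-- The pairs of subqueries. -/
def subPairs (x : Twig A × Twig A) : List (Twig A × Twig A) :=
  (subs x.1).flatMap fun c => (subs x.2).map fun c' => (c, c')

theorem mem_subPairs {x y : Twig A × Twig A} :
    y ∈ subPairs x ↔ y.1 ∈ subs x.1 ∧ y.2 ∈ subs x.2 := by
  obtain ⟨c, c'⟩ := y
  simp only [subPairs, List.mem_flatMap, List.mem_map, Prod.mk.injEq]
  constructor
  · rintro ⟨_, h, _, h', rfl, rfl⟩
    exact ⟨h, h'⟩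
  · rintro ⟨h, h'⟩
    exact ⟨_, h, _, h', rfl, rfl⟩

/-- One step of the computation of the embeddings between subqueries. -/
noncomputable def embStep (x : Twig A × Twig A) (R : List (Twig A × Twig A)) :
    List (Twig A × Twig A) :=
  (subPairs x).filter (embCond R)

/-- The test for an embedding of `p` in `q`. -/
noncomputable def emb (p q : Twig A) : Bool :=
  @decide ((p, q) ∈ (embStep (p, q))^[csize A p] []) (Classical.propDecidable _)

/-- Dynamic programming: after `n` rounds the list contains only correct pairs, and all the correct
pairs whose first component has at most `n` nodes. -/
theorem emb_eq_true {p q : Twig A} : emb p q = true ↔ Match p q := by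
  rw [emb, @decide_eq_true_iff _ (Classical.propDecidable _)]
  constructor
  · generalize csize A p = n
    suffices h : ∀ x ∈ (embStep (p, q))^[n] [], Match x.1 x.2 from fun h' => h _ h'
    induction n with
    | zero => simp
    | succ n ih =>
      intro x hx
      rw [Function.iterate_succ_apply', embStep, List.mem_filter, embCond_eq_true] at hx
      refine match_iff.2 ⟨hx.2.1, fun e c hc => ?_⟩
      obtain ⟨c', h1, h2⟩ := hx.2.2 e c hc
      exact ⟨c', h1, ih _ h2⟩
  · have h : ∀ n c c', c.size ≤ n → c ∈ subs p → c' ∈ subs q → Match c c' →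
        (c, c') ∈ (embStep (p, q))^[n] [] := by
      intro n
      induction n with
      | zero =>
        intro c _ hc
        have := c.one_le_size
        omega
      | succ n ih =>
        intro c c' hn hc hc' h
        rw [Function.iterate_succ_apply', embStep, List.mem_filter, mem_subPairs, embCond_eq_true]
        rw [match_iff] at h
        refine ⟨⟨hc, hc'⟩, h.1, fun e k hk => ?_⟩
        obtain ⟨k', h1, h2⟩ := h.2 e k hk
        refine ⟨k', h1, ih k k' ?_ ?_ ?_ h2⟩
        · obtain ⟨i, hi⟩ := List.getElem?_of_mem hk
          have := (Walk.single hi).length_add_size_le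
          simp only [List.length_singleton] at this
          omega
        · obtain ⟨v, w, hw⟩ := mem_subs.1 hc
          obtain ⟨i, hi⟩ := List.getElem?_of_mem hk
          exact mem_subs.2 ⟨_, _, hw.snoc hi⟩
        · obtain ⟨v, w, hw⟩ := mem_subs.1 hc'
          obtain ⟨v', w', -, hw', -⟩ := reach_iff.1 h1
          exact mem_subs.2 ⟨_, _, hw.append hw'⟩
    refine h _ p q ?_ (mem_subs.2 ⟨_, _, .nil p⟩) (mem_subs.2 ⟨_, _, .nil q⟩)
    have := three_mul_size_le p
    omega

theorem csize_tail (w : List (Step A)) : csize A (Twig.tail w) ≤ 1 + 8 * w.length := by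
  induction w with
  | nil => simp [Twig.tail]
  | cons x w ih =>
    obtain ⟨e, l⟩ := x
    have := csize_edge_le (A := A) e
    simp only [Twig.tail, csize_cons, csize_nil, csize_prod, csize_node, List.length_cons]
    omega

end Twig

-- The embedding test in polynomial time.

namespace PolyTime

variable {A : Type*} [LinearOrder A] [OrderBot A] {α β γ δ σ : Type*}
  [Code A α] [Code A β] [Code A γ] [Code A δ] [Code A σ]

open Polynomial

@[fun_prop]
theorem edgeIsDesc {f : α → Edge} (hf : PolyTime A f) : PolyTime A fun x => (f x).isDesc := by
  convert isDesc hf using 2 with x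
  cases f x <;> rfl

@[fun_prop]
theorem subs {q : α → Twig A} (hq : PolyTime A q) : PolyTime A fun x => subs (q x) :=
  map (f := fun _ (z : Zip A) => z.2.2) (by fun_prop) (by fun_prop)

@[fun_prop]
theorem reaches {e : α → Edge} {q : α → Twig A} (he : PolyTime A e) (hq : PolyTime A q) :
    PolyTime A fun x => reaches (e x) (q x) :=
  cond (by fun_prop)
    (map (f := fun _ (z : Zip A) => z.2.2) (filter (p := fun _ (z : Zip A) => !z.2.1.isEmpty) (by fun_prop)
      (by fun_prop)) (by fun_prop))
    (map (f := fun _ (k : Edge × Twig A) => k.2) (filter (p := fun _ (k : Edge × Twig A) => !k.1.isDesc) (by fun_prop) (by fun_prop))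
      (by fun_prop))

@[fun_prop]
theorem pathWords {q : α → Twig A} (hq : PolyTime A q) : PolyTime A fun x => pathWords (q x) :=
  map (f := fun _ (z : Zip A) => z.2.1) (filter (p := fun _ (z : Zip A) => z.2.2.kids.isEmpty) (by fun_prop)
    (by fun_prop)) (by fun_prop)

@[fun_prop]
theorem embCond {R : α → List (Twig A × Twig A)} {f : α → Twig A × Twig A} (hR : PolyTime A R)
    (hf : PolyTime A f) : PolyTime A fun x => embCond (R x) (f x) := by
  classical
  refine and (by fun_prop) (all (p := fun x (k : Edge × Twig A) => (Twig.reaches k.1 (f x).2).any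
    fun c => decide ((k.2, c) ∈ R x)) (by fun_prop) (any (p := fun (y : α × Edge × Twig A) (c : Twig A) =>
      decide ((y.2.2, c) ∈ R y.1)) (by fun_prop) ?_))
  convert mem (A := A) (f := fun y : (α × Edge × Twig A) × Twig A => (y.1.2.2, y.2)) (l := fun y => R y.1.1)
    (by fun_prop) (by fun_prop)

@[fun_prop]
theorem subPairs {f : α → Twig A × Twig A} (hf : PolyTime A f) :
    PolyTime A fun x => subPairs (f x) :=
  flatMap_map (m := fun x _ => Twig.subs (f x).2) (f := fun _ c c' => (c, c')) (by fun_prop)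
    (by fun_prop) (by fun_prop)

@[fun_prop]
theorem emb {p q : α → Twig A} (hp : PolyTime A p) (hq : PolyTime A q) :
    PolyTime A fun x => emb (p x) (q x) := by
  classical
  suffices h : PolyTime A fun x : Twig A × Twig A => Twig.emb x.1 x.2 from h.comp (pair hp hq)
  obtain ⟨B, hB⟩ := (subPairs (A := A) (f := fun x => x) id).bound
  have := iterate (l := fun x : Twig A × Twig A => List.replicate (csize A x.1) ())
    (i := fun _ => []) (f := Twig.embStep) (fuel (by fun_prop)) (by fun_prop)
    (filter (l := fun y : (Twig A × Twig A) × List (Twig A × Twig A) => Twig.subPairs y.1)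
      (p := fun y z => Twig.embCond y.2 z) (by fun_prop) (by fun_prop)) (B + 1) fun x n _ => ?_
  · convert mem (f := fun x : Twig A × Twig A => x) id this using 2 with x
    rw [List.length_replicate, Twig.emb, decide_eq_decide]
  · cases n with
    | zero => simp
    | succ n =>
      rw [Function.iterate_succ_apply', embStep, eval_add, eval_one]
      exact ((csize_sublist List.filter_sublist).trans (hB x)).trans (by omega)

@[fun_prop]
theorem ofWord {l : α → Option A} {w : α → List (Step A)} (hl : PolyTime A l) (hw : PolyTime A w) :
    PolyTime A fun x => ofWord (l x) (w x) := by
  obtain ⟨P, hP⟩ := hw.bound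
  have h : ∀ w : List (Step A), Twig.tail w = w.foldr (fun s acc => [(s.1, .node s.2 acc)]) [] := by
    intro w
    induction w with
    | nil => rfl
    | cons x w ih => rw [List.foldr_cons, ← ih]; rfl
  refine node hl ?_
  simp only [h]
  refine foldr (f := fun _ s acc => [(s.1, Twig.node s.2 acc)]) hw nil (by fun_prop) (1 + 8 * P)
    fun x u hu => ?_
  rw [← h]
  have h1 := csize_tail u
  have h2 := length_lt_csize (A := A) (w x)
  have h3 := hP x
  have h4 := hu.length_le
  simp
  omega

end PolyTime

/-! ## The inference of minimal anchored path queries -/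

open Code Twig

namespace Twig

variable {A : Type*}

theorem Spec.append {w w' : List (Step A)} (h : Spec w w') (u : List (Step A)) :
    Spec (u ++ w) (u ++ w') := by
  induction u with
  | nil => exact h
  | cons x u ih => exact .cons x ih

theorem PE.cons {e : Edge} {l l' : Option A} {w w' : List (Step A)} (h : Matches l' l)
    (h' : PE w w') : PE ((e, l) :: w) ((e, l') :: w') := by
  cases e
  · exact .child h h'
  · exact .desc _ h h'

theorem Spec.pe {w w' : List (Step A)} (h : Spec w w') : PE w w' := by
  induction h with
  | lab e a w => exact .cons (fun h => (h rfl).elim) (.refl w)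
  | ext e a => exact .cons (fun _ => rfl) (.nil _)
  | ins l a w => exact .skip _ (.refl _)
  | run m b w => exact .skips (.desc _ (fun _ => rfl) (.refl w)) _
  | cons x _ ih => exact .cons (fun _ => rfl) ih

theorem RootSpec.refines {x y : Option A × List (Step A)} (h : RootSpec x y) :
    Matches y.1 x.1 ∧ PE x.2 y.2 := by
  cases h with
  | lab a w => exact ⟨fun h => (h rfl).elim, .refl w⟩
  | ext l => exact ⟨fun _ => rfl, .nil _⟩
  | spec l h => exact ⟨fun _ => rfl, h.pe⟩

theorem PE.exists_mem {w w' : List (Step A)} (h : PE w w') {e : Edge} {a : A}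
    (he : (e, some a) ∈ w) : ∃ e', (e', some a) ∈ w' := by
  induction h with
  | nil => simp at he
  | @child l l' w w' hm _ ih =>
    rcases List.mem_cons.1 he with h | h
    · cases h
      exact ⟨_, by rw [hm (by simp)]; exact List.mem_cons_self⟩
    · obtain ⟨e', h'⟩ := ih h
      exact ⟨e', List.mem_cons_of_mem _ h'⟩
  | @desc l l' w w' e1 hm _ ih =>
    rcases List.mem_cons.1 he with h | h
    · cases h
      exact ⟨_, by rw [hm (by simp)]; exact List.mem_cons_self⟩
    · obtain ⟨e', h'⟩ := ih h
      exact ⟨e', List.mem_cons_of_mem _ h'⟩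
  | skip x _ ih =>
    obtain ⟨e', h'⟩ := ih he
    exact ⟨e', List.mem_cons_of_mem _ h'⟩

theorem Walk.exists_of_mem {q c : Twig A} {v : List ℕ} {w : List (Step A)} (h : Walk q v w c)
    {x : Step A} (hx : x ∈ w) : ∃ v' w' c', Walk q v' w' c' ∧ c'.rootLab = x.2 := by
  induction h with
  | nil => simp at hx
  | cons h1 h2 ih =>
    rcases List.mem_cons.1 hx with rfl | hx
    · exact ⟨_, _, _, .single h1, rfl⟩
    · obtain ⟨v', w', c', h3, h4⟩ := ih hx
      exact ⟨_, _, _, .cons h1 h3, h4⟩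

/-- The specializations of the word `u ++ x :: r` at `x`, with labels from `Ls` and runs of wildcards
from `Ms`. -/
def specsAt (Ls : List (Option A)) (Ms : List (List (Step A))) (u : List (Step A)) (x : Step A)
    (r : List (Step A)) : List (List (Step A)) :=
  (bif x.2.isSome then [] else Ls.map fun a => u ++ (x.1, a) :: r) ++
  ((bif x.2.isSome && r.isEmpty then [u ++ [x, (.desc, none)]] else []) ++
  ((bif x.1.isDesc then Ls.map fun a => u ++ (.desc, a) :: x :: r else []) ++
  (bif x.1.isDesc && x.2.isSome then Ms.map fun m => u ++ (m ++ (.child, x.2) :: r) else [])))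

/-- The specializations of a word, with labels from `Ls` and runs of wildcards from `Ms`. -/
def specs (Ls : List (Option A)) (Ms : List (List (Step A))) (w : List (Step A)) :
    List (List (Step A)) :=
  (splits w).flatMap fun s => (s.2.take 1).flatMap fun x => specsAt Ls Ms s.1 x s.2.tail

theorem mem_specsAt {Ls : List (Option A)} {Ms : List (List (Step A))} {u r w : List (Step A)}
    {e : Edge} {l : Option A} : w ∈ specsAt Ls Ms u (e, l) r ↔ ∃ r', w = u ++ r' ∧
      (l = none ∧ (∃ a ∈ Ls, r' = (e, a) :: r) ∨ l ≠ none ∧ r = [] ∧ r' = [(e, l), (.desc, none)] ∨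
      e = .desc ∧ (∃ a ∈ Ls, r' = (.desc, a) :: (.desc, l) :: r) ∨
      e = .desc ∧ l ≠ none ∧ ∃ m ∈ Ms, r' = m ++ (.child, l) :: r) := by
  cases e <;> cases l <;> cases r <;> simp [specsAt, Edge.isDesc] <;> aesop

theorem mem_specs {Ls : List (Option A)} {Ms : List (List (Step A))} {w w' : List (Step A)} :
    w' ∈ specs Ls Ms w ↔ ∃ u e l r r', w = u ++ (e, l) :: r ∧ w' = u ++ r' ∧
      (l = none ∧ (∃ a ∈ Ls, r' = (e, a) :: r) ∨ l ≠ none ∧ r = [] ∧ r' = [(e, l), (.desc, none)] ∨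
      e = .desc ∧ (∃ a ∈ Ls, r' = (.desc, a) :: (.desc, l) :: r) ∨
      e = .desc ∧ l ≠ none ∧ ∃ m ∈ Ms, r' = m ++ (.child, l) :: r) := by
  simp only [specs, List.mem_flatMap]
  constructor
  · rintro ⟨⟨u, r⟩, h1, x, h2, h3⟩
    cases r with
    | nil => simp at h2
    | cons y r =>
      obtain rfl : x = y := by simpa using h2
      obtain ⟨r', h4⟩ := mem_specsAt.1 h3
      exact ⟨u, x.1, x.2, r, r', (mem_splits.1 h1).symm, h4⟩
  · rintro ⟨u, e, l, r, r', rfl, h⟩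
    exact ⟨(u, (e, l) :: r), mem_splits.2 rfl, (e, l), by simp, mem_specsAt.2 ⟨r', h⟩⟩

theorem spec_of_mem_specs {Ls : List (Option A)} {Ms : List (List (Step A))} {w w' : List (Step A)}
    (hL : ∀ a ∈ Ls, a ≠ none) (hM : ∀ m ∈ Ms, ∃ n, m = List.replicate n (.child, none))
    (h : w' ∈ specs Ls Ms w) : Spec w w' := by
  obtain ⟨u, e, l, r, r', rfl, rfl, h'⟩ := mem_specs.1 h
  refine Spec.append ?_ u
  rcases h' with ⟨rfl, a, ha, rfl⟩ | ⟨hl, rfl, rfl⟩ | ⟨rfl, a, ha, rfl⟩ | ⟨rfl, hl, m, hm, rfl⟩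
  · obtain ⟨a, rfl⟩ := Option.ne_none_iff_exists'.1 (hL a ha)
    exact .lab e a r
  · obtain ⟨a, rfl⟩ := Option.ne_none_iff_exists'.1 hl
    exact .ext e a
  · obtain ⟨a, rfl⟩ := Option.ne_none_iff_exists'.1 (hL a ha)
    exact .ins l a r
  · obtain ⟨a, rfl⟩ := Option.ne_none_iff_exists'.1 hl
    obtain ⟨n, rfl⟩ := hM m hm
    exact .run n a r

theorem Spec.mem_specs {Ls : List (Option A)} {Ms : List (List (Step A))} {w w' : List (Step A)}
    (h : Spec w w') (hL : ∀ e a, (e, some a) ∈ w' → some a ∈ Ls)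
    (hM : ∀ n ≤ w'.length, List.replicate n (.child, none) ∈ Ms) : w' ∈ specs Ls Ms w := by
  rw [Twig.mem_specs]
  induction h with
  | lab e a w =>
    exact ⟨[], e, none, w, _, rfl, rfl, .inl ⟨rfl, some a, hL e a (by simp), rfl⟩⟩
  | ext e a => exact ⟨[], e, some a, [], _, rfl, rfl, .inr (.inl ⟨by simp, rfl, rfl⟩)⟩
  | ins l a w =>
    exact ⟨[], .desc, l, w, _, rfl, rfl, .inr (.inr (.inl ⟨rfl, some a, hL .desc a (by simp), rfl⟩))⟩
  | run m b w =>
    exact ⟨[], .desc, some b, w, _, rfl, rfl, .inr (.inr (.inr ⟨rfl, by simp, _,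
      hM m (by simp), rfl⟩))⟩
  | cons x _ ih =>
    obtain ⟨u, e, l, r, r', rfl, rfl, h⟩ := ih (fun e a h => hL e a (List.mem_cons_of_mem _ h))
      fun n hn => hM n (hn.trans (by simp))
    exact ⟨x :: u, e, l, r, r', rfl, rfl, h⟩

/-- The labels in a tree. -/
def labels (t : Twig A) : List (Option A) := ((subs t).map rootLab).filter Option.isSome

/-- Some runs of wildcards, at least up to the height of the tree `t`. -/
def runs (t : Twig A) : List (List (Step A)) :=
  (splits ((List.replicate (csize A t) ()).map fun _ => (Edge.child, none))).map Prod.fst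

/-- The specializations of a path query that have a chance of matching `t`. -/
def rootSpecs (t : Twig A) (x : Option A × List (Step A)) : List (Option A × List (Step A)) :=
  (bif x.1.isSome then [] else (labels t).map fun a => (a, x.2)) ++
  ((bif x.2.isEmpty then [(x.1, [(.desc, none)])] else []) ++
  (specs (labels t) (runs t) x.2).map fun w => (x.1, w))

theorem mem_labels {t : Twig A} {l : Option A} :
    l ∈ labels t ↔ l ≠ none ∧ ∃ v w c, Walk t v w c ∧ c.rootLab = l := by
  simp only [labels, List.mem_filter, List.mem_map, mem_subs, ← Option.isSome_iff_ne_none]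
  constructor
  · rintro ⟨⟨c, ⟨v, w, h⟩, rfl⟩, h'⟩
    exact ⟨h', v, w, c, h, rfl⟩
  · rintro ⟨h', v, w, c, h, rfl⟩
    exact ⟨⟨c, ⟨v, w, h⟩, rfl⟩, h'⟩

theorem mem_runs {t : Twig A} {m : List (Step A)} :
    m ∈ runs t ↔ ∃ n ≤ csize A t, m = List.replicate n (.child, none) := by
  simp only [runs, List.map_replicate, List.mem_map, Prod.exists, exists_and_right, exists_eq_right,
    mem_splits]
  constructor
  · rintro ⟨v, h⟩
    rw [List.append_eq_replicate_iff] at h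
    exact ⟨_, by omega, h.2.1⟩
  · rintro ⟨n, hn, rfl⟩
    exact ⟨List.replicate (csize A t - n) _, by rw [List.replicate_append_replicate]; congr 1; omega⟩

theorem rootSpec_of_mem_rootSpecs {t : Twig A} {x y : Option A × List (Step A)}
    (h : y ∈ rootSpecs t x) : RootSpec x y := by
  obtain ⟨l, w⟩ := x
  simp only [rootSpecs, List.mem_append, List.mem_map] at h
  rcases h with h | h | ⟨w', h, rfl⟩
  · cases l with
    | some a => simp at h
    | none =>
      simp only [Option.isSome_none, cond_false, List.mem_map] at h
      obtain ⟨a, h, rfl⟩ := h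
      obtain ⟨a, rfl⟩ := Option.ne_none_iff_exists'.1 (mem_labels.1 h).1
      exact .lab a w
  · cases w with
    | nil =>
      obtain rfl : y = _ := by simpa using h
      exact .ext l
    | cons => simp at h
  · refine .spec l (spec_of_mem_specs (fun a ha => (mem_labels.1 ha).1) (fun m hm => ?_) h)
    obtain ⟨n, -, rfl⟩ := mem_runs.1 hm
    exact ⟨n, rfl⟩

theorem length_lt_of_match {l : Option A} {w : List (Step A)} {t : Twig A}
    (h : Match (ofWord l w) t) : w.length < t.size := by
  obtain ⟨-, v, w', ⟨c, h1, -⟩, h2⟩ := match_ofWord.1 h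
  have h3 := h2.length_le
  have h4 := h1.length_eq
  have h5 := h1.length_add_size_le
  have h6 := c.one_le_size
  omega

/-- There are infinitely many elementary specializations, but the labels of one that embeds in `t`
occur in `t`, and its runs of wildcards are shorter than the size of `t`. So the finite list misses
none that matters. -/
theorem RootSpec.mem_rootSpecs {t : Twig A} {x y : Option A × List (Step A)} (h : RootSpec x y)
    (ht : Match (ofWord y.1 y.2) t) : y ∈ rootSpecs t x := by
  have hlen := length_lt_of_match ht
  have h3 := three_mul_size_le t
  obtain ⟨hroot, v, w', ⟨c, h1, -⟩, h2⟩ := match_ofWord.1 ht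
  simp only [rootSpecs, List.mem_append, List.mem_map]
  cases h with
  | lab a w =>
    refine .inl ?_
    simp only [Option.isSome_none, cond_false, List.mem_map]
    exact ⟨some a, mem_labels.2 ⟨by simp, [], [], t, .nil t, hroot (by simp)⟩, rfl⟩
  | ext l => exact .inr (.inl (by simp))
  | spec l h =>
    refine .inr (.inr ⟨_, h.mem_specs (fun e a ha => ?_) (fun n hn => ?_), rfl⟩)
    · obtain ⟨e', h4⟩ := h2.exists_mem ha
      exact mem_labels.2 ⟨by simp, h1.exists_of_mem h4⟩
    · exact mem_runs.2 ⟨n, by simp only at hlen; omega, rfl⟩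

/-- The test for the consistency of a path query with a list of trees. -/
noncomputable def consistentWith (S : List (Twig A)) (x : Option A × List (Step A)) : Bool :=
  S.all fun t => emb (ofWord x.1 x.2) t

theorem consistentWith_eq_true {S : List (Twig A)} {x : Option A × List (Step A)} :
    consistentWith S x = true ↔ ∀ t ∈ S, Match (ofWord x.1 x.2) t := by
  simp [consistentWith, emb_eq_true]

/-- One step of the greedy specialization of a path query. -/
noncomputable def greedyStep (t : Twig A) (S : List (Twig A)) (x : Option A × List (Step A)) :
    Option A × List (Step A) :=
  match (rootSpecs t x).filter (consistentWith (t :: S)) with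
  | [] => x
  | y :: _ => y

theorem greedyStep_cases (t : Twig A) (S : List (Twig A)) (x : Option A × List (Step A)) :
    (greedyStep t S x = x ∧ ∀ y, RootSpec x y → ¬ ∀ t' ∈ t :: S, Match (ofWord y.1 y.2) t') ∨
    RootSpec x (greedyStep t S x) ∧
      ∀ t' ∈ t :: S, Match (ofWord (greedyStep t S x).1 (greedyStep t S x).2) t' := by
  rw [greedyStep]
  rcases h : (rootSpecs t x).filter (consistentWith (t :: S)) with _ | ⟨y, ys⟩
  · refine .inl ⟨rfl, fun y h1 h2 => ?_⟩
    rw [List.filter_eq_nil_iff] at h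
    exact h y (h1.mem_rootSpecs (h2 t (by simp))) (consistentWith_eq_true.2 h2)
  · have : y ∈ (rootSpecs t x).filter (consistentWith (t :: S)) := by simp [h]
    rw [List.mem_filter, consistentWith_eq_true] at this
    exact .inr ⟨rootSpec_of_mem_rootSpecs this.1, this.2⟩

/-- The greedy specialization of a path query. -/
noncomputable def greedy (t : Twig A) (S : List (Twig A)) (x : Option A × List (Step A)) :
    Option A × List (Step A) :=
  (greedyStep t S)^[csize A t] x

/-- Makes no assumption on `x`, not even consistency, so that it can bound the states of the loop on
arbitrary inputs: a state is the start or embeds in `t`. -/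
theorem iterate_greedyStep (t : Twig A) (S : List (Twig A)) (x : Option A × List (Step A)) (n : ℕ) :
    (greedyStep t S)^[n] x = x ∨
      ∀ t' ∈ t :: S, Match (ofWord ((greedyStep t S)^[n] x).1 ((greedyStep t S)^[n] x).2) t' := by
  induction n with
  | zero => exact .inl rfl
  | succ n ih =>
    rw [Function.iterate_succ_apply']
    rcases greedyStep_cases t S ((greedyStep t S)^[n] x) with h | h
    · rwa [h.1]
    · exact .inr h.2

/-- As long as specialization is possible the weight increases, and consistency with `t` bounds it.
After `csize A t` rounds the search is therefore stuck, which means minimality by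
`minPath_of_forall_rootSpec`. -/
theorem greedy_spec {t : Twig A} {S : List (Twig A)} {x : Option A × List (Step A)}
    (ha : Anch true x.2) (hc : ∀ t' ∈ t :: S, Match (ofWord x.1 x.2) t') :
    MinPath (t :: S) (greedy t S x) ∧ Matches (greedy t S x).1 x.1 ∧ PE x.2 (greedy t S x).2 := by
  have h1 : ∀ n, (∀ t' ∈ t :: S,
      Match (ofWord ((greedyStep t S)^[n] x).1 ((greedyStep t S)^[n] x).2) t') := by
    intro n
    rcases iterate_greedyStep t S x n with h | h
    · rwa [h]
    · exact h
  have h2 : ∀ n, Anch true ((greedyStep t S)^[n] x).2 ∧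
      Match (ofWord x.1 x.2) (ofWord ((greedyStep t S)^[n] x).1 ((greedyStep t S)^[n] x).2) := by
    intro n
    induction n with
    | zero => exact ⟨ha, match_ofWord_ofWord.2 ⟨fun _ => rfl, .refl _⟩⟩
    | succ n ih =>
      rw [Function.iterate_succ_apply']
      rcases greedyStep_cases t S ((greedyStep t S)^[n] x) with h | h
      · rwa [h.1]
      · exact ⟨h.1.anch ih.1, ih.2.trans (match_ofWord_ofWord.2 h.1.refines)⟩
  have h3 : ∀ n, (∀ y, RootSpec ((greedyStep t S)^[n] x) y →
      ¬ ∀ t' ∈ t :: S, Match (ofWord y.1 y.2) t') ∨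
      n ≤ ((greedyStep t S)^[n] x).1.toList.length + weight ((greedyStep t S)^[n] x).2 := by
    intro n
    induction n with
    | zero => exact .inr (Nat.zero_le _)
    | succ n ih =>
      rw [Function.iterate_succ_apply']
      rcases greedyStep_cases t S ((greedyStep t S)^[n] x) with h | h
      · rw [h.1]
        exact .inl h.2
      · rcases ih with ih | ih
        · exact (ih _ h.1 h.2).elim
        · have := h.1.weight_lt
          exact .inr (by omega)
  have h4 := match_ofWord_ofWord.1 (h2 (csize A t)).2
  refine ⟨minPath_of_forall_rootSpec (h2 _).1 (h1 _) ?_, h4.1, h4.2⟩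
  -- The weight is at most three times a length below `t.size`, and the root label adds at most 1;
  -- the sum stays below `3 * t.size ≤ csize A t`.
  refine (h3 (csize A t)).resolve_right fun h => ?_
  have h5 := length_lt_of_match (h1 (csize A t) t (by simp))
  have h6 := three_mul_size_le t
  have h7 := weight_le ((greedyStep t S)^[csize A t] x).2
  have h8 : ((greedyStep t S)^[csize A t] x).1.toList.length ≤ 1 := by
    cases ((greedyStep t S)^[csize A t] x).1 <;> simp
  omega

/-- The path query obtained from the path `w` in the tree `t`. -/
noncomputable def inferOne (S : List (Twig A)) (t : Twig A) (w : List (Step A)) :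
    Option A × List (Step A) :=
  greedy t S (greedy (ofWord t.rootLab w) S (none, []))

/-- The path queries obtained from a sample, with repetitions. -/
noncomputable def inferAll (S : List (Twig A)) : List (Twig A) :=
  S.flatMap fun t => (pathWords t).map fun w =>
    ofWord (inferOne S t w).1 (inferOne S t w).2

open Classical in
/-- The path queries inferred from a sample. -/
noncomputable def infer (S : List (Twig A)) : List (Twig A) := (inferAll S).dedup

theorem csize_step_le (w : List (Step A)) : csize A w ≤ 1 + 6 * w.length := by
  induction w with
  | nil => simp
  | cons x w ih =>
    have := csize_edge_le (A := A) x.1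
    simp only [csize_cons, csize_prod, csize_lab, List.length_cons]
    omega

end Twig

-- The inference in polynomial time.

namespace PolyTime

variable {A : Type*} [LinearOrder A] [OrderBot A] {α β γ δ σ : Type*}
  [Code A α] [Code A β] [Code A γ] [Code A δ] [Code A σ]

open Polynomial

@[fun_prop]
theorem tail {l : α → List β} (hl : PolyTime A l) : PolyTime A fun x => (l x).tail := by
  convert listCase (f := fun _ => []) (g := fun _ _ t => t) hl nil (by fun_prop) using 2 with x
  cases l x <;> rfl

@[fun_prop]
theorem take_one {l : α → List β} (hl : PolyTime A l) : PolyTime A fun x => (l x).take 1 := by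
  convert listCase (f := fun _ => []) (g := fun _ b _ => [b]) hl nil (by fun_prop) using 2 with x
  cases l x <;> rfl

@[fun_prop]
theorem labels {t : α → Twig A} (ht : PolyTime A t) : PolyTime A fun x => labels (t x) :=
  filter (p := fun _ (l : Option A) => l.isSome) (map (f := fun _ (c : Twig A) => c.rootLab) (by fun_prop)
    (by fun_prop)) (by fun_prop)

@[fun_prop]
theorem runs {t : α → Twig A} (ht : PolyTime A t) : PolyTime A fun x => runs (t x) :=
  map (f := fun _ (s : List (Step A) × List (Step A)) => s.1)
    (splits (map (f := fun _ _ => (Edge.child, none)) (fuel ht) (by fun_prop))) (by fun_prop)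

@[fun_prop]
theorem specsAt {Ls : α → List (Option A)} {Ms : α → List (List (Step A))} {u r : α → List (Step A)}
    {f : α → Step A} (hL : PolyTime A Ls) (hM : PolyTime A Ms) (hu : PolyTime A u)
    (hf : PolyTime A f) (hr : PolyTime A r) :
    PolyTime A fun x => specsAt (Ls x) (Ms x) (u x) (f x) (r x) := by
  have h1 : PolyTime A fun x => (Ls x).map fun a => u x ++ ((f x).1, a) :: r x :=
    map hL (by fun_prop)
  have h2 : PolyTime A fun x => (Ls x).map fun a => u x ++ (.desc, a) :: f x :: r x :=
    map hL (by fun_prop)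
  have h3 : PolyTime A fun x => (Ms x).map fun m => u x ++ (m ++ (.child, (f x).2) :: r x) :=
    map hM (by fun_prop)
  exact append (by fun_prop) (append (by fun_prop) (append (by fun_prop) (by fun_prop)))

@[fun_prop]
theorem specs {Ls : α → List (Option A)} {Ms : α → List (List (Step A))} {w : α → List (Step A)}
    (hL : PolyTime A Ls) (hM : PolyTime A Ms) (hw : PolyTime A w) :
    PolyTime A fun x => specs (Ls x) (Ms x) (w x) :=
  flatMap (by fun_prop) (flatMap (l := fun y : α × List (Step A) × List (Step A) => y.2.2.take 1)
    (f := fun y x => Twig.specsAt (Ls y.1) (Ms y.1) y.2.1 x y.2.2.tail) (by fun_prop) (by fun_prop))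

@[fun_prop]
theorem rootSpecs {t : α → Twig A} {f : α → Option A × List (Step A)} (ht : PolyTime A t)
    (hf : PolyTime A f) : PolyTime A fun x => rootSpecs (t x) (f x) :=
  append (cond (by fun_prop) nil (map (f := fun x (a : Option A) => (a, (f x).2)) (by fun_prop)
    (by fun_prop))) (append (by fun_prop)
    (map (f := fun x (w : List (Step A)) => ((f x).1, w)) (by fun_prop) (by fun_prop)))

@[fun_prop]
theorem consistentWith {S : α → List (Twig A)} {f : α → Option A × List (Step A)}
    (hS : PolyTime A S) (hf : PolyTime A f) : PolyTime A fun x => consistentWith (S x) (f x) :=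
  all (by fun_prop) (by fun_prop)

@[fun_prop]
theorem greedyStep {t : α → Twig A} {S : α → List (Twig A)} {f : α → Option A × List (Step A)}
    (ht : PolyTime A t) (hS : PolyTime A S) (hf : PolyTime A f) :
    PolyTime A fun x => greedyStep (t x) (S x) (f x) := by
  convert listCase (l := fun x => (Twig.rootSpecs (t x) (f x)).filter
    (Twig.consistentWith (t x :: S x))) (g := fun _ y _ => y) (filter (by fun_prop) (by fun_prop))
    hf (by fun_prop) using 2 with x
  rw [Twig.greedyStep]
  cases (Twig.rootSpecs (t x) (f x)).filter (Twig.consistentWith (t x :: S x)) <;> rfl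

@[fun_prop]
theorem greedy {t : α → Twig A} {S : α → List (Twig A)} {f : α → Option A × List (Step A)}
    (ht : PolyTime A t) (hS : PolyTime A S) (hf : PolyTime A f) :
    PolyTime A fun x => greedy (t x) (S x) (f x) := by
  obtain ⟨P, hP⟩ := ht.bound
  obtain ⟨Q, hQ⟩ := hf.bound
  have := iterate (f := fun x => Twig.greedyStep (t x) (S x)) (fuel ht) hf (by fun_prop)
    (Q + 6 * P + 3) fun x n _ => ?_
  · simpa [Twig.greedy] using this
  · have h1 := hP x
    have h2 := hQ x
    simp only [eval_add, eval_mul, eval_ofNat]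
    rcases iterate_greedyStep (t x) (S x) (f x) n with h | h
    · rw [h]
      omega
    · have h3 := length_lt_of_match (h _ List.mem_cons_self)
      have h4 := three_mul_size_le (t x)
      have h5 := csize_step_le ((Twig.greedyStep (t x) (S x))^[n] (f x)).2
      simp only [csize_prod, csize_lab]
      omega

theorem inferAll : PolyTime A (inferAll (A := A)) := by
  refine flatMap_map (l := fun S => S) (m := fun _ t => Twig.pathWords t) (f := fun S t w =>
    Twig.ofWord (inferOne S t w).1 (inferOne S t w).2) (by fun_prop) (by fun_prop) ?_
  have : PolyTime A fun y : (List (Twig A) × Twig A) × List (Step A) =>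
      inferOne y.1.1 y.1.2 y.2 := greedy (by fun_prop) (by fun_prop) (by fun_prop)
  exact ofWord this.fst this.snd

theorem dedup [DecidableEq β] {l : α → List β} (hl : PolyTime A l) :
    PolyTime A fun x => (l x).dedup := by
  obtain ⟨P, hP⟩ := hl.bound
  have h : ∀ l : List β, l.dedup = l.foldr (fun b acc => if b ∈ acc then acc else b :: acc) [] := by
    intro l
    induction l with
    | nil => simp
    | cons b l ih =>
      rw [List.foldr_cons, ← ih]
      by_cases hb : b ∈ l
      · rw [List.dedup_cons_of_mem hb, if_pos (List.mem_dedup.2 hb)]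
      · rw [List.dedup_cons_of_notMem hb, if_neg (mt List.mem_dedup.1 hb)]
  simp only [h]
  refine foldr hl nil (ite (by fun_prop) (by fun_prop) (by fun_prop)) P fun x l' hl' => ?_
  rw [← h]
  exact (csize_sublist ((List.dedup_sublist l').trans hl'.sublist)).trans (hP x)

theorem infer : PolyTime A (infer (A := A)) := by
  classical
  convert dedup (inferAll (A := A)) using 2 with x
  rw [Twig.infer]

end PolyTime

/-! ## The fusion of path queries -/

open Code Twig

namespace Twig

variable {A : Type*}

open Classical in
/-- The fusions of `p` into `q` at nodes other than leaves with the same words. -/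
noncomputable def cands (p q : Twig A) : List (Twig A) :=
  (zippers p).flatMap fun z => (bif z.2.2.kids.isEmpty then [] else
    (zippers q).filter fun z' => decide (z.2.1 = z'.2.1) && !z'.2.2.kids.isEmpty).map fun z' =>
      rebuild z'.1 (node z'.2.2.rootLab (z'.2.2.kids ++ z.2.2.kids))

theorem mem_cands {p q r : Twig A} : r ∈ cands p q ↔ ∃ v w c v' c', Walk p v w c ∧
    Walk q v' w c' ∧ c.kids ≠ [] ∧ c'.kids ≠ [] ∧ r = q.attach v' c.kids := by
  simp only [cands, List.mem_flatMap, List.mem_map]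
  constructor
  · rintro ⟨z, hz, z', h, rfl⟩
    obtain ⟨v, hv⟩ := mem_zippers hz
    cases hk : z.2.2.kids with
    | nil => simp [hk] at h
    | cons k ks =>
      simp only [hk, List.isEmpty_cons, cond_false, List.mem_filter, Bool.and_eq_true,
        decide_eq_true_eq, Bool.not_eq_true', List.isEmpty_eq_false_iff] at h
      obtain ⟨v', hv'⟩ := mem_zippers h.1
      rw [← hk]
      refine ⟨v, z.2.1, z.2.2, v', z'.2.2, hv.1, ?_, by simp [hk], h.2.2, hv'.attach_eq _⟩
      rw [h.2.1]
      exact hv'.1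
  · rintro ⟨v, w, c, v', c', h1, h2, hc, hc', rfl⟩
    obtain ⟨z, hz, -, hzw⟩ := h1.exists_zippers
    obtain ⟨z', hz', hz2, hzw'⟩ := h2.exists_zippers
    refine ⟨z, hz, z', ?_, ?_⟩
    · cases hk : c.kids with
      | nil => exact (hc hk).elim
      | cons k ks => simp [hzw, hzw', hk, hz', hc']
    · rw [hz2.attach_eq, hzw]

theorem Walk.csize_attach {q c : Twig A} {v : List ℕ} {w : List (Step A)} (h : Walk q v w c)
    (new : List (Edge × Twig A)) :
    csize A (q.attach v new) + 1 = csize A q + csize A new := by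
  induction h with
  | nil q =>
    obtain ⟨l, ks⟩ := q
    have := csize_append (A := A) ks new
    rw [attach, csize_node, csize_node]
    omega
  | @cons q c c' i v w e h1 _ ih =>
    obtain ⟨l, ks⟩ := q
    change ks[i]? = _ at h1
    rw [attach, csize_node, csize_node]
    suffices h : csize A (ks.modify i fun k => (k.1, attach k.2 v new)) + 1 =
        csize A ks + csize A new by omega
    induction ks generalizing i with
    | nil => simp at h1
    | cons k ks ih2 =>
      cases i with
      | zero =>
        obtain rfl : k = (e, c) := by simpa using h1
        simp only [List.modify_zero_cons, csize_cons, csize_prod]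
        omega
      | succ i =>
        have := ih2 h1
        simp only [List.modify_succ_cons, csize_cons]
        omega

theorem csize_rebuild_le (ctx : List (Frame A)) (c : Twig A) :
    csize A (rebuild ctx c) ≤ csize A c + csize A ctx := by
  induction ctx generalizing c with
  | nil => simp [rebuild]
  | cons f ctx ih =>
    rw [rebuild, List.foldl_cons]
    refine (ih _).trans ?_
    have h1 := csize_append (A := A) f.2.1 ((f.2.2.1, c) :: f.2.2.2)
    simp only [csize_node, csize_cons, csize_prod, csize_lab] at h1 ⊢
    omega

/-- The first element of a list, or a smaller one that occurs later, and so on. -/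
noncomputable def pickMin (q : Twig A) (L : List (Twig A)) : Twig A :=
  match L with
  | [] => q
  | b :: t => t.foldl (fun b x => bif emb b x then x else b) b

theorem foldl_min (b : Twig A) (t : List (Twig A)) :
    t.foldl (fun b x => bif emb b x then x else b) b ∈ b :: t ∧
    Match b (t.foldl (fun b x => bif emb b x then x else b) b) ∧ ∀ r ∈ b :: t,
      Match (t.foldl (fun b x => bif emb b x then x else b) b) r →
      Match r (t.foldl (fun b x => bif emb b x then x else b) b) := by
  induction t generalizing b with
  | nil => simp [subsumed_iff.1 (Subsumed.refl b)]
  | cons x t ih =>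
    rw [List.foldl_cons]
    cases h : emb b x with
    | true =>
      rw [emb_eq_true] at h
      simp only [cond_true]
      obtain ⟨h1, h2, h3⟩ := ih x
      refine ⟨List.mem_cons_of_mem _ h1, h.trans h2, fun r hr hm => ?_⟩
      rcases List.mem_cons.1 hr with rfl | hr
      · exact h.trans h2
      · exact h3 r hr hm
    | false =>
      simp only [cond_false]
      obtain ⟨h1, h2, h3⟩ := ih b
      refine ⟨?_, h2, fun r hr hm => ?_⟩
      · rcases List.mem_cons.1 h1 with h1 | h1
        · rw [h1]; exact List.mem_cons_self
        · exact List.mem_cons_of_mem _ (List.mem_cons_of_mem _ h1)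
      · rcases List.mem_cons.1 hr with rfl | hr
        · exact h2
        · rcases List.mem_cons.1 hr with rfl | hr
          -- The rejected `x` is not an image of `b`. Since `b` embeds in the final choice, the
          -- final choice cannot embed in `x`.
          · exact absurd (emb_eq_true.2 (h2.trans hm)) (by simp [h])
          · exact h3 r (List.mem_cons_of_mem _ hr) hm

theorem pickMin_spec {q : Twig A} {L : List (Twig A)} (h : L ≠ []) : pickMin q L ∈ L ∧
    ∀ r ∈ L, Match (pickMin q L) r → Match r (pickMin q L) := by
  cases L with
  | nil => exact (h rfl).elim
  | cons b t => exact ⟨(foldl_min b t).1, (foldl_min b t).2.2⟩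

theorem pickMin_mem (q : Twig A) (L : List (Twig A)) : pickMin q L ∈ q :: L := by
  cases L with
  | nil => simp [pickMin]
  | cons b t => exact List.mem_cons_of_mem _ (pickMin_spec (by simp)).1

/-- A minimal consistent fusion of `p` into `q`. -/
noncomputable def best (S : List (Twig A)) (p q : Twig A) : Twig A :=
  pickMin q ((cands p q).filter fun r => S.all fun t => emb r t)

theorem mem_filter_cands {S : List (Twig A)} {p q r : Twig A} :
    (r ∈ (cands p q).filter fun r => S.all fun t => emb r t) ↔
      r ∈ cands p q ∧ ∀ t ∈ S, Match r t := by
  simp [emb_eq_true]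

/-- A fusion adds at most the size of the fused path query, so the loop over all of them stays
linear in their total size. The default `q`, for the case without candidates, respects the bound
too. -/
theorem csize_best_le (S : List (Twig A)) (p q : Twig A) :
    csize A (best S p q) ≤ csize A q + csize A p := by
  rcases List.mem_cons.1 (pickMin_mem q ((cands p q).filter fun r => S.all fun t => emb r t))
    with h | h
  · rw [best, h]
    omega
  · obtain ⟨v, w, c, v', c', h1, h2, -, -, h3⟩ := mem_cands.1 (mem_filter_cands.1 h).1
    have h4 := h2.csize_attach c.kids
    have h5 : csize A c.kids ≤ csize A p := by
      clear * - h1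
      induction h1 with
      | nil q =>
        have := csize_kids q
        omega
      | @cons q c c' i v w e h1 _ ih =>
        have h2 := csize_le_of_mem (A := A) (List.mem_of_getElem? h1)
        have h3 := csize_kids q
        simp only [csize_prod] at h2
        omega
    rw [best, h3]
    omega

/-- One step of the fusion; the current query is the first element of a list. -/
noncomputable def fuseStep (S : List (Twig A)) (s : List (Twig A)) (p : Twig A) : List (Twig A) :=
  match s with
  | [] => [p]
  | q :: _ => [best S p q]

/-- The fusion of a list of path queries with respect to a sample. -/
noncomputable def fuse (S P : List (Twig A)) : Option (Twig A) :=
  (P.foldl (fuseStep S) []).head?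

theorem csize_foldl_fuseStep_le (S P : List (Twig A)) :
    csize A (P.foldl (fuseStep S) []) ≤ csize A P := by
  induction P using List.reverseRecOn with
  | nil => simp
  | append_singleton P p ih =>
    rw [List.foldl_append, List.foldl_cons, List.foldl_nil]
    have h1 := csize_append (A := A) P [p]
    have h2 := one_le_csize (A := A) P
    cases h : P.foldl (fuseStep S) [] with
    | nil =>
      simp only [fuseStep, csize_cons, csize_nil] at h1 ⊢
      omega
    | cons q s =>
      rw [h] at ih
      have h3 := csize_best_le S p q
      have h4 := one_le_csize (A := A) s
      simp only [fuseStep, csize_cons, csize_nil] at ih h1 ⊢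
      omega

end Twig

-- The fusion in polynomial time.

namespace PolyTime

variable {A : Type*} [LinearOrder A] [OrderBot A] {α β γ δ σ : Type*}
  [Code A α] [Code A β] [Code A γ] [Code A δ] [Code A σ]

open Polynomial

@[fun_prop]
theorem rebuild {f : α → List (Frame A)} {c : α → Twig A} (hf : PolyTime A f) (hc : PolyTime A c) :
    PolyTime A fun x => rebuild (f x) (c x) := by
  obtain ⟨P, hP⟩ := hf.bound
  obtain ⟨Q, hQ⟩ := hc.bound
  refine foldl (f := fun _ c (f : Frame A) => Twig.node f.1 (f.2.1 ++ (f.2.2.1, c) :: f.2.2.2)) hf hc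
    (by fun_prop) (Q + P) fun x l hl => ?_
  refine (csize_rebuild_le l (c x)).trans ?_
  have h1 := csize_sublist (A := A) hl.sublist
  have h2 := hP x
  have h3 := hQ x
  simp only [eval_add]
  omega

@[fun_prop]
theorem cands {p q : α → Twig A} (hp : PolyTime A p) (hq : PolyTime A q) :
    PolyTime A fun x => cands (p x) (q x) := by
  classical
  have h : PolyTime A fun y : α × Zip A => (Twig.zippers (q y.1)).filter fun z' =>
      decide (y.2.2.1 = z'.2.1) && !z'.2.2.kids.isEmpty := filter (by fun_prop) (by fun_prop)
  have := flatMap_map (l := fun x => Twig.zippers (p x)) (m := fun x (z : Zip A) =>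
    bif z.2.2.kids.isEmpty then [] else (Twig.zippers (q x)).filter fun z' =>
      decide (z.2.1 = z'.2.1) && !z'.2.2.kids.isEmpty)
    (f := fun _ (z z' : Zip A) => Twig.rebuild z'.1
      (Twig.node z'.2.2.rootLab (z'.2.2.kids ++ z.2.2.kids))) (by fun_prop)
      (cond (by fun_prop) nil h) (by fun_prop)
  convert this using 2 with x
  unfold Twig.cands
  congr!

@[fun_prop]
theorem pickMin {q : α → Twig A} {L : α → List (Twig A)} (hq : PolyTime A q) (hL : PolyTime A L) :
    PolyTime A fun x => pickMin (q x) (L x) := by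
  have h : PolyTime A fun y : Twig A × List (Twig A) =>
      y.2.foldl (fun b x => bif Twig.emb b x then x else b) y.1 := by
    refine foldl (f := fun _ b x => bif Twig.emb b x then x else b) (by fun_prop) (by fun_prop)
      (by fun_prop) X fun y l hl => ?_
    rw [eval_X, csize_prod]
    rcases List.mem_cons.1 (foldl_min y.1 l).1 with h | h
    · rw [h]
      omega
    · have := csize_le_of_mem (A := A) (hl.subset h)
      omega
  convert listCase (g := fun _ b t => t.foldl (fun b x => bif Twig.emb b x then x else b) b) hL hq
    (h.comp (by fun_prop : PolyTime A fun y : α × Twig A × List (Twig A) => y.2)) using 2 with x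
  cases L x <;> rfl

@[fun_prop]
theorem best {S : α → List (Twig A)} {p q : α → Twig A} (hS : PolyTime A S) (hp : PolyTime A p)
    (hq : PolyTime A q) : PolyTime A fun x => best (S x) (p x) (q x) :=
  pickMin hq (filter (p := fun x r => (S x).all fun t => Twig.emb r t) (by fun_prop)
    (all (l := fun y : α × Twig A => S y.1) (by fun_prop) (by fun_prop)))

theorem fuse : PolyTime A fun x : List (Twig A) × List (Twig A) => fuse x.1 x.2 := by
  have h1 : PolyTime A fun y : (List (Twig A) × List (Twig A)) × List (Twig A) × Twig A =>
      Twig.fuseStep y.1.1 y.2.1 y.2.2 := by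
    convert listCase (A := A) (l := fun y : (List (Twig A) × List (Twig A)) × List (Twig A) × Twig A => y.2.1)
      (f := fun y => [y.2.2]) (g := fun y q _ => [Twig.best y.1.1 y.2.2 q]) (by fun_prop)
      (by fun_prop) (by fun_prop) using 2 with y
    cases h : y.2.1 <;> rfl
  refine (of_op .fst (f := fun l : List (Twig A) => l.head?) fun l => ?_).comp
    (foldl (l := fun x : List (Twig A) × List (Twig A) => x.2) (i := fun _ => [])
      (f := fun x s p => Twig.fuseStep x.1 s p) (by fun_prop) nil h1 X fun x l hl => ?_)
  · cases l <;> rfl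
  · have h2 := csize_sublist (A := A) hl.sublist
    refine (csize_foldl_fuseStep_le x.1 l).trans ?_
    simp only [eval_X, csize_prod]
    omega

end PolyTime

/-! ## Containment and minimal anchored path queries -/

open Code Twig

namespace Twig

variable {A : Type*}

/-- Both canonical trees of `q` belong to its language, hence to that of `p`, and `Match.of_canons`
turns this into an embedding of `p` in `q`. Infinitely many labels are needed for the fresh one. -/
theorem contained_iff [Infinite A] {p q : Twig A} (ha : Anchored true p) :
    q.Contained p ↔ Match p q := by
  constructor
  · intro h
    obtain ⟨z, z', hzz, hz⟩ := exists_fresh q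
    have key : ∀ k z, Match p (canon k z q) := fun k z => subsumed_iff.1
      (h (show (⟨canon k z q, isTree_canon q⟩ : Tree₀ A) ∈ q.language from
        subsumed_iff.2 (match_canon q)))
    exact Match.of_canons ha (key 0 z') (key q.size z) hzz hz
  · exact fun h t ht => subsumed_iff.2 (h.trans (subsumed_iff.1 ht))

theorem anchored_ofWord {l : Option A} {w : List (Step A)} (h : Anch true w) :
    Anchored true (ofWord l w) := by
  intro v w' hw
  rwa [(leafW_ofWord.1 hw).1]

theorem MinPath.eq_of_match {S : List (Twig A)} {x y : Option A × List (Step A)}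
    (hx : MinPath S x) (hy : MinPath S y) (h : Match (ofWord x.1 x.2) (ofWord y.1 y.2)) : x = y := by
  obtain ⟨h1, h2⟩ := match_ofWord_ofWord.1 h
  obtain ⟨h3, h4⟩ := hx.minimal y.1 y.2 hy.anch hy.consistent h1 h2
  exact Prod.ext h3.symm h4.symm

theorem MinPath.mono {S S' : List (Twig A)} {x : Option A × List (Step A)}
    (hx : MinPath S x) (h : ∀ t, t ∈ S ↔ t ∈ S') : MinPath S' x where
  anch := hx.anch
  consistent t ht := hx.consistent t ((h t).2 ht)
  minimal l w ha hc := hx.minimal l w ha fun t ht => hc t ((h t).1 ht)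

/-- If one minimal path query has a labelled root, all the trees have this label at the root, and
every other consistent path query can be specialized to have it. Hence all the path queries to be
fused agree at the root. -/
theorem MinPath.fst_eq {S : List (Twig A)} (hS : S ≠ []) {x y : Option A × List (Step A)}
    (hx : MinPath S x) (hy : MinPath S y) : x.1 = y.1 := by
  have key : ∀ {x y : Option A × List (Step A)}, MinPath S x → MinPath S y → ∀ a, x.1 = some a →
      y.1 = some a := by
    intro x y hx hy a ha
    have h : ∀ t ∈ S, t.rootLab = some a := fun t ht => by
      rw [← ha]
      exact (match_ofWord.1 (hx.consistent t ht)).1 (by simp [ha])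
    obtain ⟨t, ht⟩ := List.exists_mem_of_ne_nil S hS
    refine ((hy.minimal (some a) y.2 hy.anch (fun t ht => ?_) ?_ (.refl _)).1).symm
    · exact match_ofWord.2 ⟨fun _ => h t ht, (match_ofWord.1 (hy.consistent t ht)).2⟩
    · intro hne
      rw [← h t ht]
      exact (match_ofWord.1 (hy.consistent t ht)).1 hne
  rcases hx1 : x.1 with _ | a
  · rcases hy1 : y.1 with _ | b
    · rfl
    · rw [← hx1, key hy hx b hy1]
  · rw [key hx hy a hx1]

end Twig

/-- The trees of a sample. -/
def Sample.trees {A : Type*} (S : Sample A) : List (Twig A) := S.1.map Subtype.val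

namespace Sample

variable {A : Type*}

theorem consistent_iff {S : Sample A} {q : Twig A} :
    S.Consistent q ↔ ∀ t ∈ S.trees, Match q t := by
  simp only [trees, List.mem_map, forall_exists_index, and_imp, forall_apply_eq_imp_iff₂]
  exact forall₂_congr fun t _ => subsumed_iff

theorem trees_ne_nil (S : Sample A) : S.trees ≠ [] := by
  exact fun h => S.2 (List.map_eq_nil_iff.1 h)

theorem isMinimalIn_iff [Infinite A] {S : Sample A} {p : Twig A} :
    S.IsMinimalIn (AnchPath₀ A) p ↔ ∃ x, p = ofWord x.1 x.2 ∧ MinPath S.trees x := by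
  constructor
  · rintro ⟨h1, h2, h3⟩
    obtain ⟨l, w, rfl, ha⟩ := isAnchoredPath_iff.1 h1
    refine ⟨(l, w), rfl, ha, consistent_iff.1 h2, fun l' w' ha' hc hl hw => ?_⟩
    by_contra hne
    refine h3 ⟨ofWord l' w', isAnchoredPath_ofWord.2 ha',
      (contained_iff (anchored_ofWord ha)).2 (match_ofWord_ofWord.2 ⟨hl, hw⟩), fun h => hne ?_,
      consistent_iff.2 hc⟩
    have h4 := match_ofWord_ofWord.1 ((contained_iff (anchored_ofWord ha')).1 h.2)
    exact ⟨h4.1.antisymm hl |>.symm, h4.2.antisymm hw⟩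
  · rintro ⟨⟨l, w⟩, rfl, h⟩
    refine ⟨isAnchoredPath_ofWord.2 h.anch, consistent_iff.2 h.consistent, ?_⟩
    rintro ⟨p, h1, h2, h3, h4⟩
    obtain ⟨l', w', rfl, ha⟩ := isAnchoredPath_iff.1 h1
    have h5 := match_ofWord_ofWord.1 ((contained_iff (anchored_ofWord h.anch)).1 h2)
    obtain ⟨rfl, rfl⟩ := h.minimal l' w' ha (consistent_iff.1 h4) h5.1 h5.2
    exact h3 ⟨h2, h2⟩

end Sample

namespace Twig

variable {A : Type*}

/-- The first greedy run treats the path `w` of `t` as an additional tree and is thereby steered to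
a query that fits this path; the second run makes its result minimal for `S` itself. For soundness
the second run would suffice, while the first is needed to reach every minimal path query. -/
theorem inferOne_spec {S : List (Twig A)} {t : Twig A} (ht : t ∈ S) (w : List (Step A)) :
    MinPath S (inferOne S t w) ∧ ∃ x, MinPath (ofWord t.rootLab w :: S) x ∧
      Match (ofWord x.1 x.2) (ofWord (inferOne S t w).1 (inferOne S t w).2) := by
  obtain ⟨h1, -⟩ := greedy_spec (t := ofWord t.rootLab w) (S := S) (x := (none, [])) trivial
    fun t' _ => match_ofWord.2 ⟨fun h => (h rfl).elim, by
      obtain ⟨v, w, h⟩ := exists_leafW t'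
      exact ⟨v, w, h, .nil w⟩⟩
  obtain ⟨h2, h3, h4⟩ := greedy_spec (t := t) h1.anch fun t' ht' =>
    h1.consistent t' (List.mem_cons_of_mem _ (by
      rcases List.mem_cons.1 ht' with rfl | h
      · exact ht
      · exact h))
  refine ⟨h2.mono fun t' => ?_, _, h1, match_ofWord_ofWord.2 ⟨h3, h4⟩⟩
  rw [List.mem_cons]
  constructor
  · rintro (rfl | h)
    · exact ht
    · exact h
  · exact .inr

theorem mem_infer {S : List (Twig A)} {p : Twig A} :
    p ∈ infer S ↔ ∃ t ∈ S, ∃ v w, LeafW t v w ∧ p = ofWord (inferOne S t w).1 (inferOne S t w).2 := by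
  simp only [infer, List.mem_dedup, inferAll, List.mem_flatMap, List.mem_map, mem_pathWords]
  constructor
  · rintro ⟨t, ht, w, ⟨v, h⟩, rfl⟩
    exact ⟨t, ht, v, w, h, rfl⟩
  · rintro ⟨t, ht, v, w, h, rfl⟩
    exact ⟨t, ht, w, ⟨v, h⟩, rfl⟩

theorem infer_ne_nil {S : List (Twig A)} (hS : S ≠ []) : infer S ≠ [] := by
  obtain ⟨t, ht⟩ := List.exists_mem_of_ne_nil S hS
  obtain ⟨v, w, h⟩ := exists_leafW t
  exact List.ne_nil_of_mem (mem_infer.2 ⟨t, ht, v, w, h, rfl⟩)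

theorem exists_minPath_of_mem_infer {S : List (Twig A)} {p : Twig A} (h : p ∈ infer S) :
    ∃ x, p = ofWord x.1 x.2 ∧ MinPath S x := by
  obtain ⟨t, ht, v, w, -, rfl⟩ := mem_infer.1 h
  exact ⟨_, rfl, (inferOne_spec ht w).1⟩

theorem nodup_infer (S : List (Twig A)) : (infer S).Nodup := by
  classical exact List.nodup_dedup _

/-- Comparable minimal path queries are equal, so the removal of duplicates already makes the family
reduced. -/
theorem reduced_of_nodup [Infinite A] {S P : List (Twig A)}
    (h : ∀ p ∈ P, ∃ x, p = ofWord x.1 x.2 ∧ MinPath S x) (hP : P.Nodup) : Reduced P := by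
  refine List.Pairwise.imp_of_mem ?_ hP
  have key : ∀ {p p'}, p ∈ P → p' ∈ P → p ≠ p' → ¬ p.Contained p' := by
    rintro p p' hp hp' hne hc
    obtain ⟨x, rfl, hx⟩ := h p hp
    obtain ⟨y, rfl, hy⟩ := h p' hp'
    rw [contained_iff (anchored_ofWord hy.anch)] at hc
    exact hne (by rw [hy.eq_of_match hx hc])
  exact fun {_ _} hp hp' hne => ⟨key hp hp' hne, key hp' hp hne.symm⟩

/-! ### Twigs made of minimal path queries -/

/-- A query consistent with `S` whose paths are different minimal anchored path queries. -/
structure Good (S : List (Twig A)) (g : Twig A) : Prop where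
  minPath : ∀ v w, LeafW g v w → MinPath S (g.rootLab, w)
  inj : ∀ v v' w, LeafW g v w → LeafW g v' w → v = v'
  consistent : ∀ t ∈ S, Match g t

theorem Good.isPsf [Infinite A] {S : List (Twig A)} {g : Twig A} (h : Good S g) : g.IsPsf where
  anchored p hp := by
    obtain ⟨v, w, hw, rfl⟩ := mem_paths.1 hp
    exact isAnchoredPath_ofWord.2 (h.minPath v w hw).anch
  reduced := reduced_paths_iff.2 fun v w v' w' hw hw' hne hc => by
    have h1 := h.minPath v w hw
    have h2 := h.minPath v' w' hw'
    have h3 := h2.eq_of_match h1 ((contained_iff (anchored_ofWord h2.anch)).1 hc)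
    obtain rfl : w' = w := (Prod.ext_iff.1 h3).2
    exact hne (h.inj _ _ _ hw hw')

theorem MinPath.good {S : List (Twig A)} {x : Option A × List (Step A)} (h : MinPath S x) :
    Good S (ofWord x.1 x.2) where
  minPath v w hw := by
    rw [(leafW_ofWord.1 hw).1]
    exact h
  inj v v' w hw hw' := by rw [(leafW_ofWord.1 hw).2, (leafW_ofWord.1 hw').2]
  consistent := h.consistent

theorem Walk.exists_leafW_append {q c : Twig A} {v : List ℕ} {w : List (Step A)}
    (h : Walk q v w c) (hc : c.kids ≠ []) : ∃ v' w', w' ≠ [] ∧ LeafW q (v ++ v') (w ++ w') := by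
  obtain ⟨v', w', h'⟩ := exists_leafW c
  refine ⟨v', w', ?_, h.leafW h'⟩
  rintro rfl
  have h1 := h'.length_eq
  obtain rfl : v' = [] := by simpa using h1
  exact hc (leafW_nil.1 h').2

theorem rootLab_attach (q : Twig A) (v : List ℕ) (new : List (Edge × Twig A)) :
    (q.attach v new).rootLab = q.rootLab := by
  cases q
  cases v <;> rfl

/-- Attaching a path below an inner node creates one leaf and keeps all the old ones; at a leaf it
would destroy an old path, hence the hypothesis `hc`. -/
theorem Walk.leafW_attach {q c : Twig A} {v : List ℕ} {u : List (Step A)} (h : Walk q v u c)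
    (hc : c.kids ≠ []) {x : Step A} {s : List (Step A)} {v' : List ℕ} {w : List (Step A)} :
    LeafW (q.attach v (tail (x :: s))) v' w ↔ LeafW q v' w ∨
      v' = v ++ c.kids.length :: List.replicate s.length 0 ∧ w = u ++ x :: s := by
  induction h generalizing v' w with
  | nil q =>
    obtain ⟨l, ks⟩ := q
    obtain ⟨e, l'⟩ := x
    change ks ≠ [] at hc
    change LeafW (node l (ks ++ [(e, ofWord l' s)])) v' w ↔ _ ∨ v' = ks.length :: _ ∧ _
    cases v' with
    | nil => simp [leafW_nil, kids, hc]
    | cons i v' =>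
      rw [leafW_cons, leafW_cons]
      simp only [kids, List.nil_append, List.cons.injEq]
      rcases lt_trichotomy i ks.length with hi | rfl | hi
      · rw [List.getElem?_append_left hi]
        simp [hi.ne]
      · simp only [List.getElem?_concat_length, Option.some.injEq, Prod.mk.injEq, true_and,
          List.getElem?_eq_none le_rfl]
        constructor
        · rintro ⟨_, _, w', ⟨rfl, rfl⟩, h1, rfl⟩
          obtain ⟨rfl, rfl⟩ := leafW_ofWord.1 h1
          exact .inr ⟨rfl, rfl⟩
        · rintro (⟨_, _, _, h1, -⟩ | ⟨rfl, rfl⟩)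
          · cases h1
          · exact ⟨_, _, _, ⟨rfl, rfl⟩, leafW_ofWord.2 ⟨rfl, rfl⟩, rfl⟩
      · rw [List.getElem?_eq_none (by simp; omega), List.getElem?_eq_none hi.le]
        simp [hi.ne']
  | @cons q c c' i v u e h1 _ ih =>
    obtain ⟨l, ks⟩ := q
    change ks[i]? = _ at h1
    rw [attach]
    cases v' with
    | nil =>
      have h2 : ks ≠ [] := by
        rintro rfl
        simp at h1
      simp [leafW_nil, kids, h2]
    | cons j v' =>
      rw [leafW_cons, leafW_cons]
      simp only [kids, List.cons_append, List.cons.injEq, List.getElem?_modify]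
      by_cases hj : i = j
      · subst hj
        simp only [h1, if_true, Option.some.injEq, Prod.mk.injEq, true_and]
        constructor
        · rintro ⟨_, _, w', ⟨rfl, rfl⟩, h2, rfl⟩
          rcases (ih hc).1 h2 with h3 | ⟨rfl, rfl⟩
          · exact .inl ⟨_, _, w', ⟨rfl, rfl⟩, h3, by rw [rootLab_attach]⟩
          · exact .inr ⟨rfl, by rw [rootLab_attach]⟩
        · rintro (⟨_, _, w', ⟨rfl, rfl⟩, h2, rfl⟩ | ⟨rfl, rfl⟩)
          · exact ⟨_, _, w', rfl, (ih hc).2 (.inl h2), by rw [rootLab_attach]⟩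
          · exact ⟨_, _, _, rfl, (ih hc).2 (.inr ⟨rfl, rfl⟩), by rw [rootLab_attach]⟩
      · simp [hj, Ne.symm hj]

end Twig

/-! ## Soundness of the fusion -/

open Code Twig

namespace Twig

variable {A : Type*}

/-- The label at the end of the word `w`, when the label at its start is `l`. -/
def lastLab (l : Option A) (w : List (Step A)) : Option A := w.foldl (fun _ x => x.2) l

theorem Walk.rootLab_eq {q c : Twig A} {v : List ℕ} {w : List (Step A)} (h : Walk q v w c) :
    c.rootLab = lastLab q.rootLab w := by
  induction h with
  | nil => rfl
  | cons _ _ ih => exact ih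

theorem walk_ofWord {l : Option A} {w u : List (Step A)} {v : List ℕ} {c : Twig A} :
    Walk (ofWord l w) v u c ↔
      ∃ s, w = u ++ s ∧ v = List.replicate u.length 0 ∧ c = ofWord (lastLab l u) s := by
  induction w generalizing l v u c with
  | nil =>
    constructor
    · rintro (_ | ⟨h, -⟩)
      · exact ⟨[], rfl, rfl, rfl⟩
      · simp [ofWord, tail, kids] at h
    · rintro ⟨s, h, rfl, rfl⟩
      obtain ⟨rfl, rfl⟩ := List.append_eq_nil_iff.1 h.symm
      exact .nil _
  | cons x w ih =>
    obtain ⟨e, l'⟩ := x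
    constructor
    · rintro (_ | ⟨h, h'⟩)
      · exact ⟨_, rfl, rfl, rfl⟩
      · rw [kids_ofWord_cons, List.getElem?_singleton] at h
        split_ifs at h with hi
        cases h
        obtain ⟨s, rfl, rfl, rfl⟩ := ih.1 h'
        exact ⟨s, rfl, by rw [hi]; rfl, rfl⟩
    · rintro ⟨s, h, rfl, rfl⟩
      cases u with
      | nil =>
        obtain rfl : _ = s := h
        exact .nil _
      | cons y u =>
        obtain ⟨rfl, rfl⟩ := List.cons_eq_cons.1 h
        exact .cons (c := ofWord l' (u ++ s)) (by rw [kids_ofWord_cons]; rfl)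
          (ih.2 ⟨s, rfl, rfl, rfl⟩)

theorem cut_ofWord (l : Option A) (u s : List (Step A)) :
    (ofWord l (u ++ s)).cut (List.replicate u.length 0) = ofWord l u := by
  induction u generalizing l with
  | nil => rfl
  | cons x u ih =>
    obtain ⟨e, l'⟩ := x
    have h := ih l'
    change node l [(e, (ofWord l' (u ++ s)).cut _)] = node l [(e, ofWord l' u)]
    rw [h]

/-- The word `w` embeds in the word `u` in such a way that the end is mapped to the end. -/
structure Exact (w u : List (Step A)) : Prop where
  pe : ∀ {s s'}, PE s s' → PE (w ++ s) (u ++ s')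
  last : w = [] ∧ u = [] ∨ ∃ w' e l u' e' l', w = w' ++ [(e, l)] ∧ u = u' ++ [(e', l')] ∧
    Matches l' l ∧ (e = .child → e' = .child)

/-- `PE` alone forgets where the last node goes. Following the embedding along the word keeps this
information: a last child edge is mapped to a child edge, and any continuation embeds below the
image. The suffix `s` is there for the induction from the end of `w`. -/
theorem RawEmb.exact {l : Option A} {w : List (Step A)} {q : Twig A} {F : List ℕ → List ℕ} :
    ∀ {s u c}, RawEmb (ofWord l (w ++ s)) q F → Walk q (F (List.replicate w.length 0)) u c →
      Exact w u := by
  induction w using List.reverseRecOn with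
  | nil =>
    intro s u c hF h
    have h' : Walk q [] u c := hF.root ▸ h
    obtain ⟨rfl, -⟩ := walk_nil.1 h'
    exact ⟨fun h => h, .inl ⟨rfl, rfl⟩⟩
  | append_singleton w x ih =>
    intro s u c hF h
    obtain ⟨e, l'⟩ := x
    rw [List.append_assoc, List.singleton_append] at hF
    rw [List.length_append, List.length_singleton, List.replicate_succ'] at h
    have h1 : Walk (ofWord l (w ++ (e, l') :: s)) (List.replicate w.length 0) w
      (ofWord (lastLab l w) ((e, l') :: s)) := walk_ofWord.2 ⟨_, rfl, rfl, rfl⟩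
    have h2 : (ofWord (lastLab l w) ((e, l') :: s)).kids[0]? = some (e, ofWord l' s) := by
      rw [kids_ofWord_cons]; rfl
    obtain ⟨u', c', h3, h4⟩ := hF.walk (h1.snoc h2)
    obtain ⟨rfl, rfl⟩ := h3.unique h
    have h4 : Matches c'.rootLab l' := h4
    cases e with
    | child =>
      obtain ⟨j, u₁, c₁, k, h5, h6, h7⟩ := hF.child h1 h2
      rw [h7] at h
      obtain ⟨rfl, rfl⟩ := h.unique (h5.snoc h6)
      refine ⟨fun {s s'} hs => ?_, .inr ⟨w, _, _, u₁, _, _, rfl, rfl, h4, fun _ => rfl⟩⟩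
      rw [List.append_assoc, List.append_assoc]
      exact (ih hF h5).pe (.child h4 hs)
    | desc =>
      obtain ⟨x, hx, h7⟩ := hF.below h1 h2
      rw [h7] at h
      obtain ⟨u₁, u₂, m, rfl, h8, h9⟩ := h.split
      obtain ⟨x, i, rfl⟩ := (List.eq_nil_or_concat x).resolve_left hx
      rw [List.concat_eq_append] at h9
      obtain ⟨e, m', u₃, -, h10, rfl⟩ := walk_snoc.1 h9
      refine ⟨fun {s s'} hs => ?_, .inr ⟨w, _, _, u₁ ++ u₃, e, c'.rootLab, rfl, by simp, h4,
        by simp⟩⟩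
      simp only [List.append_assoc]
      exact (ih hF h8).pe (.skips (.desc _ h4 hs) _)

/-- The condition on the beginning of an anchored word. -/
def PreAnch : Bool → List (Step A) → Prop
  | _, [] => True
  | b, (e, l) :: w => (e = .desc → b = true ∧ l ≠ none) ∧ PreAnch l.isSome w

/-- Whether the label at the end of a word is not the wildcard. -/
def endLab (b : Bool) (w : List (Step A)) : Bool := w.foldl (fun _ x => x.2.isSome) b

theorem anch_append {b : Bool} {u s : List (Step A)} (hs : s ≠ []) :
    Anch b (u ++ s) ↔ PreAnch b u ∧ Anch (endLab b u) s := by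
  induction u generalizing b with
  | nil => simp [PreAnch, endLab]
  | cons x u ih =>
    obtain ⟨e, l⟩ := x
    rw [List.cons_append, Anch, ih]
    simp only [PreAnch, endLab, List.foldl_cons, List.append_eq_nil_iff, hs, and_false, ne_eq,
      not_false_eq_true, implies_true, true_and, and_assoc]

theorem Anch.preAnch {b : Bool} {u : List (Step A)} (h : Anch b u)
    (h' : ∀ u', u ≠ u' ++ [(.desc, none)]) : PreAnch b u := by
  induction u generalizing b with
  | nil => trivial
  | cons x u ih =>
    obtain ⟨e, l⟩ := x
    refine ⟨fun he => ⟨(h.1 he).1, fun hl => ?_⟩, ih h.2.2 fun u' hu => h' (_ :: u') (by rw [hu]; rfl)⟩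
    subst he hl
    rw [(h.1 rfl).2 rfl] at h'
    exact h' [] rfl

theorem PreAnch.ne {b : Bool} {u : List (Step A)} (h : PreAnch b u) (u' : List (Step A)) :
    u ≠ u' ++ [(.desc, none)] := by
  rintro rfl
  induction u' generalizing b with
  | nil => exact (h.1 rfl).2 rfl
  | cons x u' ih => exact ih h.2

/-- Only the seam can violate anchoring. If the end of `w` is labelled, so is the end of `u`. If `u`
ended in a wildcard entered by a descendant edge, so would `w`, which has the continuation `s`. -/
theorem Exact.anch {w u s : List (Step A)} (h : Exact w u) (hw : Anch true (w ++ s)) (hs : s ≠ [])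
    (hu : Anch true u ∨ PreAnch true u) : Anch true (u ++ s) := by
  rw [anch_append hs] at hw ⊢
  rcases h.last with ⟨rfl, rfl⟩ | ⟨w', e, l, u', e', l', rfl, rfl, hl, he⟩
  · exact hw
  · refine ⟨?_, hw.2.mono ?_⟩
    · rcases hu with hu | hu
      · refine hu.preAnch fun u'' h1 => hw.1.ne w' ?_
        have h2 := (List.append_inj' h1 rfl).2
        simp only [List.cons.injEq, Prod.mk.injEq, and_true] at h2
        obtain ⟨rfl, rfl⟩ := h2
        have h3 : l = none := by
          by_contra hne
          exact hne (hl hne).symm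
        cases e
        · simp at he
        · rw [h3]
      · exact hu
    · simp only [endLab, List.foldl_append, List.foldl_cons, List.foldl_nil]
      cases l
      · simp
      · rw [hl (by simp)]
        exact fun h => h

theorem Walk.attach {q c : Twig A} {v : List ℕ} {w : List (Step A)} (h : Walk q v w c)
    (new : List (Edge × Twig A)) : Walk (q.attach v new) v w (node c.rootLab (c.kids ++ new)) := by
  induction h with
  | nil q =>
    cases q
    exact .nil _
  | @cons q c c' i v w e h1 _ ih =>
    obtain ⟨l, ks⟩ := q
    change ks[i]? = _ at h1
    rw [← rootLab_attach c v new]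
    refine .cons ?_ ih
    simp [Twig.attach, kids, h1]

theorem Walk.leafW_attach_new {q c : Twig A} {v : List ℕ} {u : List (Step A)} (h : Walk q v u c)
    (x : Step A) (s : List (Step A)) :
    ∃ v', LeafW (q.attach v (tail (x :: s))) v' (u ++ x :: s) :=
  ⟨_, (h.attach _).leafW (leafW_cons.2 ⟨x.1, ofWord x.2 s, s, List.getElem?_concat_length,
    leafW_ofWord.2 ⟨rfl, rfl⟩, rfl⟩)⟩

/-- The tautological embedding of a path into the query it was read off: an address of zeros is sent
to the initial segment of `v` of the same length. -/
theorem Walk.rawEmb {g c : Twig A} {v : List ℕ} {u : List (Step A)} (h2 : Walk g v u c) :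
    RawEmb (ofWord g.rootLab u) g fun x => v.take x.length := by
  have hlen := h2.length_eq
  have key : ∀ {x w₁ c₁}, Walk (ofWord g.rootLab u) x w₁ c₁ → ∃ m s, u = w₁ ++ s ∧
      c₁ = ofWord (lastLab g.rootLab w₁) s ∧ Walk g (v.take x.length) w₁ m ∧
      Walk m (v.drop x.length) s c := by
    intro x w₁ c₁ h
    obtain ⟨s', rfl, rfl, rfl⟩ := walk_ofWord.1 h
    obtain ⟨m, h3, h4⟩ := h2.take w₁.length
    rw [List.take_left] at h3
    rw [List.drop_left] at h4
    exact ⟨m, s', rfl, rfl, by simpa using h3, by simpa using h4⟩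
  have key2 : ∀ {x w₁ c₁ i e k}, Walk (ofWord g.rootLab u) x w₁ c₁ → c₁.kids[i]? = some (e, k) →
      ∃ j m k', Walk g (v.take x.length) w₁ m ∧ m.kids[j]? = some (e, k') ∧
        v.take (x ++ [i]).length = v.take x.length ++ [j] := by
    intro x w₁ c₁ i e k h hi
    obtain ⟨m, s', hs, rfl, h3, h4⟩ := key h
    cases s' with
    | nil => simp [ofWord, tail, kids] at hi
    | cons y s' =>
      rw [kids_ofWord_cons, List.getElem?_singleton] at hi
      split_ifs at hi
      cases hi
      have h5 : x.length < v.length := by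
        rw [h.length_eq, hlen, hs, List.length_append, List.length_cons]
        omega
      rw [List.drop_eq_getElem_cons h5] at h4
      obtain ⟨e, k', s'', h6, h7, h8⟩ := walk_cons.1 h4
      cases h8
      exact ⟨_, m, k', h3, h6, by
        rw [List.length_append, List.length_singleton, List.take_succ_eq_append_getElem h5]⟩
  constructor
  · simp
  · intro x w₁ c₁ h
    obtain ⟨m, s', -, rfl, h3, -⟩ := key h
    exact ⟨_, m, h3, fun _ => h3.rootLab_eq⟩
  · intro x w₁ c₁ i k h hi
    obtain ⟨j, m, k', h3, h4, h5⟩ := key2 h hi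
    exact ⟨j, w₁, m, k', h3, h4, h5⟩
  · intro x w₁ c₁ i e k h hi
    obtain ⟨j, m, k', h3, h4, h5⟩ := key2 h hi
    exact ⟨[j], by simp, h5⟩

variable {S : List (Twig A)} {g r : Twig A} {w : List (Step A)}

/-- Let the upper part `w₁` of `w₁ ++ s` be sent to a node with the word `u`. Then `u ++ s` is an
anchored consistent path of `r` and specializes the minimal `w₁ ++ s`, so `u = w₁`. The node is no
leaf of `g`, as the minimal path `u` would then be specialized by `u ++ s`. The case of empty `s`
would make `w` a path of `g`. -/
theorem Good.mem_cands (hg : Good S g) (hw : MinPath S (g.rootLab, w)) (hnew : ∀ v, ¬ LeafW g v w)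
    (hr : IsFusion (ofWord g.rootLab w) g r) (hc : ∀ t ∈ S, Match r t) :
    r ∈ cands (ofWord g.rootLab w) g := by
  obtain ⟨n, f, n₁, hn, hf, rfl⟩ := hr
  obtain ⟨w₁, hn1⟩ := walk_sub n
  obtain ⟨s, rfl, hn2, hn3⟩ := walk_ofWord.1 hn1
  obtain ⟨F, hF, hFn⟩ := hf.exists_rawEmb
  have hF1 := hFn n₁
  rw [hn, hn2] at hF1
  rw [hn2, cut_ofWord] at hF
  obtain ⟨u, hu⟩ := walk_sub (f n₁)
  obtain ⟨c, hcc⟩ : ∃ c, c = g.sub (f n₁) := ⟨_, rfl⟩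
  rw [← hcc] at hu
  have hex : Exact w₁ u := RawEmb.exact (s := []) (by rwa [List.append_nil]) (hF1 ▸ hu)
  rw [hn3] at hc ⊢
  change ∀ t ∈ S, Match (g.attach _ (tail s)) t at hc
  cases s with
  | nil =>
    obtain ⟨v', w', h'⟩ := exists_leafW c
    have h1 := hu.leafW h'
    have h2 := hw.eq_of_match (hg.minPath _ _ h1) (match_ofWord_ofWord.2 ⟨fun _ => rfl,
      hex.pe (.nil w')⟩)
    have h3 : w₁ ++ [] = u ++ w' := (Prod.ext_iff.1 h2).2
    exact (hnew _ (h3 ▸ h1)).elim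
  | cons x s =>
    have ha : Anch true (u ++ x :: s) := by
      refine hex.anch hw.anch (by simp) ?_
      by_cases hk : c.kids = []
      · exact .inl (hg.minPath _ _ ⟨c, hu, hk⟩).anch
      · obtain ⟨v', w', hne, h'⟩ := hu.exists_leafW_append hk
        exact .inr ((anch_append hne).1 (hg.minPath _ _ h').anch).1
    have hcons : ∀ t ∈ S, Match (ofWord g.rootLab (u ++ x :: s)) t := by
      intro t ht
      obtain ⟨v', h'⟩ := hu.leafW_attach_new x s
      have := h'.match
      rw [rootLab_attach] at this
      exact this.trans (hc t ht)
    have h1 := (hw.minimal _ _ ha hcons (fun _ => rfl) (hex.pe (.refl _))).2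
    obtain rfl : u = w₁ := List.append_cancel_right h1
    refine Twig.mem_cands.2 ⟨_, _, _, _, c, hn1, hu, ?_, fun hk => ?_, by rw [hn3]⟩
    · rw [hn3, Ne, kids_ofWord_eq_nil]
      simp
    · have h2 := hg.minPath _ _ ⟨c, hu, hk⟩
      have h3 : PE u (u ++ x :: s) := by simpa using hex.pe (.nil (x :: s))
      have := (h2.minimal _ _ ha hcons (fun _ => rfl) h3).2
      simp at this

theorem isFusion_of_mem_cands (hr : r ∈ cands (ofWord g.rootLab w) g) :
    IsFusion (ofWord g.rootLab w) g r := by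
  obtain ⟨v, u, c, v', c', h1, h2, -, -, rfl⟩ := Twig.mem_cands.1 hr
  obtain ⟨s, rfl, rfl, rfl⟩ := walk_ofWord.1 h1
  have hF := h2.rawEmb
  obtain ⟨f, hf, hfF⟩ := hF.exists_isEmbedding
  have hn : Walk (ofWord g.rootLab u) (List.replicate u.length 0) u (ofWord (lastLab g.rootLab u) []) :=
    walk_ofWord.2 ⟨[], by simp, rfl, rfl⟩
  have hcut := cut_ofWord g.rootLab u s
  refine ⟨h1.toNode, ?_⟩
  have h3 : (ofWord g.rootLab (u ++ s)).sub h1.toNode = ofWord (lastLab g.rootLab u) s :=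
    h1.sub_eq (n := h1.toNode)
  rw [h3]
  change ∃ (f : ((ofWord g.rootLab (u ++ s)).cut (List.replicate u.length 0)).Node → g.Node)
    (n₁ : ((ofWord g.rootLab (u ++ s)).cut (List.replicate u.length 0)).Node),
    n₁.1 = List.replicate u.length 0 ∧ IsEmbedding ((ofWord g.rootLab (u ++ s)).cut
      (List.replicate u.length 0)) g f ∧ _
  rw [hcut]
  refine ⟨f, hn.toNode, rfl, hf, ?_⟩
  rw [hfF]
  change _ = g.attach (v'.take (List.replicate u.length 0).length) _
  rw [List.length_replicate, ← h2.length_eq, List.take_length]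

theorem match_attach_nil {p q t : Twig A} (hp : Match p t) (hq : Match q t) :
    Match (q.attach [] p.kids) t := by
  obtain ⟨l, ks⟩ := q
  rw [match_iff] at hp hq ⊢
  refine ⟨hq.1, fun e c hc => ?_⟩
  rcases List.mem_append.1 hc with hc | hc
  · exact hq.2 e c hc
  · exact hp.2 e c hc

/-- Fusing at the root is always consistent, as the two queries embed independently; minimality of
`w` and its absence from `g` exclude that either is a single node. So earlier choices never block
the fusion. -/
theorem Good.exists_cands (hg : Good S g) (hw : MinPath S (g.rootLab, w))
    (hnew : ∀ v, ¬ LeafW g v w) :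
    ∃ r ∈ cands (ofWord g.rootLab w) g, ∀ t ∈ S, Match r t := by
  have hw0 : w ≠ [] := by
    rintro rfl
    obtain ⟨v, w, h⟩ := exists_leafW g
    have := hw.eq_of_match (hg.minPath v w h) (match_ofWord_ofWord.2 ⟨fun _ => rfl, .nil w⟩)
    obtain rfl : [] = w := (Prod.ext_iff.1 this).2
    exact hnew _ h
  have hg0 : g.kids ≠ [] := by
    intro h
    have h1 : LeafW g [] [] := leafW_nil.2 ⟨rfl, h⟩
    have := (hg.minPath _ _ h1).eq_of_match hw (match_ofWord_ofWord.2 ⟨fun _ => rfl, .nil w⟩)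
    exact hw0 (Prod.ext_iff.1 this).2.symm
  exact ⟨_, Twig.mem_cands.2 ⟨[], [], _, [], g, .nil _, .nil g, by simpa using hw0, hg0, rfl⟩,
    fun t ht => match_attach_nil (hw.consistent t ht) (hg.consistent t ht)⟩

/-- The form of the fusions of a minimal path query. -/
theorem Good.exists_attach (hr : r ∈ cands (ofWord g.rootLab w) g) :
    ∃ v u c x s, Walk g v u c ∧ c.kids ≠ [] ∧ w = u ++ x :: s ∧ r = g.attach v (tail (x :: s)) := by
  obtain ⟨v, u, c, v', c', h1, h2, h3, h4, rfl⟩ := Twig.mem_cands.1 hr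
  obtain ⟨s, rfl, rfl, rfl⟩ := walk_ofWord.1 h1
  cases s with
  | nil => simp at h3
  | cons x s => exact ⟨v', u, c', x, s, h2, h4, rfl, rfl⟩

/-- A consistent fusion at an inner node with the same word adds exactly one leaf, and its word is
`w`. The invariant survives because this word is minimal and new. -/
theorem Good.fuse (hg : Good S g) (hw : MinPath S (g.rootLab, w)) (hnew : ∀ v, ¬ LeafW g v w)
    (hr : r ∈ cands (ofWord g.rootLab w) g) (hc : ∀ t ∈ S, Match r t) :
    Good S r ∧ r.rootLab = g.rootLab ∧
      ∀ w', (∃ v, LeafW r v w') ↔ (∃ v, LeafW g v w') ∨ w' = w := by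
  obtain ⟨v, u, c, x, s, h1, h2, rfl, rfl⟩ := Good.exists_attach hr
  have hl := fun {v' w'} => h1.leafW_attach h2 (x := x) (s := s) (v' := v') (w := w')
  refine ⟨⟨fun v' w' h => ?_, fun v' v'' w' h h' => ?_, hc⟩, rootLab_attach _ _ _, fun w' => ?_⟩
  · rw [rootLab_attach]
    rcases hl.1 h with h | ⟨-, rfl⟩
    · exact hg.minPath _ _ h
    · exact hw
  · rcases hl.1 h with h | ⟨h1, rfl⟩
    · rcases hl.1 h' with h' | ⟨-, rfl⟩
      · exact hg.inj _ _ _ h h'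
      · exact (hnew _ h).elim
    · rcases hl.1 h' with h' | ⟨h2, -⟩
      · exact (hnew _ h').elim
      · rw [h1, h2]
  · constructor
    · rintro ⟨v', h⟩
      rcases hl.1 h with h | ⟨-, rfl⟩
      · exact .inl ⟨_, h⟩
      · exact .inr rfl
    · rintro (⟨v', h⟩ | rfl)
      · exact ⟨_, hl.2 (.inl h)⟩
      · exact ⟨_, hl.2 (.inr ⟨rfl, rfl⟩)⟩

end Twig

-- Runs of the fusion loop on a sample.

namespace Sample

variable {A : Type*} {S : Sample A} {g r : Twig A} {w : List (Step A)}

theorem mem_candidates (hg : Good S.trees g) (hw : MinPath S.trees (g.rootLab, w))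
    (hnew : ∀ v, ¬ LeafW g v w) : r ∈ S.Candidates (ofWord g.rootLab w) (some g) ↔
      r ∈ cands (ofWord g.rootLab w) g ∧ ∀ t ∈ S.trees, Match r t := by
  constructor
  · rintro ⟨h1, h2⟩
    rw [consistent_iff] at h2
    exact ⟨hg.mem_cands hw hnew h1 h2, h2⟩
  · rintro ⟨h1, h2⟩
    exact ⟨isFusion_of_mem_cands h1, consistent_iff.2 h2⟩

theorem isBestFusion_best (hg : Good S.trees g) (hw : MinPath S.trees (g.rootLab, w))
    (hnew : ∀ v, ¬ LeafW g v w) :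
    S.IsBestFusion (ofWord g.rootLab w) (some g) (best S.trees (ofWord g.rootLab w) g) := by
  obtain ⟨r, h1, h2⟩ := hg.exists_cands hw hnew
  have h3 := pickMin_spec (q := g) (List.ne_nil_of_mem (mem_filter_cands.2 ⟨h1, h2⟩))
  refine ⟨(mem_candidates hg hw hnew).2 (mem_filter_cands.1 h3.1), fun r hr hm => ?_⟩
  rw [mem_candidates hg hw hnew] at hr
  rw [subsumed_iff] at hm ⊢
  exact h3.2 r (mem_filter_cands.2 hr) hm

theorem isBestFusion_none (h : S.Consistent r) : S.IsBestFusion r none r :=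
  ⟨⟨rfl, h⟩, fun r' hr' _ => by
    obtain rfl : r' = r := hr'.1
    exact .refl _⟩

/-- The words of the query grow by exactly the fused one, so distinct members of `P` remain new to
the query until their turn comes. -/
theorem fusionRun_of_good (hg : Good S.trees g) {P : List (Twig A)} (hP : P.Nodup)
    (h : ∀ p ∈ P, ∃ w, p = ofWord g.rootLab w ∧ MinPath S.trees (g.rootLab, w) ∧
      ∀ v, ¬ LeafW g v w) :
    ∃ r, P.foldl (fuseStep S.trees) [g] = [r] ∧ S.FusionRun (some g) P (some r) ∧
      Good S.trees r := by
  induction P generalizing g with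
  | nil => exact ⟨g, rfl, .done _, hg⟩
  | cons p P ih =>
    obtain ⟨w, rfl, hw, hnew⟩ := h p (by simp)
    have h1 := isBestFusion_best hg hw hnew
    obtain ⟨h2, h3⟩ := (mem_candidates hg hw hnew).1 h1.1
    obtain ⟨h4, h5, h6⟩ := hg.fuse hw hnew h2 h3
    rw [List.nodup_cons] at hP
    obtain ⟨r, h7, h8, h9⟩ := ih h4 hP.2 fun p hp => by
      obtain ⟨w', rfl, hw', hnew'⟩ := h p (List.mem_cons_of_mem _ hp)
      rw [h5]
      refine ⟨w', rfl, hw', fun v hv => ?_⟩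
      rcases (h6 w').1 ⟨v, hv⟩ with ⟨v', hv'⟩ | rfl
      · exact hnew' v' hv'
      · exact hP.1 hp
    exact ⟨r, h7, .step h1 h8, h9⟩

theorem fusionRun_fuse {P : List (Twig A)} (hP : P.Nodup) (h0 : P ≠ [])
    (h : ∀ p ∈ P, ∃ x, p = ofWord x.1 x.2 ∧ MinPath S.trees x) :
    ∃ r, fuse S.trees P = some r ∧ S.FusionRun none P (some r) ∧ Good S.trees r := by
  cases P with
  | nil => exact (h0 rfl).elim
  | cons p P =>
    obtain ⟨x, rfl, hx⟩ := h p (by simp)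
    rw [List.nodup_cons] at hP
    obtain ⟨r, h1, h2, h3⟩ := fusionRun_of_good (S := S) hx.good hP.2 fun p hp => by
      obtain ⟨y, rfl, hy⟩ := h p (List.mem_cons_of_mem _ hp)
      have hxy := hx.fst_eq S.trees_ne_nil hy
      refine ⟨y.2, by rw [← hxy]; rfl, by rw [rootLab_ofWord, hxy]; exact hy, fun v hv => ?_⟩
      obtain rfl : x = y := Prod.ext hxy (leafW_ofWord.1 hv).1.symm
      exact hP.1 hp
    refine ⟨r, ?_, .step (isBestFusion_none (consistent_iff.2 hx.consistent)) h2, h3⟩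
    change (P.foldl (fuseStep S.trees) [ofWord x.1 x.2]).head? = _
    rw [h1]
    rfl

end Sample

/-! ## Comparison of fusions by the sharing of nodes -/

open Code Twig

namespace Twig

variable {A : Type*}

theorem RawEmb.comp {p q r : Twig A} {F G : List ℕ → List ℕ} (hF : RawEmb p q F)
    (hG : RawEmb q r G) : RawEmb p r fun v => G (F v) where
  root := by rw [hF.root, hG.root]
  walk h := by
    obtain ⟨w', c', h1, h2⟩ := hF.walk h
    obtain ⟨w'', c'', h3, h4⟩ := hG.walk h1
    exact ⟨w'', c'', h3, h4.trans h2⟩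
  child h hi := by
    obtain ⟨j, w', c', k', h1, h2, h3⟩ := hF.child h hi
    rw [h3]
    exact hG.child h1 h2 |>.imp fun j ⟨w'', c'', k'', h⟩ => ⟨w'', c'', k'', h⟩
  below {v w c i e k} h hi := by
    obtain ⟨x, hx, h1⟩ := hF.below h hi
    obtain ⟨w', c', h2, -⟩ := hF.walk (h.snoc hi)
    rw [h1] at h2
    obtain ⟨w₁, w₂, m, -, h3, h4⟩ := h2.split
    obtain ⟨y, h5, h6⟩ := hG.length_le h3 h4
    refine ⟨y, ?_, by rw [h1, h5]⟩
    rintro rfl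
    exact hx (List.length_eq_zero_iff.1 (Nat.le_zero.1 h6))

variable {S : List (Twig A)} {g h : Twig A}

/-- The paths of `g` share only nodes that are shared by the paths of `h` with the same words. -/
def SharesLe (g h : Twig A) : Prop :=
  ∀ v₁ v₂ w₁ w₂ v₁' v₂' d, LeafW g v₁ w₁ → LeafW g v₂ w₂ → LeafW h v₁' w₁ → LeafW h v₂' w₂ →
    v₁.take d = v₂.take d → v₁'.take d = v₂'.take d

theorem SharesLe.trans {k : Twig A} (h1 : SharesLe g h) (h2 : SharesLe h k)
    (hw : ∀ v w, LeafW g v w → ∃ v', LeafW h v' w) : SharesLe g k := by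
  intro v₁ v₂ w₁ w₂ v₁' v₂' d h3 h4 h5 h6 h7
  obtain ⟨u₁, hu₁⟩ := hw _ _ h3
  obtain ⟨u₂, hu₂⟩ := hw _ _ h4
  exact h2 _ _ _ _ _ _ d hu₁ hu₂ h5 h6 (h1 _ _ _ _ _ _ d h3 h4 hu₁ hu₂ h7)

/-- Extend the image of the path `w` to a leaf of `h`. The word found there specializes `w` and both
are minimal, so they are equal and the leaf is `v'`. Embeddings do not shorten addresses; as the
total length is unchanged, every initial segment keeps its length and goes to that of `v'`. -/
theorem Good.take_of_rawEmb (hg : Good S g) (hh : Good S h) {F : List ℕ → List ℕ}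
    (hF : RawEmb g h F) (hroot : g.rootLab = h.rootLab) {v v' : List ℕ} {w : List (Step A)}
    (hv : LeafW g v w) (hv' : LeafW h v' w) (d : ℕ) : F (v.take d) = v'.take d := by
  obtain ⟨c, h1, hc⟩ := hv
  obtain ⟨u, m, h2, -⟩ := hF.walk h1
  have h3 : Exact w u := RawEmb.exact (s := []) (u := u) (c := m)
    (by rw [List.append_nil]; exact h1.rawEmb.comp hF)
    (by simpa [← h1.length_eq] using h2)
  obtain ⟨x, s, h4⟩ := exists_leafW m
  have h5 := h2.leafW h4
  have h6 := h3.pe (.nil s)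
  rw [List.append_nil] at h6
  have h7 : w = u ++ s := (Prod.ext_iff.1 ((hg.minPath _ _ ⟨c, h1, hc⟩).eq_of_match
    (y := (g.rootLab, u ++ s)) (by rw [hroot]; exact hh.minPath _ _ h5)
    (match_ofWord_ofWord.2 ⟨fun _ => rfl, h6⟩))).2
  have h8 := hh.inj _ _ _ hv' (by rw [h7]; exact h5)
  obtain ⟨m', h9, h10⟩ := h1.take d
  obtain ⟨y, h11, h12⟩ := hF.length_le (.nil g) h9
  obtain ⟨y', h13, h14⟩ := hF.length_le h9 h10
  rw [List.take_append_drop] at h13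
  rw [List.nil_append, hF.root, List.nil_append] at h11
  rw [h13, h11] at h8
  have h15 := hv'.length_eq
  have h16 := h1.length_eq
  rw [h8] at h15
  simp only [List.length_append, List.length_take, List.length_drop] at h12 h14 h15
  rw [h11, h8, List.append_assoc]
  rcases le_total d v.length with hd | hd
  · rw [List.take_append_of_le_length (by omega), List.take_of_length_le (by omega)]
  · have h17 : y' = [] := List.length_eq_zero_iff.1 (by omega)
    have h18 : x = [] := List.length_eq_zero_iff.1 (by omega)
    rw [h17, h18]
    simp only [List.append_nil]
    rw [List.take_of_length_le (by omega)]

theorem Good.sharesLe (hg : Good S g) (hh : Good S h) (hm : Match g h)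
    (hroot : g.rootLab = h.rootLab) : SharesLe g h := by
  obtain ⟨F, hF⟩ := hm.exists_rawEmb
  intro v₁ v₂ w₁ w₂ v₁' v₂' d h1 h2 h3 h4 h5
  rw [← hg.take_of_rawEmb hh hF hroot h1 h3, ← hg.take_of_rawEmb hh hF hroot h2 h4, h5]

open Classical in
/-- The map that sends the nodes of the paths of `g` to those of the paths of `h` with the same
words. -/
noncomputable def transfer (g h : Twig A) (v : List ℕ) : List ℕ :=
  if H : ∃ v', ∃ x w, LeafW g (v ++ x) w ∧ LeafW h v' w then H.choose.take v.length else []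

theorem SharesLe.transfer_eq (hs : SharesLe g h) {v v' x : List ℕ} {w : List (Step A)}
    (h1 : LeafW g (v ++ x) w) (h2 : LeafW h v' w) : transfer g h v = v'.take v.length := by
  have H : ∃ v', ∃ x w, LeafW g (v ++ x) w ∧ LeafW h v' w := ⟨v', x, w, h1, h2⟩
  rw [transfer, dif_pos H]
  obtain ⟨x', w', h3, h4⟩ := H.choose_spec
  exact hs _ _ _ _ _ _ v.length h3 h1 h4 h2 (by simp)

theorem SharesLe.walk_transfer (hs : SharesLe g h) (hw : ∀ v w, LeafW g v w → ∃ v', LeafW h v' w)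
    {v : List ℕ} {u : List (Step A)} {c : Twig A} (h1 : Walk g v u c) :
    ∃ m, Walk h (transfer g h v) u m ∧ ∀ i e k, c.kids[i]? = some (e, k) →
      ∃ j k', transfer g h (v ++ [i]) = transfer g h v ++ [j] ∧ m.kids[j]? = some (e, k') := by
  have key : ∀ {v u c}, Walk g v u c → ∃ x s v', LeafW g (v ++ x) (u ++ s) ∧ LeafW h v' (u ++ s) ∧
      ∃ m, Walk h (v'.take v.length) u m := by
    intro v u c h1
    obtain ⟨x, s, h2⟩ := exists_leafW c
    obtain ⟨v', m, h3, h4⟩ := hw _ _ (h1.leafW h2)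
    obtain ⟨m', h5, -⟩ := h3.take v.length
    rw [h1.length_eq, List.take_left, ← h1.length_eq] at h5
    exact ⟨x, s, v', h1.leafW h2, ⟨m, h3, h4⟩, m', h5⟩
  obtain ⟨x, s, v', h2, h3, m, h4⟩ := key h1
  rw [hs.transfer_eq h2 h3]
  refine ⟨m, h4, fun i e k hi => ?_⟩
  obtain ⟨x₁, s₁, v₁, h5, h6, m₁, h7⟩ := key (h1.snoc hi)
  have h8 := hs.transfer_eq h2 h3
  have h5' := h5
  rw [List.append_assoc] at h5'
  rw [hs.transfer_eq h5' h6] at h8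
  rw [hs.transfer_eq h5 h6, ← h8]
  rw [← h8] at h4
  have h9 : v.length < v₁.length := by
    have h10 := h5.length_eq
    have h11 := h6.length_eq
    rw [← h10] at h11
    simp only [List.length_append, List.length_singleton] at h11
    omega
  rw [List.length_append, List.length_singleton, List.take_succ_eq_append_getElem h9] at h7 ⊢
  obtain ⟨e', m₂, w', h12, h13, h14⟩ := walk_snoc.1 h7
  obtain ⟨-, rfl⟩ := h13.unique h4
  have h15 := (List.append_inj' h14 rfl).2
  simp only [List.cons.injEq, Prod.mk.injEq, and_true] at h15
  rw [h15.1]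
  exact ⟨_, m₁, rfl, h12⟩

/-- A node is sent to the node of the same depth on the path of `h` with the same word as some path
of `g` through it. The choice of the path does not matter, because nodes shared in `g` are shared in
`h`. -/
theorem SharesLe.match (hs : SharesLe g h) (hw : ∀ v w, LeafW g v w → ∃ v', LeafW h v' w)
    (hroot : g.rootLab = h.rootLab) : Match g h := by
  have hF : RawEmb g h (transfer g h) := by
    constructor
    · obtain ⟨v, w, h1⟩ := exists_leafW g
      obtain ⟨v', h2⟩ := hw v w h1
      exact hs.transfer_eq (x := v) h1 h2
    · intro v u c h1
      obtain ⟨m, h2, -⟩ := hs.walk_transfer hw h1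
      exact ⟨u, m, h2, fun _ => by rw [h2.rootLab_eq, h1.rootLab_eq, hroot]⟩
    · intro v u c i k h1 hi
      obtain ⟨m, h2, h3⟩ := hs.walk_transfer hw h1
      obtain ⟨j, k', h4, h5⟩ := h3 _ _ _ hi
      exact ⟨j, u, m, k', h2, h5, h4⟩
    · intro v u c i e k h1 hi
      obtain ⟨m, h2, h3⟩ := hs.walk_transfer hw h1
      obtain ⟨j, k', h4, h5⟩ := h3 _ _ _ hi
      exact ⟨[j], by simp, h4⟩
  have h1 : Walk h (transfer g h []) [] h := by
    rw [hF.root]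
    exact .nil h
  exact hF.match (.nil g) h1

theorem SharesLe.transfer_transfer (hs : SharesLe g h) (hs' : SharesLe h g)
    (hw : ∀ v w, LeafW g v w → ∃ v', LeafW h v' w) {v : List ℕ} {u : List (Step A)} {c : Twig A}
    (h1 : Walk g v u c) : transfer h g (transfer g h v) = v := by
  obtain ⟨x, s, h2⟩ := exists_leafW c
  obtain ⟨v', h3⟩ := hw _ _ (h1.leafW h2)
  rw [hs.transfer_eq (h1.leafW h2) h3]
  have h4 : LeafW h (v'.take v.length ++ v'.drop v.length) (u ++ s) := by
    rwa [List.take_append_drop]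
  rw [hs'.transfer_eq h4 (h1.leafW h2)]
  have h5 := h3.length_eq
  have h6 := (h1.leafW h2).length_eq
  rw [← h6, List.length_append] at h5
  rw [List.length_take, min_eq_left (by omega), List.take_left]

/-- With equal sharing the two transfer maps are inverse to each other, and both respect edges and
labels. -/
theorem SharesLe.iso (hs : SharesLe g h) (hs' : SharesLe h g)
    (hw : ∀ w, (∃ v, LeafW g v w) ↔ ∃ v, LeafW h v w) (hroot : g.rootLab = h.rootLab) :
    g ≅ₜ h := by
  have hw1 : ∀ v w, LeafW g v w → ∃ v', LeafW h v' w := fun v w hv => (hw w).1 ⟨v, hv⟩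
  have hw2 : ∀ v w, LeafW h v w → ∃ v', LeafW g v' w := fun v w hv => (hw w).2 ⟨v, hv⟩
  have hval : ∀ {g h : Twig A} (hs : SharesLe g h) (hw : ∀ v w, LeafW g v w → ∃ v', LeafW h v' w)
      (v : g.Node), (h.at? (transfer g h v.1)).isSome := by
    intro g h hs hw v
    obtain ⟨w, h1⟩ := walk_sub v
    obtain ⟨m, h2, -⟩ := hs.walk_transfer hw h1
    rw [at?_eq_some.2 ⟨_, h2⟩]
    rfl
  have hedge : ∀ {g h : Twig A} (hs : SharesLe g h) (hw : ∀ v w, LeafW g v w → ∃ v', LeafW h v' w)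
      (e : Edge) (v w : g.Node), g.HasEdge e v w →
      h.HasEdge e ⟨transfer g h v.1, hval hs hw v⟩ ⟨transfer g h w.1, hval hs hw w⟩ := by
    rintro g h hs hw e v w ⟨i, c, h1, h2⟩
    obtain ⟨u, h3⟩ := walk_sub v
    obtain ⟨m, h4, h5⟩ := hs.walk_transfer hw h3
    obtain ⟨j, k', h6, h7⟩ := h5 _ _ _ h2
    refine ⟨j, k', by simp only [h1, h6], ?_⟩
    have h8 : h.sub ⟨transfer g h v.1, hval hs hw v⟩ = m :=
      Walk.sub_eq (n := ⟨transfer g h v.1, hval hs hw v⟩) h4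
    rwa [h8]
  have hinv : ∀ {g h : Twig A} (hs : SharesLe g h) (hs' : SharesLe h g)
      (hw : ∀ v w, LeafW g v w → ∃ v', LeafW h v' w) (v : g.Node),
      transfer h g (transfer g h v.1) = v.1 := by
    intro g h hs hs' hw v
    obtain ⟨w, h1⟩ := walk_sub v
    exact hs.transfer_transfer hs' hw h1
  let f : g.Node ≃ h.Node :=
    { toFun := fun v => ⟨transfer g h v.1, hval hs hw1 v⟩
      invFun := fun v => ⟨transfer h g v.1, hval hs' hw2 v⟩
      left_inv := fun v => Subtype.ext (hinv hs hs' hw1 v)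
      right_inv := fun v => Subtype.ext (hinv hs' hs hw2 v) }
  refine ⟨f, Subtype.ext ?_, fun v => ?_, fun e v w => ⟨hedge hs hw1 e v w, fun H => ?_⟩⟩
  · obtain ⟨v, w, h1⟩ := exists_leafW g
    obtain ⟨v', h2⟩ := hw1 v w h1
    exact hs.transfer_eq (v := []) (x := v) h1 h2
  · obtain ⟨w, h1⟩ := walk_sub v
    obtain ⟨m, h2, -⟩ := hs.walk_transfer hw1 h1
    have h8 : h.sub (f v) = m := Walk.sub_eq (n := f v) h2
    rw [lab, lab, h8, h2.rootLab_eq, h1.rootLab_eq, hroot]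
  · have h1 := hedge hs' hw2 e _ _ H
    have h2 : ∀ v : g.Node, (⟨transfer h g (f v).1, hval hs' hw2 (f v)⟩ : g.Node) = v :=
      fun v => f.left_inv v
    rwa [h2, h2] at h1

theorem SharesLe.iff_take (hs : SharesLe g h) (hs' : SharesLe h g) {v₁ v₂ v₁' v₂' : List ℕ}
    {w₁ w₂ : List (Step A)} (h1 : LeafW g v₁ w₁) (h2 : LeafW g v₂ w₂) (h3 : LeafW h v₁' w₁)
    (h4 : LeafW h v₂' w₂) (d : ℕ) : v₁.take d = v₂.take d ↔ v₁'.take d = v₂'.take d :=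
  ⟨hs _ _ _ _ _ _ d h1 h2 h3 h4, hs' _ _ _ _ _ _ d h3 h4 h1 h2⟩

end Twig

/-! ## Fusions with respect to a characteristic sample -/

open Code Twig

namespace Twig

variable {A : Type*}

theorem Iso.refl (q : Twig A) : q ≅ₜ q := ⟨Equiv.refl _, rfl, fun _ => rfl, fun _ _ _ => Iff.rfl⟩

theorem LeafW.eq_nil_of_append {q : Twig A} {v x : List ℕ} {w w' : List (Step A)}
    (h : LeafW q v w) (h' : LeafW q (v ++ x) w') : x = [] := by
  obtain ⟨c, h1, h2⟩ := h
  obtain ⟨c', h3, -⟩ := h'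
  obtain ⟨w₁, w₂, m, -, h4, h5⟩ := h3.split
  obtain ⟨-, rfl⟩ := h4.unique h1
  cases h5 with
  | nil => rfl
  | cons h6 _ => simp [h2] at h6

theorem ofWord_inj {l l' : Option A} {w w' : List (Step A)} (h : ofWord l w = ofWord l' w') :
    l = l' ∧ w = w' := by
  have h1 : LeafW (ofWord l w) _ w := leafW_ofWord.2 ⟨rfl, rfl⟩
  have h2 := congrArg rootLab h
  rw [h] at h1
  exact ⟨h2, (leafW_ofWord.1 h1).1⟩

/-- Follows from composition of embeddings of path queries; wildcards at the roots remove the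
condition on root labels. -/
theorem PE.trans {u v w : List (Step A)} (h : PE u v) (h' : PE v w) : PE u w :=
  (match_ofWord_ofWord.1 ((match_ofWord_ofWord.2 ⟨fun h => (h rfl).elim, h⟩).trans
    (match_ofWord_ofWord.2 ⟨fun h => (h rfl).elim, h'⟩) :
      Match (ofWord none u) (ofWord none w))).2

variable {S : List (Twig A)} {g q : Twig A}

/-- Attach the new path at the deepest node that its counterpart `v'` in `q` shares with a path
already present in `g`. It then separates from each old path at the same depth as in `q`. -/
theorem Good.exists_shares (hq : Good S q) (hsub : ∀ v w, LeafW g v w → ∃ v', LeafW q v' w) (h1 : SharesLe g q) (h2 : SharesLe q g)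
    {v' : List ℕ} {w : List (Step A)} (hv' : LeafW q v' w) (hnew : ∀ v, ¬ LeafW g v w) :
    ∃ r ∈ cands (ofWord q.rootLab w) g, SharesLe r q ∧ SharesLe q r := by
  classical
  let P : ℕ → Prop := fun d => ∃ l l' w₁, LeafW g l w₁ ∧ LeafW q l' w₁ ∧ l'.take d = v'.take d
  have hP0 : P 0 := by
    obtain ⟨l, w₁, hl⟩ := exists_leafW g
    obtain ⟨l', hl'⟩ := hsub _ _ hl
    exact ⟨l, l', w₁, hl, hl', rfl⟩
  -- `d` is the greatest depth at which `v'` agrees with the counterpart of an old path, realized by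
  -- `l` in `g` and `l'` in `q`. As no leaf lies below another one, both `v'` and `l'` continue
  -- beyond `d`.
  obtain ⟨d, hd⟩ : ∃ d, d = Nat.findGreatest P v'.length := ⟨_, rfl⟩
  have hmax : ∀ e, d < e → e ≤ v'.length → ¬ P e := fun e he he' =>
    Nat.findGreatest_is_greatest (hd ▸ he) he'
  have hle : d ≤ v'.length := hd ▸ Nat.findGreatest_le _
  obtain ⟨l, l', w₁, hl, hl', hdl⟩ : P d := hd ▸ Nat.findGreatest_spec (Nat.zero_le _) hP0
  have hne : ∀ x, v' ≠ l' ++ x := by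
    rintro x rfl
    obtain rfl := hl'.eq_nil_of_append hv'
    rw [List.append_nil] at hv'
    exact hnew l (hv'.unique hl' ▸ hl)
  have hne' : ∀ x, l' ≠ v' ++ x := by
    rintro x rfl
    obtain rfl := hv'.eq_nil_of_append hl'
    exact hne [] (by simp)
  have hd1 : d < v'.length := by
    refine lt_of_le_of_ne hle fun h => hne' (l'.drop d) ?_
    rw [h, List.take_length] at hdl
    rw [h]
    conv_lhs => rw [← List.take_append_drop v'.length l', hdl]
  have hd2 : d < l'.length := by
    by_contra hd2
    refine hne (v'.drop d) ?_
    conv_lhs => rw [← List.take_append_drop d v', ← hdl, List.take_of_length_le (not_lt.1 hd2)]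
  have hlen : l.length = l'.length := by rw [hl.length_eq, hl'.length_eq]
  obtain ⟨cg, hcg, -⟩ := id hl
  obtain ⟨cq, hcq, -⟩ := id hl'
  obtain ⟨cv, hcv, -⟩ := id hv'
  obtain ⟨c, h3, h4⟩ := hcg.take d
  obtain ⟨m, h5, -⟩ := hcq.take d
  obtain ⟨m', h6, -⟩ := hcv.take d
  rw [hdl] at h5
  obtain ⟨h7, -⟩ := h5.unique h6
  rw [h7] at h3
  have hc : c.kids ≠ [] := by
    intro hc
    have hdrop : l.drop d ≠ [] := by
      rw [Ne, List.drop_eq_nil_iff]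
      omega
    generalize l.drop d = y at hdrop h4
    generalize w₁.drop d = y' at h4
    cases h4 with
    | nil => exact hdrop rfl
    | cons h _ => simp [hc] at h
  have hwd : d < w.length := by rwa [← hcv.length_eq]
  obtain ⟨x, s, hxs⟩ : ∃ x s, w.drop d = x :: s := ⟨_, _, List.drop_eq_getElem_cons hwd⟩
  have hw : w = w.take d ++ x :: s := by rw [← hxs, List.take_append_drop]
  have hleaf := fun {v₁ w₁} => h3.leafW_attach hc (x := x) (s := s) (v' := v₁) (w := w₁)
  rw [← hw] at hleaf
  have hld : (l.take d).length = d := by simp; omega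
  -- Up to depth `d` the new path runs along `l`, where the sharing is known. Beyond it, no old path
  -- uses the new child with the index `c.kids.length`, and none agrees with `v'` in `q` by the
  -- maximality of `d`.
  have key : ∀ l₂ w₂ l₂' e, LeafW g l₂ w₂ → LeafW q l₂' w₂ →
      (l₂.take e = (l.take d ++ c.kids.length :: List.replicate s.length 0).take e ↔
        l₂'.take e = v'.take e) := by
    intro l₂ w₂ l₂' e h8 h9
    rcases le_or_gt e d with he | he
    · rw [List.take_append_of_le_length (by omega), List.take_take, min_eq_left he,
        h1.iff_take h2 h8 hl h9 hl' e]
      have : l'.take e = v'.take e := by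
        have := congrArg (List.take e) hdl
        rwa [List.take_take, List.take_take, min_eq_left he] at this
      rw [this]
    · refine iff_of_false (fun h => ?_) fun h => ?_
      · have h10 := congrArg (List.take (d + 1)) h
        rw [List.take_take, List.take_take, min_eq_left (by omega), List.take_append, hld,
          Nat.add_sub_cancel_left, List.take_succ_cons, List.take_zero,
          List.take_of_length_le (l := l.take d) (by omega)] at h10
        obtain ⟨c₂, h11, -⟩ := h8
        obtain ⟨m₂, h12, -⟩ := h11.take (d + 1)
        rw [h10] at h12
        obtain ⟨e', m₃, w₃, h13, h14, -⟩ := walk_snoc.1 h12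
        obtain ⟨-, rfl⟩ := h14.unique h3
        simp at h13
      · refine hmax (min e v'.length) (by omega) (min_le_right _ _) ⟨l₂, l₂', w₂, h8, h9, ?_⟩
        have := congrArg (List.take (min e v'.length)) h
        rwa [List.take_take, List.take_take, min_eq_left (min_le_left _ _)] at this
  have hiff : ∀ v₁ v₂ w₁ w₂ v₁' v₂' e, LeafW (g.attach (l.take d) (tail (x :: s))) v₁ w₁ →
      LeafW (g.attach (l.take d) (tail (x :: s))) v₂ w₂ → LeafW q v₁' w₁ → LeafW q v₂' w₂ →
      (v₁.take e = v₂.take e ↔ v₁'.take e = v₂'.take e) := by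
    intro v₁ v₂ w₁ w₂ v₁' v₂' e h8 h9 h10 h11
    rcases hleaf.1 h8 with h8 | ⟨rfl, rfl⟩
    · rcases hleaf.1 h9 with h9 | ⟨rfl, rfl⟩
      · exact h1.iff_take h2 h8 h9 h10 h11 e
      · obtain rfl := hq.inj _ _ _ h11 hv'
        exact key _ _ _ e h8 h10
    · obtain rfl := hq.inj _ _ _ h10 hv'
      rcases hleaf.1 h9 with h9 | ⟨rfl, rfl⟩
      · rw [eq_comm, key _ _ _ e h9 h11, eq_comm]
      · obtain rfl := hq.inj _ _ _ h11 hv'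
        simp
  refine ⟨g.attach (l.take d) (tail (x :: s)), ?_,
    fun v₁ v₂ w₁ w₂ v₁' v₂' e h8 h9 h10 h11 => (hiff _ _ _ _ _ _ e h8 h9 h10 h11).1,
    fun v₁ v₂ w₁ w₂ v₁' v₂' e h8 h9 h10 h11 => (hiff _ _ _ _ _ _ e h10 h11 h8 h9).2⟩
  exact Twig.mem_cands.2 ⟨_, w.take d, ofWord _ (x :: s), _, c, walk_ofWord.2 ⟨_, hw, rfl, rfl⟩, h3,
    by simp, hc, rfl⟩

/-- Properties of the trees in samples that are sufficient for the identification of `q`. -/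
structure Characterizes (S : List (Twig A)) (q : Twig A) : Prop where
  anch : Anchored true q
  inj : ∀ v w v' w', LeafW q v w → LeafW q v' w' → PE w w' → v = v'
  consistent : ∀ t ∈ S, Match q t
  complete : ∀ p, Anchored true p → (∀ t ∈ S, Match p t) → Match p q

/-- A consistent specialization of a path of `q` embeds in some path of `q`; by incomparability it
is the same path, so the paths are minimal. Conversely a minimal path query embeds in one of these
minimal paths and therefore equals it. -/
theorem Characterizes.minPath_iff (h : Characterizes S q) {x : Option A × List (Step A)} :
    MinPath S x ↔ x.1 = q.rootLab ∧ ∃ v, LeafW q v x.2 := by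
  have key : ∀ v w, LeafW q v w → MinPath S (q.rootLab, w) := by
    intro v w hw
    refine ⟨h.anch v w hw, fun t ht => hw.match.trans (h.consistent t ht), fun l' w' ha hc hl hw' => ?_⟩
    obtain ⟨h1, v'', w'', h2, h3⟩ := match_ofWord.1 (h.complete _ (anchored_ofWord ha) hc)
    have h4 := h.inj _ _ _ _ hw h2 (PE.trans hw' h3)
    subst h4
    obtain rfl := hw.unique h2
    exact ⟨h1.antisymm hl |>.symm, h3.antisymm hw'⟩
  constructor
  · intro hx
    obtain ⟨h1, v, w, h2, h3⟩ := match_ofWord.1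
      (h.complete _ (anchored_ofWord hx.anch) hx.consistent)
    have h4 := hx.eq_of_match (key v w h2) (match_ofWord_ofWord.2 ⟨h1, h3⟩)
    rw [h4]
    exact ⟨rfl, v, h2⟩
  · rintro ⟨h1, v, h2⟩
    have := key v _ h2
    rwa [← h1] at this

theorem Characterizes.good (h : Characterizes S q) : Good S q where
  minPath v _ hw := h.minPath_iff.2 ⟨rfl, v, hw⟩
  inj v v' w hw hw' := h.inj v w v' w hw hw' (.refl _)
  consistent := h.consistent

theorem Good.anchored (h : Good S g) : Anchored true g := fun v w hw => (h.minPath v w hw).anch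

theorem Characterizes.exists_leafW (h : Characterizes S q) (hg : Good S g) (v : List ℕ)
    (w : List (Step A)) (hw : LeafW g v w) : ∃ v', LeafW q v' w :=
  (h.minPath_iff.1 (hg.minPath v w hw)).2

end Twig

namespace Sample

variable {A : Type*} {S : Sample A} {q : Twig A}

/-- The fusion of the path queries `W` shares the same nodes as `q`. -/
def Faithful (S : Sample A) (q : Twig A) (W : List (Twig A)) : Option (Twig A) → Prop
  | none => W = []
  | some g => Good S.trees g ∧ g.rootLab = q.rootLab ∧ SharesLe g q ∧ SharesLe q g ∧
      ∀ w, (∃ v, LeafW g v w) ↔ ofWord q.rootLab w ∈ W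

/-- Every consistent fusion is good and embeds in `q`, so it shares no more nodes than `q`. The
fusion `r` of `Good.exists_shares` shares as many as `q` and is consistent because it embeds in `q`.
Hence `r` is least for `≼`, and every minimal fusion has the same sharing and is isomorphic to it.
-/
theorem Faithful.step (hq : Characterizes S.trees q) {W : List (Twig A)} {st : Option (Twig A)}
    (h : Faithful S q W st) {p : Twig A} (hp : p ∈ q.paths) (hW : p ∉ W) :
    ∃ r, S.IsBestFusion p st r ∧ ∀ r', S.IsBestFusion p st r' →
      r' ≅ₜ r ∧ Faithful S q (W ++ [p]) (some r') := by
  obtain ⟨v', w, hv', rfl⟩ := mem_paths.1 hp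
  have hw : MinPath S.trees (q.rootLab, w) := hq.good.minPath v' w hv'
  cases st with
  | none =>
    obtain rfl : W = [] := h
    refine ⟨_, isBestFusion_none (consistent_iff.2 hw.consistent), fun r hr => ?_⟩
    obtain rfl : r = ofWord q.rootLab w := hr.1.1
    refine ⟨.refl _, hw.good, rfl, ?_, ?_, fun w' => ?_⟩
    · intro v₁ v₂ w₁ w₂ v₁' v₂' d h1 h2 h3 h4 _
      rw [(leafW_ofWord.1 h1).1] at h3
      rw [(leafW_ofWord.1 h2).1] at h4
      rw [hq.good.inj _ _ _ h3 h4]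
    · intro v₁ v₂ w₁ w₂ v₁' v₂' d _ _ h3 h4 _
      rw [(leafW_ofWord.1 h3).2, (leafW_ofWord.1 h4).2]
    · rw [List.nil_append, List.mem_singleton]
      constructor
      · rintro ⟨v, h⟩
        rw [(leafW_ofWord.1 h).1]
      · intro h
        rw [← (ofWord_inj h).2]
        exact ⟨_, leafW_ofWord.2 ⟨rfl, rfl⟩⟩
  | some g =>
    obtain ⟨hg, hroot, h1, h2, hWg⟩ := h
    have hnew : ∀ v, ¬ LeafW g v w := fun v hv => hW ((hWg w).1 ⟨v, hv⟩)
    have hw' := hw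
    rw [← hroot] at hw'
    obtain ⟨r, hr, hr1, hr2⟩ := hq.good.exists_shares (hq.exists_leafW hg) h1 h2 hv' hnew
    have hcand := fun {r} => mem_candidates (r := r) hg hw' hnew
    rw [hroot] at hcand
    have hrw : ∀ v w', LeafW r v w' → ∃ v', LeafW q v' w' := by
      intro v w' hv
      rw [← hroot] at hr
      obtain ⟨v₁, u, c, x, s, h3, h4, h5, rfl⟩ := Good.exists_attach hr
      rcases (h3.leafW_attach h4).1 hv with h6 | ⟨-, rfl⟩
      · exact hq.exists_leafW hg _ _ h6
      · exact ⟨v', by rwa [h5] at hv'⟩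
    have hrr : r.rootLab = q.rootLab := by
      rw [← hroot] at hr
      obtain ⟨v₁, u, c, x, s, h3, h4, h5, rfl⟩ := Good.exists_attach hr
      rw [rootLab_attach, hroot]
    have hrq : Match r q := hr1.match hrw hrr
    have hrc : ∀ t ∈ S.trees, Match r t := fun t ht => hrq.trans (hq.consistent t ht)
    have hfuse : ∀ r', r' ∈ S.Candidates (ofWord q.rootLab w) (some g) → Good S.trees r' ∧
        r'.rootLab = q.rootLab ∧ (∀ w', (∃ v, LeafW r' v w') ↔ (∃ v, LeafW g v w') ∨ w' = w) ∧
        SharesLe r' q := by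
      intro r' h
      obtain ⟨h3, h4⟩ := hcand.1 h
      rw [← hroot] at h3
      obtain ⟨h5, h6, h7⟩ := hg.fuse hw' hnew h3 h4
      exact ⟨h5, h6.trans hroot, h7, h5.sharesLe hq.good (hq.complete _ h5.anchored h4)
        (h6.trans hroot)⟩
    have hrcand := hcand.2 ⟨hr, hrc⟩
    obtain ⟨hr3, -, hr4, -⟩ := hfuse r hrcand
    have hwords : ∀ {r'}, r' ∈ S.Candidates (ofWord q.rootLab w) (some g) →
        ∀ w', (∃ v, LeafW r' v w') ↔ ∃ v, LeafW r v w' := fun h w' => by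
      rw [hr4, (hfuse _ h).2.2.1]
    have hle : ∀ r', r' ∈ S.Candidates (ofWord q.rootLab w) (some g) → SharesLe r' r := fun r' h =>
      (hfuse r' h).2.2.2.trans hr2 (hq.exists_leafW (hfuse r' h).1)
    have hmin : ∀ r', r' ∈ S.Candidates (ofWord q.rootLab w) (some g) → r ≼ r' := fun r' h =>
      subsumed_iff.2 ((hle r' h).match (fun v w' hv => (hwords h w').1 ⟨v, hv⟩)
        ((hfuse r' h).2.1.trans hrr.symm))
    refine ⟨r, ⟨hrcand, fun r' h _ => hmin r' h⟩, fun r' h => ?_⟩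
    obtain ⟨hg', hroot', hwg', hs'⟩ := hfuse r' h.1
    have h3 : r' ≼ r := h.2 r hrcand (hmin r' h.1)
    have h4 : SharesLe r r' := hr3.sharesLe hg' (subsumed_iff.1 h3) (hrr.trans hroot'.symm)
    refine ⟨(hle r' h.1).iso h4 (hwords h.1) (hroot'.trans hrr.symm), hg', hroot', hs', ?_,
      fun w' => ?_⟩
    · intro v₁ v₂ w₁ w₂ v₁' v₂' d h5 h6 h7 h8 h9
      obtain ⟨x₁, hx₁⟩ := (hwords h.1 _).1 ⟨_, h7⟩
      obtain ⟨x₂, hx₂⟩ := (hwords h.1 _).1 ⟨_, h8⟩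
      exact h4 _ _ _ _ _ _ d hx₁ hx₂ h7 h8 (hr2 _ _ _ _ _ _ d h5 h6 hx₁ hx₂ h9)
    · rw [hwg', hWg, List.mem_append, List.mem_singleton]
      refine or_congr Iff.rfl ⟨fun h => by rw [h], fun h => (ofWord_inj h).2⟩

theorem Faithful.run (hq : Characterizes S.trees q) {st r : Option (Twig A)} {P : List (Twig A)}
    (hr : S.FusionRun st P r) {W : List (Twig A)} (h : Faithful S q W st) (hP : (W ++ P).Nodup)
    (hPq : ∀ p ∈ P, p ∈ q.paths) : Faithful S q (W ++ P) r := by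
  induction hr generalizing W with
  | done => rwa [List.append_nil]
  | @step st p q' P r h1 _ ih =>
    have h2 : W ++ p :: P = (W ++ [p]) ++ P := by simp
    have h3 : p ∉ W := fun hp => by
      rw [List.nodup_append] at hP
      exact hP.2.2 p hp p (by simp) rfl
    obtain ⟨r₀, -, h4⟩ := h.step hq (hPq p (by simp)) h3
    rw [h2] at hP ⊢
    exact ih (h4 _ h1).2 hP fun p hp => hPq p (List.mem_cons_of_mem _ hp)

theorem Faithful.iso (hq : Characterizes S.trees q) {r : Option (Twig A)} {P : List (Twig A)}
    (h : Faithful S q P r) (hP : ∀ p, p ∈ P ↔ p ∈ q.paths) : ∃ q', r = some q' ∧ q' ≅ₜ q := by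
  cases r with
  | none =>
    obtain rfl : P = [] := h
    obtain ⟨v, w, hv⟩ := Twig.exists_leafW q
    exact absurd ((hP _).2 (mem_paths.2 ⟨v, w, hv, rfl⟩)) (by simp)
  | some g =>
    obtain ⟨hg, hroot, h1, h2, h3⟩ := h
    refine ⟨g, rfl, h1.iso h2 (fun w => ?_) hroot⟩
    rw [h3, hP, mem_paths]
    constructor
    · rintro ⟨v, w', hv, h⟩
      exact ⟨v, (ofWord_inj h).2 ▸ hv⟩
    · rintro ⟨v, hv⟩
      exact ⟨v, w, hv, rfl⟩

end Sample

/-! ## Characteristic samples -/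

open Code Twig

namespace Twig

variable {A : Type*}

/-- The words of the canonical trees of path queries. -/
def canonWord (k : ℕ) (z : A) : List (Step A) → List (Step A)
  | [] => []
  | (.child, l) :: w => (.child, some (l.getD z)) :: canonWord k z w
  | (.desc, l) :: w =>
    List.replicate k (.child, some z) ++ (.child, some (l.getD z)) :: canonWord k z w

variable {k : ℕ} {z : A}

theorem chain_ofWord (l : Option A) (w : List (Step A)) (n : ℕ) :
    [(Edge.child, chain z (ofWord l w) n)] =
      tail (List.replicate n (.child, some z) ++ (.child, l) :: w) := by
  induction n with
  | zero => rfl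
  | succ n ih =>
    rw [chain, ih]
    rfl

theorem canon_ofWord (l : Option A) (w : List (Step A)) :
    canon k z (ofWord l w) = ofWord (some (l.getD z)) (canonWord k z w) := by
  induction w generalizing l with
  | nil => rfl
  | cons x w ih =>
    obtain ⟨e, l'⟩ := x
    change canon k z (node l [(e, ofWord l' w)]) = _
    rw [canon_node, List.map_singleton, ih]
    cases e with
    | child => rfl
    | desc =>
      simp only [stretch, chain_ofWord]
      rfl

theorem exists_leafW_cons {q : Twig A} {s : List (Step A)} :
    (∃ v, LeafW q v s) ↔ q.kids = [] ∧ s = [] ∨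
      ∃ e c, (e, c) ∈ q.kids ∧ ∃ v s', LeafW c v s' ∧ s = (e, c.rootLab) :: s' := by
  constructor
  · rintro ⟨v, h⟩
    cases v with
    | nil => exact .inl (leafW_nil.1 h).symm
    | cons i v =>
      obtain ⟨e, c, s', h1, h2, rfl⟩ := leafW_cons.1 h
      exact .inr ⟨e, c, List.mem_of_getElem? h1, v, s', h2, rfl⟩
  · rintro (h | ⟨e, c, h1, v, s', h2, rfl⟩)
    · exact ⟨[], leafW_nil.2 h.symm⟩
    · obtain ⟨i, hi⟩ := List.getElem?_of_mem h1
      exact ⟨_, leafW_cons.2 ⟨e, c, s', hi, h2, rfl⟩⟩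

theorem leafW_chain {t : Twig A} {n : ℕ} {s : List (Step A)} :
    (∃ v s', LeafW (chain z t n) v s' ∧ s = (.child, (chain z t n).rootLab) :: s') ↔
      ∃ v s', LeafW t v s' ∧ s = List.replicate n (.child, some z) ++ (.child, t.rootLab) :: s' := by
  induction n generalizing s with
  | zero => rfl
  | succ n ih =>
    have h : ∀ s', (∃ v, LeafW (chain z t (n + 1)) v s') ↔
        ∃ v s'', LeafW (chain z t n) v s'' ∧ s' = (.child, (chain z t n).rootLab) :: s'' := by
      intro s'
      rw [exists_leafW_cons]
      simp [chain, kids]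
    constructor
    · rintro ⟨v, s', h1, rfl⟩
      obtain ⟨v', s'', h2, rfl⟩ := ih.1 ((h s').1 ⟨v, h1⟩)
      exact ⟨v', s'', h2, rfl⟩
    · rintro ⟨v, s', h1, rfl⟩
      obtain ⟨v', h2⟩ := (h _).2 (ih.2 ⟨v, s', h1, rfl⟩)
      exact ⟨v', _, h2, rfl⟩

/-- The chains do not branch, so the root-to-leaf words of the canonical tree are obtained by
translating those of `q` one by one. -/
theorem leafW_canon {q : Twig A} {s : List (Step A)} :
    (∃ v, LeafW (canon k z q) v s) ↔ ∃ v w, LeafW q v w ∧ s = canonWord k z w := by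
  induction q using ind generalizing s with
  | h l ks ih =>
    have h1 : ∀ e c, (e, c) ∈ ks → ∀ s,
        ((∃ v s', LeafW (stretch k z e (canon k z c)) v s' ∧
          s = (.child, (stretch k z e (canon k z c)).rootLab) :: s') ↔
        ∃ v w, LeafW c v w ∧ s = canonWord k z ((e, c.rootLab) :: w)) := by
      intro e c hc s
      have h2 : ∀ (f : List (Step A) → List (Step A)), (∃ v s', LeafW (canon k z c) v s' ∧ s = f s') ↔
          ∃ v w, LeafW c v w ∧ s = f (canonWord k z w) := by
        intro f
        constructor
        · rintro ⟨v, s', h, rfl⟩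
          obtain ⟨v', w, h', rfl⟩ := (ih _ hc).1 ⟨v, h⟩
          exact ⟨v', w, h', rfl⟩
        · rintro ⟨v, w, h, rfl⟩
          obtain ⟨v', h'⟩ := (ih _ hc).2 ⟨v, w, h, rfl⟩
          exact ⟨v', _, h', rfl⟩
      cases e with
      | child =>
        simp only [stretch, canonWord, h2, rootLab_canon]
      | desc =>
        simp only [stretch, canonWord, leafW_chain, rootLab_canon]
        exact h2 fun s' => List.replicate k (.child, some z) ++
          (.child, some (c.rootLab.getD z)) :: s'
    rw [exists_leafW_cons, canon_node]
    constructor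
    · rintro (⟨h2, rfl⟩ | ⟨e, c, h2, h3⟩)
      · refine ⟨[], [], leafW_nil.2 ⟨rfl, ?_⟩, rfl⟩
        simpa [kids] using h2
      · obtain ⟨⟨e', c'⟩, h4, h5⟩ := List.mem_map.1 h2
        cases h5
        obtain ⟨v, w, h6, rfl⟩ := (h1 e' c' h4 s).1 h3
        obtain ⟨i, hi⟩ := List.getElem?_of_mem h4
        exact ⟨_, _, leafW_cons.2 ⟨e', c', w, hi, h6, rfl⟩, rfl⟩
    · rintro ⟨v, w, h2, rfl⟩
      cases v with
      | nil =>
        obtain ⟨rfl, h3⟩ := leafW_nil.1 h2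
        exact .inl ⟨by simpa [kids] using h3, rfl⟩
      | cons i v =>
        obtain ⟨e, c, w', hi, h3, rfl⟩ := leafW_cons.1 h2
        have h4 := List.mem_of_getElem? hi
        exact .inr ⟨_, _, List.mem_map.2 ⟨_, h4, rfl⟩, (h1 e c h4 _).2 ⟨v, w', h3, rfl⟩⟩

end Twig

namespace Sample

variable {A : Type*} {q : Twig A} {z z' : A}

/-- A characteristic sample, for two different labels `z` and `z'` of which `z` is not in `q`. -/
def charSample (q : Twig A) (z z' : A) : Sample A :=
  ⟨[⟨canon 0 z' q, isTree_canon q⟩, ⟨canon q.size z q, isTree_canon q⟩], by simp⟩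

theorem size_charSample_le : (charSample q z z').size ≤ q.size + (q.size + 1) * q.size := by
  have h1 := size_canon_le (k := 0) (z := z') q
  have h2 := size_canon_le (k := q.size) (z := z) q
  simp only [charSample, size, List.map_cons, List.map_nil, List.sum_cons, List.sum_nil]
  omega

theorem charSample_consistent : (charSample q z z').Consistent q := by
  intro t ht
  simp only [charSample, List.mem_cons, List.not_mem_nil, or_false] at ht
  rcases ht with rfl | rfl <;> exact subsumed_iff.2 (match_canon q)

variable {S : Sample A}

theorem Extends.exists_mem (h : S.Extends (charSample q z z')) :
    (∃ t ∈ S.trees, Match t (canon 0 z' q) ∧ Match (canon 0 z' q) t) ∧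
      ∃ t ∈ S.trees, Match t (canon q.size z q) ∧ Match (canon q.size z q) t := by
  have key : ∀ t ∈ (charSample q z z').1, ∃ t' ∈ S.trees, Match t' t.1 ∧ Match t.1 t' := by
    intro t ht
    obtain ⟨t', h1, h2⟩ := h t ht
    exact ⟨_, List.mem_map.2 ⟨t', h1, rfl⟩, subsumed_iff.1 h2.symm.subsumed,
      subsumed_iff.1 h2.subsumed⟩
  exact ⟨key ⟨canon 0 z' q, isTree_canon q⟩ (by simp [charSample]),
    key ⟨canon q.size z q, isTree_canon q⟩ (by simp [charSample])⟩

theorem characterizes [Infinite A] (hq : q.IsPsf) (hzz : z ≠ z')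
    (hz : ∀ v w c, Walk q v w c → c.rootLab ≠ some z) (h : S.Extends (charSample q z z'))
    (hS : S.Consistent q) : Characterizes S.trees q where
  anch v w hw := isAnchoredPath_ofWord.1 (hq.anchored _ (mem_paths.2 ⟨v, w, hw, rfl⟩))
  inj v w v' w' hw hw' hp := by
    by_contra hne
    refine reduced_paths_iff.1 hq.reduced v' w' v w hw' hw (Ne.symm hne) ((contained_iff ?_).2
      (match_ofWord_ofWord.2 ⟨fun _ => rfl, hp⟩))
    exact anchored_ofWord (isAnchoredPath_ofWord.1 (hq.anchored _ (mem_paths.2 ⟨v, w, hw, rfl⟩)))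
  consistent := consistent_iff.1 hS
  complete p ha hp := by
    obtain ⟨⟨t, h1, h2, -⟩, t', h3, h4, -⟩ := h.exists_mem
    exact Match.of_canons ha ((hp t h1).trans h2) ((hp t' h3).trans h4) hzz hz

/-- The tree `t` of the sample that is equivalent to the canonical tree has a path that is literally
the canonical word of `w`. Started from it, the first greedy run can only end in `w`, since every
consistent anchored path query embedding there embeds in `w` itself. -/
theorem mem_infer_iff [Infinite A] (hq : q.IsPsf) (hzz : z ≠ z')
    (hz : ∀ v w c, Walk q v w c → c.rootLab ≠ some z) (h : S.Extends (charSample q z z'))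
    (hS : S.Consistent q) (p : Twig A) : p ∈ infer S.trees ↔ p ∈ q.paths := by
  have hc := characterizes hq hzz hz h hS
  constructor
  · intro hp
    obtain ⟨⟨l, w⟩, rfl, hx⟩ := exists_minPath_of_mem_infer hp
    obtain ⟨h1, v, h2⟩ := hc.minPath_iff.1 hx
    obtain rfl : l = q.rootLab := h1
    exact mem_paths.2 ⟨v, w, h2, rfl⟩
  · intro hp
    obtain ⟨v, w, hw, rfl⟩ := mem_paths.1 hp
    obtain ⟨⟨t₀, ht₀, h1, -⟩, t, ht, h2, h3⟩ := h.exists_mem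
    have hmin : MinPath S.trees (q.rootLab, w) := hc.good.minPath v w hw
    have hroot : t.rootLab = (canon q.size z q).rootLab :=
      (match_iff.1 h3).1 |> fun h => ((match_iff.1 h2).1.antisymm h).symm
    obtain ⟨x₀, hs₀⟩ := (leafW_canon (k := q.size) (z := z)).2 ⟨v, w, hw, rfl⟩
    obtain ⟨-, x, s, hx, h4⟩ := match_ofWord.1 (hs₀.match.trans h3)
    obtain ⟨-, x₁, s₁, hx₁, h5⟩ := match_ofWord.1 (hx.match.trans h2)
    obtain ⟨v₁, w₁, hw₁, rfl⟩ := leafW_canon.1 ⟨x₁, hx₁⟩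
    have hanch := anchored_ofWord (l := q.rootLab) (hc.anch v w hw)
    have hcanon : ∀ w, ofWord (canon q.size z q).rootLab (canonWord q.size z w) =
        canon q.size z (ofWord q.rootLab w) := fun w => by rw [canon_ofWord, rootLab_canon]
    have h6 : Match (ofWord q.rootLab w) (ofWord q.rootLab w₁) := by
      refine Match.of_canons (z := z) (z' := z') hanch (hw.match.trans (match_canon q)) ?_ hzz hz
      refine (match_canon (k := q.size) (z := z) _).trans ?_
      rw [← hcanon, ← hcanon]
      exact match_ofWord_ofWord.2 ⟨fun _ => rfl, h4.trans h5⟩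
    -- The canonical word of `w` embeds in the path `s` of `t`, which in turn embeds in the
    -- canonical word of some `w₁`. Incomparability of the paths of `q` gives `w₁ = w`, and then
    -- antisymmetry determines `s`.
    obtain rfl := hc.inj _ _ _ _ hw hw₁ (match_ofWord_ofWord.1 h6).2
    obtain rfl := hw.unique hw₁
    have hseed : ofWord t.rootLab s = canon q.size z (ofWord q.rootLab w) := by
      rw [h5.antisymm h4, hroot, hcanon]
    obtain ⟨h7, ⟨l, u⟩, h8, h9⟩ := inferOne_spec ht s
    rw [hseed] at h8
    have h10 : Match (ofWord l u) (ofWord q.rootLab w) :=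
      -- The short tree comes from the sample and the long one is the added path, so the target is
      -- the path query of `w` instead of all of `q`.
      Match.of_canons (anchored_ofWord h8.anch)
        ((h8.consistent t₀ (List.mem_cons_of_mem _ ht₀)).trans h1)
        (h8.consistent _ List.mem_cons_self) hzz hz
    obtain ⟨h11, h12⟩ := match_ofWord_ofWord.1 h10
    obtain ⟨rfl, rfl⟩ := h8.minimal q.rootLab w hmin.anch (fun t' ht' => by
      rcases List.mem_cons.1 ht' with rfl | ht'
      · exact match_canon _
      · exact hmin.consistent t' ht') h11 h12
    have h13 := hmin.eq_of_match h7 h9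
    rw [mem_infer]
    refine ⟨t, ht, x, s, hx, ?_⟩
    rw [← h13]

/-! ## Running times in terms of the size of the sample -/

/-- A node costs 3, and its entry in the list of its parent at most 5 more. The root has no such
entry, which accounts for the summand 5. -/
theorem csize_add_le (q : Twig A) : csize A q + 5 ≤ 8 * q.size := by
  induction q using ind with
  | h l ks ih =>
    rw [csize_node, size_eq, csize_eq_sum]
    suffices h : (ks.map fun k => 1 + csize A k).sum ≤ 8 * (ks.map fun k => k.2.size).sum by omega
    induction ks with
    | nil => simp
    | cons k ks ih2 =>
      have h1 := ih2 fun k hk => ih k (List.mem_cons_of_mem _ hk)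
      have h2 := ih k (by simp)
      have h3 := csize_edge_le (A := A) k.1
      have h4 := csize_prod (A := A) k
      simp only [List.map_cons, List.sum_cons]
      omega

theorem csize_trees_le (S : Sample A) : csize A S.trees ≤ 1 + 8 * S.size := by
  rw [csize_eq_sum, trees, size, List.map_map]
  generalize S.1 = l
  induction l with
  | nil => simp
  | cons t l ih =>
    have := csize_add_le t.1
    simp only [List.map_cons, List.sum_cons, Function.comp_apply]
    omega

theorem enc_eq (S : Sample A) : S.enc = code S.trees := by
  rw [Sample.enc, trees]
  change _ = Data.ofList ((S.1.map Subtype.val).map Twig.enc)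
  rw [List.map_map]
  rfl

/-- The learner. -/
noncomputable def learn (S : Sample A) : Option (Twig A) := fuse S.trees (infer S.trees)

open Polynomial in
theorem exists_programs [LinearOrder A] [OrderBot A] : ∃ (M N : Prog) (T : Polynomial ℕ),
    ComputesInTime M T (fun P => Data.ofList (P.map Twig.enc)) (fun S : Sample A => infer S.trees) ∧
    ComputesInTime (.seq (.pair (.op .id) M) N) T encAnswer (learn (A := A)) := by
  obtain ⟨M, T, hM⟩ := PolyTime.infer (A := A)
  obtain ⟨N, U, hN⟩ := PolyTime.fuse (A := A)
  refine ⟨M, N, (T + (X + T + U.comp (1 + X + 3 * T) + 2)).comp (1 + 8 * X), fun S => ?_,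
    fun S => ?_⟩
  · obtain ⟨n, hn, h⟩ := hM S.trees
    refine ⟨n, hn.trans ?_, by rw [enc_eq]; exact h⟩
    have h1 := T.eval_le_eval_nat (csize_trees_le S)
    simp only [eval_comp, eval_add, eval_mul, eval_X, eval_one, eval_ofNat]
    omega
  · obtain ⟨n, hn, h⟩ := hM S.trees
    obtain ⟨m, hm, h'⟩ := hN (S.trees, infer S.trees)
    rw [enc_eq]
    refine ⟨_, ?_, .seq (.pair (.op .id _) h) h'⟩
    have h1 := csize_trees_le S
    have h2 := T.eval_le_eval_nat h1
    have h3 : csize A (infer S.trees) ≤ 3 * n := h.size_le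
    have h4 := U.eval_le_eval_nat (show csize A (S.trees, infer S.trees) ≤
      1 + (1 + 8 * S.size) + 3 * T.eval (1 + 8 * S.size) by simp only [csize_prod]; omega)
    change csize A S.trees + n + 1 + m + 1 ≤ _
    simp only [eval_comp, eval_add, eval_mul, eval_X, eval_one, eval_ofNat]
    omega

end Sample

-- Assembly of the theorem.

theorem mainTheorem3 {A : Type*} [LinearOrder A] [OrderBot A] [Infinite A] :
    ∃ (infer fuse : Prog) (paths : Sample A → List (Twig A)) (learner : Sample A → Option (Twig A))
      (time poly : Polynomial ℕ),
      -- the learner is a polynomial time algorithm: it first infers path queries from the sample,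
      -- and then fuses them, having still access to the sample
      ComputesInTime infer time (fun P => Data.ofList (P.map Twig.enc)) paths ∧
      ComputesInTime (Prog.seq (Prog.pair (Prog.op Op.id) infer) fuse) time encAnswer learner ∧
      (∀ S : Sample A, paths S ≠ [] ∧ (∀ p ∈ paths S, S.IsMinimalIn (AnchPath₀ A) p) ∧
        Twig.Reduced (paths S) ∧ S.FusionRun none (paths S) (learner S)) ∧
      -- soundness
      IsSound (PsfTwig₀ A) learner ∧
      -- completeness, with characteristic samples of polynomial size
      ∀ q ∈ PsfTwig₀ A, ∃ C : Sample A, C.size ≤ poly.eval q.size ∧ IsCharacteristic learner q C ∧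
        ∀ S : Sample A, S.Extends C → S.Consistent q →
          -- the inferred path queries are all the minimal ones, and are the paths of the goal query
          (paths S).Perm q.paths ∧ (∀ p, S.IsMinimalIn (AnchPath₀ A) p ↔ p ∈ q.paths) ∧
          -- in whatever order they are fused, ...
          ∀ P : List (Twig A), P.Perm q.paths →
            -- ... there is exactly one best choice, up to isomorphism, at every step ...
            (∀ P₁ p P₂ q₁, P = P₁ ++ p :: P₂ → S.FusionRun none P₁ q₁ →
              ∃ q₂, S.IsBestFusion p q₁ q₂ ∧ ∀ q₃, S.IsBestFusion p q₁ q₃ → q₃ ≅ₜ q₂) ∧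
            -- ... and the result is the goal query
            ∀ r, S.FusionRun none P r → ∃ q', r = some q' ∧ q' ≅ₜ q := by
  obtain ⟨M, N, T, hM, hN⟩ := Sample.exists_programs (A := A)
  have hmem : ∀ S : Sample A, ∀ p ∈ Twig.infer S.trees,
      ∃ x, p = ofWord x.1 x.2 ∧ MinPath S.trees x := fun S p => exists_minPath_of_mem_infer
  have hrun : ∀ S : Sample A, ∃ r, S.learn = some r ∧
      S.FusionRun none (Twig.infer S.trees) (some r) ∧ Good S.trees r := fun S =>
    Sample.fusionRun_fuse (nodup_infer _) (infer_ne_nil S.trees_ne_nil) (hmem S)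
  refine ⟨M, N, fun S => Twig.infer S.trees, Sample.learn, T,
    -- The first summand bounds the canonical tree without inner chain nodes, the second the one
    -- with chains as long as the size of the query.
    Polynomial.X + (Polynomial.X + 1) * Polynomial.X, hM, hN, fun S => ⟨infer_ne_nil S.trees_ne_nil,
      fun p hp => Sample.isMinimalIn_iff.2 (hmem S p hp), reduced_of_nodup (hmem S) (nodup_infer _),
      ?_⟩, fun S => ⟨fun q hq => ?_, fun h => ?_⟩, fun q hq => ?_⟩
  · obtain ⟨r, h1, h2, -⟩ := hrun S
    rwa [h1]
  · obtain ⟨r, h1, -, h3⟩ := hrun S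
    obtain rfl : q = r := Option.some_injective _ (hq.symm.trans h1)
    exact ⟨h3.isPsf, Sample.consistent_iff.2 h3.consistent⟩
  · obtain ⟨r, h1, -⟩ := hrun S
    rw [h] at h1
    cases h1
  · obtain ⟨z, z', hzz, hz⟩ := exists_fresh q
    have hperm : ∀ S : Sample A, S.Extends (Sample.charSample q z z') → S.Consistent q →
        (Twig.infer S.trees).Perm q.paths := fun S h1 h2 =>
      (List.perm_ext_iff_of_nodup (nodup_infer _) (IsPsf.reduced hq).nodup).2
        (Sample.mem_infer_iff hq hzz hz h1 h2)
    have hres : ∀ S : Sample A, S.Extends (Sample.charSample q z z') → S.Consistent q →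
        ∀ P : List (Twig A), P.Perm q.paths → ∀ r, S.FusionRun none P r →
          ∃ q', r = some q' ∧ q' ≅ₜ q := by
      intro S h1 h2 P hP r hr
      have hc := Sample.characterizes hq hzz hz h1 h2
      exact (Sample.Faithful.run hc hr (W := []) rfl
        (hP.nodup_iff.2 (IsPsf.reduced hq).nodup) fun p hp => hP.mem_iff.1 hp).iso hc
          fun p => hP.mem_iff
    refine ⟨Sample.charSample q z z', ?_, ⟨Sample.charSample_consistent, fun S h1 h2 => ?_⟩,
      fun S h1 h2 => ⟨hperm S h1 h2, fun p => ?_, fun P hP => ⟨?_, hres S h1 h2 P hP⟩⟩⟩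
    · simpa using Sample.size_charSample_le (q := q) (z := z) (z' := z')
    · obtain ⟨r, h3, h4, -⟩ := hrun S
      -- The uniqueness for all orders and all choices is applied to the run of the learner.
      obtain ⟨q', h5, h6⟩ := hres S h1 h2 _ (hperm S h1 h2) _ h4
      refine ⟨q', h3.trans h5, fun t ht => ?_, fun t ht => ?_⟩
      · exact Subsumed.trans ht h6.symm.subsumed
      · exact Subsumed.trans ht h6.subsumed
    · have hc := Sample.characterizes hq hzz hz h1 h2
      rw [Sample.isMinimalIn_iff, mem_paths]
      constructor
      · rintro ⟨⟨l, w⟩, rfl, hx⟩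
        obtain ⟨h3, v, h4⟩ := hc.minPath_iff.1 hx
        obtain rfl : l = q.rootLab := h3
        exact ⟨v, w, h4, rfl⟩
      · rintro ⟨v, w, h3, rfl⟩
        exact ⟨(q.rootLab, w), rfl, hc.minPath_iff.2 ⟨rfl, v, h3⟩⟩
    · rintro P₁ p P₂ q₁ rfl h3
      have hc := Sample.characterizes hq hzz hz h1 h2
      have hnd := hP.nodup_iff.2 (IsPsf.reduced hq).nodup
      rw [List.nodup_append] at hnd
      obtain ⟨r, h4, h5⟩ := (Sample.Faithful.run hc h3 (W := []) rfl hnd.1 fun p hp =>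
        hP.mem_iff.1 (List.mem_append_left _ hp)).step hc
          (hP.mem_iff.1 (by simp)) fun hp => hnd.2.2 p hp p (by simp) rfl
      exact ⟨r, h4, fun r' hr' => (h5 r' hr').1⟩
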